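/- Let $0\le k\le m$, let $U$ be an open neighbourhood of the origin in $\mathbb C^m$, $f=t_1\cdots t_k$ and $\varSigma=\{f=0\}$. Let $\Omega=\sum_{i=1}^m\Omega_i\,dt_i$ be an $n\times n$-matrix 1-form that is meromorphic in $U$ with polar set in $\varSigma$ (holomorphic in $U\smallsetminus\varSigma$, and near each $a\in U\cap\varSigma$ some $f^r\Omega$ extends holomorphically). Assume: (1) $\Omega$ is integrable: $d\Omega=\Omega\wedge\Omega$ in $U\smallsetminus\varSigma$. (2) $\Omega$ has a regular singularity on $\varSigma$: for every simply connected semianalytic set $S\subseteq U\smallsetminus\varSigma$ with compact closure contained in $U$, and every branch on $S$ of a fundamental matrix solution $X$ of $dX=\Omega X$ (a holomorphic solution with values in $\mathrm{GL}(n,\mathbb C)$ on a neighbourhood of $S$ in $U\smallsetminus\varSigma$), there are constants $c>0$ and $r\in\mathbb R$, depending on $X$ and $S$, with $|X(t)|\le c\,|f(t)|^{-r}$ for all $t\in S$. Then every formal Laurent solution of $dx=\Omega x$ converges and so is meromorphic. Precisely, let $\sum_{a\in\mathbb Z^m}x_a t^a$, $x_a\in\mathbb C^n$, be a formal series such that $x_a\ne0$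 implies $a_{k+1},\dots,a_m\ge0$ and such that for every $e\in\mathbb Z^m$ only finitely many $a\le e$ (coordinatewise) have $x_a\neq0$; this includes all series whose exponents are bounded below, and all sums of weighted homogeneous Laurent polynomials whose degrees with respect to some positive weights tend to $+\infty$. Suppose that the series satisfies $dx=\Omega x$ formally, $\Omega$ being replaced by its Laurent expansion at $0$. Then there are an open neighbourhood $V\subseteq U$ of $0$ and a function $F$ with values in $\mathbb C^n$, meromorphic in $V$ with polar set in $\varSigma$, such that $F$ is a holomorphic solution of $dx=\Omega x$ in $V\smallsetminus\varSigma$ and the given series is the Laurent expansion of $F$ at $0$: the exponents of its nonzero terms are bounded below, and it converges absolutely to $F$ outside $\varSigma$ in some polydisc centred at $0$. -/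

import Mathlib

open scoped Topology Matrix

namespace PfaffianSystem

variable {m n : ℕ}

/-- The equation `f(t) = t₁ ⋯ t_k` of the coordinate cross in `ℂ^m`
(the coordinates with index `0, …, k - 1`). -/
def crossEq (k : ℕ) (t : Fin m → ℂ) : ℂ :=
  ∏ i ∈ Finset.univ.filter (fun i : Fin m => (i : ℕ) < k), t i

/-- The coordinate cross `Σ = {t₁ ⋯ t_k = 0}` in `ℂ^m`. -/
def cross (m k : ℕ) : Set (Fin m → ℂ) :=
  {t | crossEq k t = 0}

/-- The partial derivative `∂g/∂t_i` at `t`. -/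
noncomputable def partialDeriv (i : Fin m) (g : (Fin m → ℂ) → ℂ) (t : Fin m → ℂ) : ℂ :=
  fderiv ℂ g t (Pi.single i 1)

/-- `g` is meromorphic in the open set `U` with polar set in the coordinate cross: it is holomorphic
in `U ∖ Σ`, and near each point of `U ∩ Σ` some product `f ^ r * g` extends holomorphically.
The values of `g` on `Σ` are irrelevant. -/
def IsMeromorphicOn (k : ℕ) (U : Set (Fin m → ℂ)) (g : (Fin m → ℂ) → ℂ) : Prop :=
  AnalyticOnNhd ℂ g (U \ cross m k) ∧
    ∀ a ∈ U ∩ cross m k, ∃ (r : ℕ) (h : (Fin m → ℂ) → ℂ), AnalyticAt ℂ h a ∧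
      ∀ᶠ t in 𝓝[(cross m k)ᶜ] a, h t = crossEq k t ^ r * g t

/-- A matrix-valued 1-form `Ω = ∑ i, Ω i dt_i` on (a part of) `ℂ^m`, given by its coefficients
`Ω i`, which are `n × n`-matrix functions. -/
abbrev MatrixForm (m n : ℕ) : Type :=
  Fin m → (Fin m → ℂ) → Matrix (Fin n) (Fin n) ℂ

/-- All entries of the matrix 1-form `Ω` are meromorphic in `U` with polar set in the cross. -/
def MatrixForm.IsMeromorphicOn (k : ℕ) (U : Set (Fin m → ℂ)) (Ω : MatrixForm m n) : Prop :=
  ∀ i p q, PfaffianSystem.IsMeromorphicOn k U (fun t => Ω i t p q)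

/-- The integrability condition `dΩ = Ω ∧ Ω` at all points of `W`: the coefficients of
`dt_i ∧ dt_j` of the two matrix 2-forms agree. -/
def MatrixForm.IsIntegrableOn (Ω : MatrixForm m n) (W : Set (Fin m → ℂ)) : Prop :=
  ∀ t ∈ W, ∀ i j p q,
    partialDeriv i (fun s => Ω j s p q) t - partialDeriv j (fun s => Ω i s p q) t =
      (Ω i t * Ω j t - Ω j t * Ω i t) p q

/-- `x` is a holomorphic solution of `dx = Ω x` on the open set `W`. -/
def IsSolutionOn (Ω : MatrixForm m n) (W : Set (Fin m → ℂ)) (x : (Fin m → ℂ) → Fin n → ℂ) :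
    Prop :=
  (∀ p, AnalyticOnNhd ℂ (fun t => x t p) W) ∧
    ∀ t ∈ W, ∀ i p, partialDeriv i (fun s => x s p) t = (Ω i t *ᵥ x t) p

/-- `X` is a fundamental matrix solution on the open set `W`: a holomorphic matrix function with
values in `GL(n, ℂ)` such that `dX = Ω X`. -/
def IsFundamentalSolutionOn (Ω : MatrixForm m n) (W : Set (Fin m → ℂ))
    (X : (Fin m → ℂ) → Matrix (Fin n) (Fin n) ℂ) : Prop :=
  (∀ p q, AnalyticOnNhd ℂ (fun t => X t p q) W) ∧
    (∀ t ∈ W, IsUnit (X t).det) ∧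
    ∀ t ∈ W, ∀ i p q, partialDeriv i (fun s => X s p q) t = (Ω i t * X t) p q

/-- Semianalytic subsets of a real normed space: near every point of the space, the set is a finite
union of sets, each given by finitely many equations `g = 0` and inequalities `h > 0` with real
analytic functions `g`, `h`. -/
def IsSemianalytic {E : Type*} [NormedAddCommGroup E] [NormedSpace ℝ E] (S : Set E) : Prop :=
  ∀ a : E, ∃ V : Set E, IsOpen V ∧ a ∈ V ∧
    ∃ (r s : ℕ) (g h : Fin r → Fin s → E → ℝ),
      (∀ i j, AnalyticOnNhd ℝ (g i j) V ∧ AnalyticOnNhd ℝ (h i j) V) ∧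
      ∀ z ∈ V, z ∈ S ↔ ∃ i, ∀ j, g i j z = 0 ∧ 0 < h i j z

/-- The system `dX = Ω X` on `U ∖ Σ` has a regular singularity on the cross `Σ`: on every simply
connected semianalytic set `S ⊆ U ∖ Σ` which is bounded in `U` (relatively compact in `U`), every
(branch of a) fundamental solution `X`, that is, every fundamental solution holomorphic in a
neighbourhood `W` of `S` in `U ∖ Σ`, satisfies `|X(t)| ≤ c |f(t)| ^ (-r)` on `S` for some `c`, `r`
that may depend on `X` and `S`. -/
def HasRegularSingularity (k : ℕ) (U : Set (Fin m → ℂ)) (Ω : MatrixForm m n) : Prop :=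
  ∀ S : Set (Fin m → ℂ), S ⊆ U \ cross m k → IsSemianalytic S → IsSimplyConnected S →
    IsCompact (closure S) → closure S ⊆ U →
    ∀ (W : Set (Fin m → ℂ)) (X : (Fin m → ℂ) → Matrix (Fin n) (Fin n) ℂ),
      IsOpen W → S ⊆ W → W ⊆ U \ cross m k → IsFundamentalSolutionOn Ω W X →
      ∃ c r : ℝ, 0 < c ∧ ∀ t ∈ S, ∀ p q, ‖X t p q‖ ≤ c * ‖crossEq k t‖ ^ (-r)

/-- The family `c` of coefficients, indexed by exponents `a ∈ ℤ^m`, is the Laurent expansion of `g`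
at the origin: the exponents of `t₁, …, t_k` are bounded below, those of the other variables are
nonnegative, and `∑ a, c a * t ^ a` converges (absolutely) to `g t` at all points `t` outside the
cross in some polydisc centred at the origin. -/
def HasLaurentExpansion (k : ℕ) (g : (Fin m → ℂ) → ℂ) (c : (Fin m → ℤ) → ℂ) : Prop :=
  (∃ N : ℕ, ∀ a, c a ≠ 0 → ∀ i : Fin m, (if (i : ℕ) < k then -(N : ℤ) else 0) ≤ a i) ∧
    ∃ ρ : ℝ, 0 < ρ ∧ ∀ t : Fin m → ℂ, (∀ i, ‖t i‖ < ρ) → t ∉ cross m k →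
      HasSum (fun a : Fin m → ℤ => c a * ∏ i, t i ^ a i) (g t)

/-- Formal vector Laurent series `∑ a, x a * t ^ a` (`a ∈ ℤ^m`, `x a ∈ ℂ^n`), involving only
nonnegative powers of the variables after the `k`-th one, and with only finitely many nonzero terms
whose exponent is `≤ e` coordinatewise, for every `e`; the latter is what makes the product with an
ordinary Laurent series meaningful. These include the series with a pole of finite
order on the cross (exponents bounded below), and the sums of
weighted homogeneous Laurent polynomials whose degrees, for some positive weights, tend to `+∞`. -/
def IsFormalLaurentSeries (k : ℕ) (x : (Fin m → ℤ) → Fin n → ℂ) : Prop :=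
  (∀ a, x a ≠ 0 → ∀ i : Fin m, k ≤ (i : ℕ) → 0 ≤ a i) ∧
    ∀ e : Fin m → ℤ, {a | x a ≠ 0 ∧ a ≤ e}.Finite

/-- The formal Laurent series `x` satisfies `dx = Ω x`, where `Ω` is replaced by its Laurent
expansion `Ω i = ∑ a, A i a * t ^ a`: the coefficients of `t ^ e` in `∂x/∂t_i` and in `Ω i * x`
are equal. The sum on the right has finitely many nonzero terms for `x` as in
`IsFormalLaurentSeries`. -/
def IsFormalSolution (k : ℕ) (Ω : MatrixForm m n) (x : (Fin m → ℤ) → Fin n → ℂ) : Prop :=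
  ∃ A : Fin m → (Fin m → ℤ) → Matrix (Fin n) (Fin n) ℂ,
    (∀ i p q, HasLaurentExpansion k (fun t => Ω i t p q) (fun a => A i a p q)) ∧
    ∀ (i : Fin m) (e : Fin m → ℤ),
      ((e i : ℂ) + 1) • x (e + Pi.single i 1) = ∑ᶠ a : Fin m → ℤ, A i (e - a) *ᵥ x a

end PfaffianSystem

/-!
Formal Laurent solutions of a system `dx = Ω x` with a regular singularity on the coordinate cross
converge because the system can be transformed into one with constant coefficients by a matrix that
is itself meromorphic.

In the logarithmic coordinates `s_i = log t_i` (`i < k`) the system lives on a convex set, where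
integrability yields a fundamental solution `Y` (`exists_fundamental_pair`). It is invariant under
the translations by `2πi`, so `Y` has commuting monodromy matrices, these have commuting logarithms
(`exists_commuting_logs`), and `Y = Φ(t) exp(∑ A_i log t_i)` with a single-valued `Φ`
(`exists_floquet`). On products of half discs, which are simply connected and semianalytic,
regularity bounds `Y` by a power of `f = t_1 ⋯ t_k`; finitely many of them cover the
complement of the cross, so `Φ` has moderate growth (`exists_moderate_frame`) and hence, by
the Riemann extension theorem, is meromorphic.

The same holds for `Ψ = Φ⁻¹`, although nothing is assumed on the growth of `Y⁻¹`: the determinant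
`G = det Φ` satisfies `t_i ∂G/∂t_i = ω_i G` with a Laurent series `ω_i`, and comparison of
the lowest exponents shows that `ω_i` has no negative ones (`nonneg_of_euler_eq_conv`), so it is
bounded, and Gronwall's inequality bounds `1 / G` by a power of `1 / f` (`isModerate_inv`).

Let `x` be a formal solution. Since `t_i ∂Ψ/∂t_i = A_i Ψ - Ψ (t_i Ω_i)`, the formal product
`y = Ψ x` satisfies `t_i ∂y/∂t_i = A_i y`, that is, `e_i y_e = A_i y_e` for all
exponents `e`. Thus `|e_i| ≤ ‖A_i‖` whenever `y_e ≠ 0`: only finitely many `y_e` are nonzero, `y` is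
a Laurent polynomial, and `x = Φ y` converges (`exists_moderate_solution`).
-/

namespace PfaffianSystem

open MeasureTheory Metric Set

/-! ### Holomorphic functions of several variables -/

section Osgood

variable {E : Type*} [NormedAddCommGroup E] [NormedSpace ℂ E]

lemma torusMap_mem_closedBall {m : ℕ} (c : Fin m → ℂ) {R : ℝ} (hR : 0 ≤ R) (θ : Fin m → ℝ) :
    torusMap c (fun _ => R) θ ∈ closedBall c R := by
  rw [mem_closedBall, dist_pi_le_iff hR]
  intro i
  simp [torusMap, dist_eq_norm, Complex.norm_exp_ofReal_mul_I, abs_of_nonneg hR]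

lemma torusMap_apply_ne {m : ℕ} {c w : Fin m → ℂ} {R : ℝ} (hw : w ∈ ball c R)
    (θ : Fin m → ℝ) (i : Fin m) : torusMap c (fun _ => R) θ i - w i ≠ 0 := by
  intro h
  have hR : 0 < R := dist_nonneg.trans_lt hw
  have h1 : dist (w i) (c i) < R := (dist_le_pi_dist w c i).trans_lt hw
  rw [← sub_eq_zero.1 h] at h1
  simp [torusMap, dist_eq_norm, Complex.norm_exp_ofReal_mul_I, abs_of_pos hR] at h1

lemma continuous_torusMap {m : ℕ} (c : Fin m → ℂ) (R : Fin m → ℝ) : Continuous (torusMap c R) := by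
  unfold torusMap
  fun_prop

lemma torusIntegrable_cauchy {m : ℕ} {h : (Fin m → ℂ) → E} {c : Fin m → ℂ} {R : ℝ}
    (hc : ContinuousOn h (closedBall c R)) {w : Fin m → ℂ} (hw : w ∈ ball c R) :
    TorusIntegrable (fun ζ => (∏ i, (ζ i - w i))⁻¹ • h ζ) c (fun _ => R) := by
  have hR : 0 < R := dist_nonneg.trans_lt hw
  refine (Continuous.continuousOn ?_).integrableOn_compact isCompact_Icc
  refine Continuous.smul (Continuous.inv₀ ?_ ?_) ?_
  · have := continuous_torusMap c (fun _ => R)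
    fun_prop
  · intro θ
    exact Finset.prod_ne_zero_iff.2 fun i _ => torusMap_apply_ne hw θ i
  · exact hc.comp_continuous (continuous_torusMap c _) (torusMap_mem_closedBall c hR.le)

/-- Cauchy's integral formula on a polydisc, for a continuous function which is holomorphic in
each variable separately. -/
theorem torusIntegral_cauchy [CompleteSpace E] {m : ℕ} {h : (Fin m → ℂ) → E} {c : Fin m → ℂ}
    {R : ℝ} (hc : ContinuousOn h (closedBall c R))
    (hd : ∀ t ∈ closedBall c R, ∀ i,
      DifferentiableOn ℂ (fun z => h (Function.update t i z)) (ball (c i) R))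
    {w : Fin m → ℂ} (hw : w ∈ ball c R) :
    (∯ ζ in T(c, fun _ => R), (∏ i, (ζ i - w i))⁻¹ • h ζ) =
      (2 * Real.pi * Complex.I : ℂ) ^ m • h w := by
  have hR : 0 < R := dist_nonneg.trans_lt hw
  induction m with
  | zero => rw [torusIntegral_dim0]; simp [Subsingleton.elim c w]
  | succ m ih =>
    rw [torusIntegral_succ (torusIntegrable_cauchy hc hw)]
    have hw' : Fin.tail w ∈ ball (c ∘ Fin.succ) R := by
      rw [mem_ball, dist_pi_lt_iff hR]
      exact fun i => (dist_le_pi_dist w c i.succ).trans_lt hw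
    have hmem : ∀ (x : ℂ) (y : Fin m → ℂ), x ∈ closedBall (c 0) R →
        y ∈ closedBall (c ∘ Fin.succ) R → (Fin.cons x y : Fin (m + 1) → ℂ) ∈ closedBall c R := by
      intro x y hx hy
      rw [mem_closedBall, dist_pi_le_iff hR.le] at hy ⊢
      intro i
      refine Fin.cases ?_ (fun i => ?_) i
      · simpa using hx
      · simpa using hy i
    have key : ∀ x ∈ sphere (c 0) R,
        (∯ y in T(c ∘ Fin.succ, (fun _ => R) ∘ Fin.succ),
          (∏ i, ((Fin.cons x y : Fin (m + 1) → ℂ) i - w i))⁻¹ • h (Fin.cons x y)) =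
        (2 * Real.pi * Complex.I : ℂ) ^ m • ((x - w 0)⁻¹ • h (Function.update w 0 x)) := by
      intro x hx
      have hx' := sphere_subset_closedBall hx
      have := ih (h := fun y => h (Fin.cons x y)) (c := c ∘ Fin.succ) (w := Fin.tail w) ?_ ?_ hw'
      · simp only [Fin.prod_univ_succ, Fin.cons_zero, Fin.cons_succ, mul_inv, mul_smul]
        rw [torusIntegral_smul]
        simp only [Function.comp_def] at this ⊢
        simp only [Fin.tail] at this
        rw [this, smul_comm]
        congr 3
        rw [← Fin.update_cons_zero (w 0), Fin.cons_self_tail]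
      · refine hc.comp ?_ (fun y hy => hmem x y hx' hy)
        exact Continuous.continuousOn (by fun_prop)
      · intro t ht i
        have := hd _ (hmem x t hx' ht) i.succ
        simp only [Fin.cons_update]
        exact this
    rw [circleIntegral.integral_congr hR.le key, circleIntegral.integral_smul,
      Complex.circleIntegral_sub_inv_smul_of_differentiable_on_off_countable countable_empty
        (f := fun z => h (Function.update w 0 z)) (w := w 0), smul_smul, ← pow_succ]
    · simp
    · exact (dist_le_pi_dist w c 0).trans_lt hw
    · refine hc.comp (Continuous.continuousOn (by fun_prop)) fun z hz => ?_
      rw [← Fin.cons_self_tail w, Fin.update_cons_zero]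
      exact hmem _ _ hz (ball_subset_closedBall hw')
    · intro z hz
      exact (hd w (ball_subset_closedBall hw) 0).differentiableAt (isOpen_ball.mem_nhds hz.1)

/-- Osgood's lemma on a closed polydisc: the Cauchy kernel depends analytically on the evaluation
point, as an element of the Banach algebra of continuous functions on the torus. -/
theorem analyticAt_of_continuousOn_closedBall [CompleteSpace E] {m : ℕ} {h : (Fin m → ℂ) → E}
    {c : Fin m → ℂ} {R : ℝ} (hR : 0 < R) (hc : ContinuousOn h (closedBall c R))
    (hd : ∀ t ∈ closedBall c R, ∀ i,
      DifferentiableOn ℂ (fun z => h (Function.update t i z)) (ball (c i) R)) :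
    AnalyticAt ℂ h c := by
  set B : Set (Fin m → ℝ) := Icc 0 fun _ => 2 * Real.pi
  have : CompactSpace B := isCompact_iff_compactSpace.1 isCompact_Icc
  set μ : Measure B := (volume : Measure (Fin m → ℝ)).comap Subtype.val with hμ
  have : IsFiniteMeasure μ := by
    constructor
    rw [hμ, (MeasurableEmbedding.subtype_coe measurableSet_Icc).comap_apply]
    rw [image_univ, Subtype.range_coe]
    exact isCompact_Icc.measure_lt_top
  -- the density of the Cauchy integral on the torus
  set k : C(B, E) := ⟨fun θ => (∏ i, (R : ℂ) * Complex.exp (θ.1 i * Complex.I) * Complex.I) •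
    h (torusMap c (fun _ => R) θ.1), by
      refine Continuous.smul (continuous_finsetProd _ fun i _ => ?_) ?_
      · exact (continuous_const.mul (Complex.continuous_exp.comp
          ((Complex.continuous_ofReal.comp ((continuous_apply i).comp
            continuous_subtype_val)).mul continuous_const))).mul continuous_const
      exact hc.comp_continuous ((continuous_torusMap c _).comp continuous_subtype_val)
        fun θ => torusMap_mem_closedBall c hR.le _⟩
  have hint : ∀ g : C(B, ℂ), Integrable (fun θ => g θ • k θ) μ := fun g =>
    (g • k).continuous.integrable_of_hasCompactSupport (HasCompactSupport.of_compactSpace _)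
  let Λ₀ : C(B, ℂ) →ₗ[ℂ] E :=
    { toFun := fun g => ∫ θ, g θ • k θ ∂μ
      map_add' := fun g₁ g₂ => by
        rw [← integral_add (hint g₁) (hint g₂)]; simp [add_smul]
      map_smul' := fun a g => by
        rw [RingHom.id_apply, ← integral_smul]; simp [mul_smul] }
  let Λ : C(B, ℂ) →L[ℂ] E := Λ₀.mkContinuous (‖k‖ * μ.real univ) fun g => by
    have := norm_integral_le_of_norm_le_const (μ := μ) (f := fun θ => g θ • k θ) (C := ‖g‖ * ‖k‖)
      (Filter.Eventually.of_forall fun θ => by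
        rw [norm_smul]
        exact mul_le_mul (g.norm_coe_le_norm θ) (k.norm_coe_le_norm θ) (norm_nonneg _)
          (norm_nonneg _))
    calc _ ≤ _ := this
      _ = _ := by ring
  let κ : Fin m → C(B, ℂ) := fun i => ⟨fun θ => torusMap c (fun _ => R) θ.1 i, by
    have := continuous_torusMap c (fun _ => R)
    fun_prop⟩
  let K : (Fin m → ℂ) → C(B, ℂ) := fun w =>
    ∏ i, Ring.inverse (κ i - algebraMap ℂ C(B, ℂ) (w i))
  have hunit : ∀ w ∈ ball c R, ∀ i, IsUnit (κ i - algebraMap ℂ C(B, ℂ) (w i)) := fun w hw i =>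
    ContinuousMap.isUnit_iff_forall_ne_zero _ |>.2 fun θ => torusMap_apply_ne hw θ.1 i
  have hK : AnalyticAt ℂ K c := by
    refine Finset.analyticAt_fun_prod _ fun i _ => ?_
    obtain ⟨u, hu⟩ := hunit c (mem_ball_self hR) i
    have h1 := analyticAt_inverse (𝕜 := ℂ) u
    rw [hu] at h1
    refine h1.comp (f := fun w : Fin m → ℂ => κ i - algebraMap ℂ C(B, ℂ) (w i)) (x := c) ?_
    refine analyticAt_const.sub ?_
    exact ((Algebra.linearMap ℂ C(B, ℂ)).toContinuousLinearMap.comp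
      (ContinuousLinearMap.proj (R := ℂ) (φ := fun _ : Fin m => ℂ) i)).analyticAt c
  have heval : ∀ w ∈ ball c R, ∀ θ, K w θ = (∏ i, (torusMap c (fun _ => R) θ.1 i - w i))⁻¹ := by
    intro w hw θ
    simp only [K, ContinuousMap.prod_apply, ← Finset.prod_inv_distrib]
    refine Finset.prod_congr rfl fun i _ => ?_
    have := Ring.inverse_mul_cancel _ (hunit w hw i)
    have := congrArg (fun g : C(B, ℂ) => g θ) this
    exact eq_inv_of_mul_eq_one_left this
  have hfin : AnalyticAt ℂ (fun w => ((2 * Real.pi * Complex.I : ℂ) ^ m)⁻¹ • Λ (K w)) c :=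
    analyticAt_const.smul ((Λ.analyticAt _).comp hK)
  refine hfin.congr ?_
  filter_upwards [isOpen_ball.mem_nhds (mem_ball_self hR)] with w hw
  have h1 := torusIntegral_cauchy hc hd hw
  rw [inv_smul_eq_iff₀ (by simp [Real.pi_ne_zero]), ← h1]
  change ∫ θ, K w θ • k θ ∂μ = _
  rw [torusIntegral, ← integral_subtype_comap measurableSet_Icc]
  refine integral_congr_ae (Filter.Eventually.of_forall fun θ => ?_)
  simp only [heval w hw θ, k, ContinuousMap.coe_mk]
  rw [smul_comm]

/-- Osgood's lemma: a continuous function on an open subset of `ℂ^m` which is holomorphic in each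
variable separately is analytic. -/
theorem analyticOnNhd_of_continuousOn [CompleteSpace E] {m : ℕ} {h : (Fin m → ℂ) → E}
    {U : Set (Fin m → ℂ)} (hU : IsOpen U) (hc : ContinuousOn h U)
    (hd : ∀ t ∈ U, ∀ i, DifferentiableAt ℂ (fun z => h (Function.update t i z)) (t i)) :
    AnalyticOnNhd ℂ h U := by
  intro c hcU
  obtain ⟨R, hR, hsub⟩ := nhds_basis_closedBall.mem_iff.1 (hU.mem_nhds hcU)
  refine analyticAt_of_continuousOn_closedBall hR (hc.mono hsub) fun t ht i z hz => ?_
  have hmem : Function.update t i z ∈ closedBall c R := by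
    rw [mem_closedBall, dist_pi_le_iff hR.le] at ht ⊢
    intro j
    rcases eq_or_ne j i with rfl | hj
    · simpa using hz.le
    · simpa [hj] using ht j
  have := hd _ (hsub hmem) i
  simp only [Function.update_idem, Function.update_self] at this
  exact this.differentiableWithinAt

/-- Complex differentiable functions on an open subset of `ℂ^m` are analytic. -/
theorem analyticOnNhd_of_differentiableOn [CompleteSpace E] {m : ℕ} {h : (Fin m → ℂ) → E}
    {U : Set (Fin m → ℂ)} (hU : IsOpen U) (hd : DifferentiableOn ℂ h U) :
    AnalyticOnNhd ℂ h U := by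
  refine analyticOnNhd_of_continuousOn hU hd.continuousOn fun t ht i => ?_
  have h1 : DifferentiableAt ℂ h (Function.update t i (t i)) := by
    rw [Function.update_eq_self]
    exact hd.differentiableAt (hU.mem_nhds ht)
  exact h1.comp (t i) (hasFDerivAt_update t (t i)).differentiableAt

end Osgood

/-! ### Monomial expansions and functions of moderate growth along the cross -/

section Expansion

lemma hasSum_of_eq {ι : Type*} {f g : ι → ℂ} {a : ℂ} (hf : HasSum f a) (h : ∀ i, g i = f i) :
    HasSum g a :=
  (funext h : g = f) ▸ hf

/-- The function `t ↦ p (t, …, t)` of a multilinear map, expanded into monomials. -/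
lemma multilinear_diag_eq_sum {m N : ℕ}
    (p : ContinuousMultilinearMap ℂ (fun _ : Fin N => Fin m → ℂ) ℂ)
    (t : Fin m → ℂ) :
    p (fun _ => t) = ∑ φ : Fin N → Fin m, p (fun j => Pi.single (φ j) 1) * ∏ j, t (φ j) := by
  have h1 : (fun _ : Fin N => t) = fun _ => ∑ i : Fin m, t i • (Pi.single i 1 : Fin m → ℂ) := by
    funext _
    exact (pi_eq_sum_univ' t).trans (by simp)
  rw [h1, p.map_sum]
  refine Finset.sum_congr rfl fun φ _ => ?_
  rw [p.map_smul_univ, smul_eq_mul, mul_comm]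

/-- A function which is analytic at the origin of `ℂ^m` is the sum of an absolutely convergent
series of monomials in some polydisc. -/
theorem exists_hasSum_monomial {m : ℕ} {h : (Fin m → ℂ) → ℂ} (hh : AnalyticAt ℂ h 0) :
    ∃ (c : (Fin m → ℕ) → ℂ) (ρ : ℝ), 0 < ρ ∧ ∀ t : Fin m → ℂ, (∀ i, ‖t i‖ < ρ) →
      HasSum (fun a => c a * ∏ i, t i ^ a i) (h t) := by
  obtain ⟨p, r, hp⟩ := hh
  obtain ⟨r', hr'0, hr'⟩ := ENNReal.lt_iff_exists_nnreal_btwn.1 hp.r_pos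
  have hr'pos : 0 < (r' : ℝ) := by exact_mod_cast hr'0
  -- each of the `m ^ n` monomials of degree `n` is bounded by `‖p n‖ * ‖t‖ ^ n`
  set ρ : ℝ := r' / (m + 1) with hρ
  have hm : (0 : ℝ) < m + 1 := by positivity
  have hρ0 : 0 < ρ := by positivity
  let cnt : (Σ N, (Fin N → Fin m)) → (Fin m → ℕ) := fun x i =>
    (Finset.univ.filter fun j => x.2 j = i).card
  let q : (Σ N, (Fin N → Fin m)) → ℂ := fun x => p x.1 (fun j => Pi.single (x.2 j) 1)
  refine ⟨fun a => ∑' x : cnt ⁻¹' {a}, q x, ρ, hρ0, fun t ht => ?_⟩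
  have htn : ‖t‖ ≤ ρ := (pi_norm_le_iff_of_nonneg hρ0.le).2 fun i => (ht i).le
  have hmon : ∀ x : Σ N, (Fin N → Fin m), ∏ j, t (x.2 j) = ∏ i, t i ^ cnt x i := by
    intro x
    rw [← Finset.prod_fiberwise (s := Finset.univ) (g := x.2)]
    refine Finset.prod_congr rfl fun i _ => ?_
    rw [Finset.prod_congr rfl (g := fun _ => t i) (by simp +contextual), Finset.prod_const]
  have hbound : ∀ x : Σ N, (Fin N → Fin m), ‖q x * ∏ j, t (x.2 j)‖ ≤ ‖p x.1‖ * ρ ^ x.1 := by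
    intro x
    rw [norm_mul, norm_prod]
    refine mul_le_mul ?_ ?_ (by positivity) (norm_nonneg _)
    · refine ((p x.1).le_opNorm _).trans (mul_le_of_le_one_right (norm_nonneg _) ?_)
      refine Finset.prod_le_one (fun _ _ => norm_nonneg _) fun j _ => ?_
      refine (pi_norm_le_iff_of_nonneg zero_le_one).2 fun i => ?_
      rw [Pi.single_apply]
      split_ifs <;> simp
    · calc ∏ j, ‖t (x.2 j)‖ ≤ ∏ _j : Fin x.1, ρ :=
            Finset.prod_le_prod (fun _ _ => norm_nonneg _) fun j _ => (ht _).le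
        _ = ρ ^ x.1 := by simp
  have hsum0 : Summable fun x : Σ N, (Fin N → Fin m) => ‖p x.1‖ * ρ ^ x.1 := by
    refine (summable_sigma_of_nonneg fun x => by positivity).2
      ⟨fun N => (hasSum_fintype _).summable, ?_⟩
    have h2 := p.summable_norm_mul_pow (hr'.trans_le hp.r_le)
    refine Summable.of_nonneg_of_le (fun N => by positivity) (fun N => ?_) h2
    change (∑' _ : Fin N → Fin m, ‖p N‖ * ρ ^ N) ≤ _
    rw [tsum_fintype, Finset.sum_const, Finset.card_univ, Fintype.card_fun, Fintype.card_fin,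
      Fintype.card_fin, nsmul_eq_mul, Nat.cast_pow]
    have h3 : (m : ℝ) * ρ ≤ r' := by
      rw [hρ, mul_div_assoc', div_le_iff₀ hm]
      nlinarith
    calc (m : ℝ) ^ N * (‖p N‖ * ρ ^ N) = ‖p N‖ * (m * ρ) ^ N := by rw [mul_pow]; ring
      _ ≤ ‖p N‖ * (r' : ℝ) ^ N := by gcongr
  have hsum : Summable fun x : Σ N, (Fin N → Fin m) => q x * ∏ j, t (x.2 j) :=
    Summable.of_norm_bounded hsum0 hbound
  have htot : HasSum (fun x : Σ N, (Fin N → Fin m) => q x * ∏ j, t (x.2 j)) (h t) := by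
    have h4 := hsum.hasSum.sigma fun N => hasSum_fintype _
    have hball : t ∈ eball (0 : Fin m → ℂ) r := by
      rw [mem_eball, edist_zero_right]
      refine lt_of_le_of_lt ?_ hr'
      rw [enorm_le_coe]
      refine htn.trans ?_
      rw [hρ, div_le_iff₀ hm]
      exact le_mul_of_one_le_right r'.2 (le_add_of_nonneg_left m.cast_nonneg)
    have h5 := hp.hasSum hball
    rw [zero_add] at h5
    have h6 : (fun N => p N fun _ => t) =
        fun N => ∑ φ : Fin N → Fin m, q ⟨N, φ⟩ * ∏ j, t (φ j) :=
      funext fun N => multilinear_diag_eq_sum (p N) t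
    rw [h6] at h5
    rw [← h4.unique h5]
    exact hsum.hasSum
  have := htot.tsum_fiberwise cnt
  refine hasSum_of_eq this fun a => ?_
  rw [← tsum_mul_right]
  refine tsum_congr fun x => ?_
  rw [hmon, x.2]

end Expansion

section Moderate

variable {m n k : ℕ}

lemma mem_cross_iff {t : Fin m → ℂ} : t ∈ cross m k ↔ ∃ i : Fin m, (i : ℕ) < k ∧ t i = 0 := by
  simp [cross, crossEq, Finset.prod_eq_zero_iff]

lemma notMem_cross_iff {t : Fin m → ℂ} :
    t ∉ cross m k ↔ ∀ i : Fin m, (i : ℕ) < k → t i ≠ 0 := by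
  simp [mem_cross_iff]

lemma crossEq_ne_zero {t : Fin m → ℂ} (ht : t ∉ cross m k) : crossEq k t ≠ 0 := ht

lemma differentiable_crossEq : Differentiable ℂ (crossEq k : (Fin m → ℂ) → ℂ) := by
  unfold crossEq
  fun_prop

lemma continuous_crossEq : Continuous (crossEq k : (Fin m → ℂ) → ℂ) :=
  differentiable_crossEq.continuous

lemma isClosed_cross : IsClosed (cross m k) := isClosed_singleton.preimage continuous_crossEq

lemma analyticAt_crossEq (t : Fin m → ℂ) : AnalyticAt ℂ (crossEq k) t :=
  analyticOnNhd_of_differentiableOn isOpen_univ differentiable_crossEq.differentiableOn t trivial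

lemma isOpen_ball_diff_cross (ρ : ℝ) : IsOpen (ball (0 : Fin m → ℂ) ρ \ cross m k) :=
  isOpen_ball.sdiff isClosed_cross

lemma norm_crossEq (t : Fin m → ℂ) :
    ‖crossEq k t‖ = ∏ i ∈ Finset.univ.filter (fun i : Fin m => (i : ℕ) < k), ‖t i‖ := norm_prod _ _

lemma norm_crossEq_le_one {ρ : ℝ} (hρ : ρ ≤ 1) {t : Fin m → ℂ} (ht : t ∈ ball 0 ρ) :
    ‖crossEq k t‖ ≤ 1 := by
  rw [norm_crossEq]
  refine Finset.prod_le_one (fun _ _ => norm_nonneg _) fun i _ => ?_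
  exact (norm_le_pi_norm t i).trans ((mem_ball_zero_iff.1 ht).le.trans hρ)

lemma crossEq_pow (t : Fin m → ℂ) (N : ℕ) :
    crossEq k t ^ N = ∏ i : Fin m, t i ^ (if (i : ℕ) < k then N else 0) := by
  rw [crossEq, ← Finset.prod_pow, Finset.prod_filter]
  refine Finset.prod_congr rfl fun i _ => ?_
  split_ifs <;> simp

/-- `g` is holomorphic in the polydisc of radius `ρ` outside the cross, and its growth along the
cross is at most that of a power of `1 / f`. -/
def IsModerate (k : ℕ) (ρ : ℝ) (g : (Fin m → ℂ) → ℂ) : Prop :=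
  AnalyticOnNhd ℂ g (ball 0 ρ \ cross m k) ∧
    ∃ (C : ℝ) (N : ℕ), ∀ t ∈ ball 0 ρ \ cross m k, ‖crossEq k t‖ ^ N * ‖g t‖ ≤ C

namespace IsModerate

variable {ρ : ℝ} {g h : (Fin m → ℂ) → ℂ}

/-- Riemann's extension theorem along the cross. The extension is `f ^ (N + 2) * g`: since
`f ^ N * g` is bounded, it vanishes to second order along the cross, hence is differentiable
there. -/
theorem exists_extension (hg : IsModerate k ρ g) :
    ∃ (N : ℕ) (h : (Fin m → ℂ) → ℂ), AnalyticOnNhd ℂ h (ball 0 ρ) ∧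
      ∀ t ∈ ball 0 ρ \ cross m k, h t = crossEq k t ^ N * g t := by
  classical
  obtain ⟨ha, C, N, hC⟩ := hg
  let h : (Fin m → ℂ) → ℂ := fun t => if t ∈ cross m k then 0 else crossEq k t ^ (N + 2) * g t
  refine ⟨N + 2, h, analyticOnNhd_of_differentiableOn isOpen_ball fun a haB => ?_,
    fun t ht => if_neg ht.2⟩
  refine DifferentiableAt.differentiableWithinAt ?_
  by_cases hac : a ∈ cross m k
  · have h1 : (fun t => h t) =O[𝓝 a] fun t => crossEq k t ^ 2 := by
      refine Asymptotics.IsBigO.of_bound C ?_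
      filter_upwards [isOpen_ball.mem_nhds haB] with t ht
      by_cases htc : t ∈ cross m k
      · simp only [h, if_pos htc, norm_zero]
        have : crossEq k t = 0 := htc
        simp [this]
      · simp only [h, if_neg htc, norm_mul, norm_pow, pow_add]
        nlinarith [hC t ⟨ht, htc⟩, sq_nonneg ‖crossEq k t‖]
    have hfa : crossEq k a = 0 := hac
    have h2 : (crossEq k : (Fin m → ℂ) → ℂ) =O[𝓝 a] fun t => t - a := by
      have := (differentiable_crossEq (k := k) a).isBigO_sub
      simpa [hfa] using this
    have h3 : (fun t => h t) =o[𝓝 a] fun t => t - a := by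
      refine (h1.trans (h2.norm_right.pow 2)).trans_isLittleO ?_
      have h4 : (fun t : Fin m → ℂ => ‖t - a‖ ^ 2) =o[𝓝 a] fun t => ‖t - a‖ := by
        have : Filter.Tendsto (fun t : Fin m → ℂ => ‖t - a‖) (𝓝 a) (𝓝 0) := by
          have : Continuous fun t : Fin m → ℂ => ‖t - a‖ := by fun_prop
          simpa using this.tendsto a
        exact (Asymptotics.isLittleO_pow_id one_lt_two).comp_tendsto this
      exact h4.of_norm_right
    have : HasFDerivAt h (0 : (Fin m → ℂ) →L[ℂ] ℂ) a := by
      rw [hasFDerivAt_iff_isLittleO]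
      simpa [h, hac] using h3
    exact this.differentiableAt
  · have h1 : AnalyticAt ℂ (fun t => crossEq k t ^ (N + 2) * g t) a :=
      ((analyticAt_crossEq a).pow _).mul (ha a ⟨haB, hac⟩)
    refine (h1.congr ?_).differentiableAt
    filter_upwards [isClosed_cross.isOpen_compl.mem_nhds hac] with t ht
    exact (if_neg ht).symm

theorem isMeromorphicOn (hg : IsModerate k ρ g) : IsMeromorphicOn k (ball 0 ρ) g := by
  obtain ⟨N, h, hh, hhg⟩ := hg.exists_extension
  refine ⟨hg.1, fun a ha => ⟨N, h, hh a ha.1, ?_⟩⟩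
  filter_upwards [self_mem_nhdsWithin, mem_nhdsWithin_of_mem_nhds (isOpen_ball.mem_nhds ha.1)]
    with t ht1 ht2
  exact hhg t ⟨ht2, ht1⟩

/-- After multiplication by a power of `t_1 ⋯ t_k`, a function of moderate growth extends
holomorphically across the cross; its Laurent series is the shifted Taylor series. -/
theorem exists_hasLaurentExpansion (hρ : 0 < ρ) (hg : IsModerate k ρ g) :
    ∃ c, HasLaurentExpansion k g c := by
  obtain ⟨N, h, hh, hhg⟩ := hg.exists_extension
  obtain ⟨c, ρ', hρ', hc⟩ := exists_hasSum_monomial (hh 0 (mem_ball_self hρ))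
  let ι : (Fin m → ℕ) → (Fin m → ℤ) := fun b i => (b i : ℤ) - if (i : ℕ) < k then (N : ℤ) else 0
  have hι : Function.Injective ι := fun b b' hb => by
    funext i
    have := congrFun hb i
    simp only [ι] at this
    omega
  refine ⟨Function.extend ι c 0, ⟨N, fun a ha i => ?_⟩, min ρ ρ', lt_min hρ hρ', fun t ht htc => ?_⟩
  · by_cases hex : ∃ b, ι b = a
    · obtain ⟨b, rfl⟩ := hex
      simp only [ι]
      split_ifs <;> omega
    · exact absurd (Function.extend_apply' _ _ _ hex) ha
  · have htB : t ∈ ball 0 ρ := by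
      rw [mem_ball_zero_iff, pi_norm_lt_iff hρ]
      exact fun i => (ht i).trans_le (min_le_left _ _)
    have h1 := hc t fun i => (ht i).trans_le (min_le_right _ _)
    rw [hhg t ⟨htB, htc⟩] at h1
    have hf : crossEq k t ^ N ≠ 0 := pow_ne_zero _ (crossEq_ne_zero htc)
    rw [← hι.hasSum_iff]
    · have h2 := h1.mul_left (crossEq k t ^ N)⁻¹
      rw [inv_mul_cancel_left₀ hf] at h2
      refine hasSum_of_eq h2 fun b => ?_
      simp only [Function.comp, hι.extend_apply, ι]
      rw [mul_left_comm]
      congr 1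
      rw [crossEq_pow, ← Finset.prod_inv_distrib, ← Finset.prod_mul_distrib]
      refine Finset.prod_congr rfl fun i _ => ?_
      split_ifs with hi
      · rw [zpow_sub₀ (notMem_cross_iff.1 htc i hi), div_eq_inv_mul, zpow_natCast, zpow_natCast]
      · rw [sub_zero, zpow_natCast, pow_zero, inv_one, one_mul]
    · intro a ha
      rw [Function.extend_apply' _ _ _ (by simpa using ha)]
      simp

lemma const (ρ : ℝ) (c : ℂ) : IsModerate k ρ (fun _ : Fin m → ℂ => c) :=
  ⟨fun _ _ => analyticAt_const, ‖c‖, 0, fun _ _ => by simp⟩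

lemma mul (hg : IsModerate k ρ g) (hh : IsModerate k ρ h) :
    IsModerate k ρ (fun t => g t * h t) := by
  obtain ⟨ha, C, N, hC⟩ := hg
  obtain ⟨ha', C', N', hC'⟩ := hh
  refine ⟨ha.mul ha', C * C', N + N', fun t ht => ?_⟩
  have h1 := hC t ht
  have h2 := hC' t ht
  calc ‖crossEq k t‖ ^ (N + N') * ‖g t * h t‖
      = (‖crossEq k t‖ ^ N * ‖g t‖) * (‖crossEq k t‖ ^ N' * ‖h t‖) := by
        rw [norm_mul, pow_add]; ring
    _ ≤ C * C' := mul_le_mul h1 h2 (by positivity) (le_trans (by positivity) h1)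

lemma add (hρ : ρ ≤ 1) (hg : IsModerate k ρ g) (hh : IsModerate k ρ h) :
    IsModerate k ρ (fun t => g t + h t) := by
  obtain ⟨ha, C, N, hC⟩ := hg
  obtain ⟨ha', C', N', hC'⟩ := hh
  refine ⟨ha.add ha', C + C', N + N', fun t ht => ?_⟩
  have hf := norm_crossEq_le_one (k := k) hρ ht.1
  have h1 : ‖crossEq k t‖ ^ N' * (‖crossEq k t‖ ^ N * ‖g t‖) ≤ C :=
    (mul_le_of_le_one_left (by positivity) (pow_le_one₀ (norm_nonneg _) hf)).trans (hC t ht)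
  have h2 : ‖crossEq k t‖ ^ N * (‖crossEq k t‖ ^ N' * ‖h t‖) ≤ C' :=
    (mul_le_of_le_one_left (by positivity) (pow_le_one₀ (norm_nonneg _) hf)).trans (hC' t ht)
  calc ‖crossEq k t‖ ^ (N + N') * ‖g t + h t‖
      ≤ ‖crossEq k t‖ ^ (N + N') * (‖g t‖ + ‖h t‖) := by gcongr; exact norm_add_le _ _
    _ = ‖crossEq k t‖ ^ N' * (‖crossEq k t‖ ^ N * ‖g t‖) +
        ‖crossEq k t‖ ^ N * (‖crossEq k t‖ ^ N' * ‖h t‖) := by rw [pow_add]; ring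
    _ ≤ C + C' := add_le_add h1 h2

lemma sum {ι : Type*} (hρ : ρ ≤ 1) (s : Finset ι) {g : ι → (Fin m → ℂ) → ℂ}
    (hg : ∀ i ∈ s, IsModerate k ρ (g i)) : IsModerate k ρ (fun t => ∑ i ∈ s, g i t) := by
  classical
  induction s using Finset.induction_on with
  | empty => simpa using const ρ 0
  | insert a s has ih =>
    simp only [Finset.sum_insert has]
    exact add hρ (hg a (by simp)) (ih fun i hi => hg i (by simp [hi]))

lemma prod {ι : Type*} (s : Finset ι) {g : ι → (Fin m → ℂ) → ℂ}
    (hg : ∀ i ∈ s, IsModerate k ρ (g i)) : IsModerate k ρ (fun t => ∏ i ∈ s, g i t) := by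
  classical
  induction s using Finset.induction_on with
  | empty => simpa using const ρ 1
  | insert a s has ih =>
    simp only [Finset.prod_insert has]
    exact mul (hg a (by simp)) (ih fun i hi => hg i (by simp [hi]))

lemma det {p : ℕ} (hρ : ρ ≤ 1) {M : (Fin m → ℂ) → Matrix (Fin p) (Fin p) ℂ}
    (hM : ∀ i j, IsModerate k ρ (fun t => M t i j)) : IsModerate k ρ (fun t => (M t).det) := by
  simp only [Matrix.det_apply']
  exact sum hρ _ fun σ _ => mul (const ρ _) (prod _ fun i _ => hM _ _)

lemma mono {ρ' : ℝ} (h : ρ' ≤ ρ) (hg : IsModerate k ρ g) : IsModerate k ρ' g :=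
  have hsub : ball (0 : Fin m → ℂ) ρ' \ cross m k ⊆ ball 0 ρ \ cross m k :=
    sdiff_subset_sdiff_left (ball_subset_ball h)
  ⟨hg.1.mono hsub, hg.2.imp fun _ => Exists.imp fun _ hC t ht => hC t (hsub ht)⟩

end IsModerate

end Moderate

/-! ### The algebra of Laurent expansions -/

section Laurent

variable {m n k : ℕ}

/-- The exponents of the nonzero coefficients are at least `-N` in the first `k` coordinates and
nonnegative in the others. -/
def PoleOrderLE (k N : ℕ) {M : Type*} [Zero M] (c : (Fin m → ℤ) → M) : Prop :=
  ∀ a, c a ≠ 0 → ∀ i : Fin m, (if (i : ℕ) < k then -(N : ℤ) else 0) ≤ a i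

namespace PoleOrderLE

variable {M : Type*} [Zero M] {N N' : ℕ}

lemma mono {c : (Fin m → ℤ) → M} (h : N ≤ N') (hc : PoleOrderLE k N c) :
    PoleOrderLE k N' c := by
  intro a ha i
  have := hc a ha i
  split_ifs at this ⊢ <;> omega

lemma neg_le {c : (Fin m → ℤ) → M} (hc : PoleOrderLE k N c) {a : Fin m → ℤ} (ha : c a ≠ 0)
    (i : Fin m) : -(N : ℤ) ≤ a i := by
  have := hc a ha i
  split_ifs at this <;> omega

lemma nonneg {c : (Fin m → ℤ) → M} (hc : PoleOrderLE k N c) {a : Fin m → ℤ} (ha : c a ≠ 0)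
    {i : Fin m} (hi : ¬ (i : ℕ) < k) : 0 ≤ a i := by
  have := hc a ha i
  rwa [if_neg hi] at this

end PoleOrderLE

lemma zpow_add_of_nonneg {z : ℂ} {a b : ℤ} (h : z ≠ 0 ∨ (0 ≤ a ∧ 0 ≤ b)) :
    z ^ (a + b) = z ^ a * z ^ b := by
  rcases h with h | ⟨ha, hb⟩
  · exact zpow_add₀ h a b
  · exact zpow_add' (by omega)

/-- Monomials multiply outside the cross, provided the exponents of the other variables are
nonnegative: those variables may vanish. -/
lemma monomial_add {t : Fin m → ℂ} (ht : t ∉ cross m k) {a b : Fin m → ℤ}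
    (hab : ∀ i : Fin m, ¬ (i : ℕ) < k → 0 ≤ a i ∧ 0 ≤ b i) :
    ∏ i, t i ^ (a i + b i) = (∏ i, t i ^ a i) * ∏ i, t i ^ b i := by
  rw [← Finset.prod_mul_distrib]
  refine Finset.prod_congr rfl fun i _ => zpow_add_of_nonneg ?_
  by_cases hi : (i : ℕ) < k
  · exact Or.inl (notMem_cross_iff.1 ht i hi)
  · exact Or.inr (hab i hi)

namespace HasLaurentExpansion

variable {g h : (Fin m → ℂ) → ℂ} {c d : (Fin m → ℤ) → ℂ}

lemma poleOrderLE (hg : HasLaurentExpansion k g c) : ∃ N, PoleOrderLE k N c := hg.1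

theorem add (hg : HasLaurentExpansion k g c) (hh : HasLaurentExpansion k h d) :
    HasLaurentExpansion k (fun t => g t + h t) (fun a => c a + d a) := by
  obtain ⟨⟨N, hN⟩, ρ, hρ, hs⟩ := hg
  obtain ⟨⟨N', hN'⟩, ρ', hρ', hs'⟩ := hh
  refine ⟨⟨max N N', fun a ha => ?_⟩, min ρ ρ', lt_min hρ hρ', fun t ht htc => ?_⟩
  · by_cases h1 : c a = 0
    · exact PoleOrderLE.mono (le_max_right N N') hN' a fun h2 => ha (by simp [h1, h2])
    · exact PoleOrderLE.mono (le_max_left N N') hN a h1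
  · simp only [add_mul]
    exact (hs t (fun i => (ht i).trans_le (min_le_left _ _)) htc).add
      (hs' t (fun i => (ht i).trans_le (min_le_right _ _)) htc)

theorem const_mul (hg : HasLaurentExpansion k g c) (z : ℂ) :
    HasLaurentExpansion k (fun t => z * g t) (fun a => z * c a) := by
  obtain ⟨⟨N, hN⟩, ρ, hρ, hs⟩ := hg
  refine ⟨⟨N, fun a ha => hN a (right_ne_zero_of_mul ha)⟩, ρ, hρ, fun t ht htc => ?_⟩
  simp only [mul_assoc]
  exact (hs t ht htc).mul_left z

theorem sub (hg : HasLaurentExpansion k g c) (hh : HasLaurentExpansion k h d) :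
    HasLaurentExpansion k (fun t => g t - h t) (fun a => c a - d a) := by
  have := hg.add (hh.const_mul (-1))
  simpa only [neg_one_mul, ← sub_eq_add_neg] using this

theorem congr (hg : HasLaurentExpansion k g c) {ρ : ℝ} (hρ : 0 < ρ)
    (hgh : ∀ t ∈ ball 0 ρ \ cross m k, h t = g t) : HasLaurentExpansion k h c := by
  obtain ⟨hN, ρ', hρ', hs⟩ := hg
  refine ⟨hN, min ρ ρ', lt_min hρ hρ', fun t ht htc => ?_⟩
  rw [hgh t ⟨?_, htc⟩]
  · exact hs t (fun i => (ht i).trans_le (min_le_right _ _)) htc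
  · rw [mem_ball_zero_iff, pi_norm_lt_iff hρ]
    exact fun i => (ht i).trans_le (min_le_left _ _)

/-- A monomial, with nonnegative exponents of the variables after the `k`-th one. -/
theorem monomial {e : Fin m → ℤ} (he : ∀ i : Fin m, ¬ (i : ℕ) < k → 0 ≤ e i) :
    HasLaurentExpansion k (fun t => ∏ i, t i ^ e i) (Pi.single e 1) := by
  refine ⟨⟨∑ i, (e i).natAbs, fun a ha i => ?_⟩, 1, one_pos, fun t _ _ => ?_⟩
  · obtain rfl : a = e := by
      by_contra hne
      exact ha (Pi.single_eq_of_ne hne _)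
    have h1 : (a i).natAbs ≤ ∑ i, (a i).natAbs :=
      Finset.single_le_sum (f := fun i => (a i).natAbs) (fun _ _ => Nat.zero_le _)
        (Finset.mem_univ i)
    split_ifs with hi
    · omega
    · exact he i hi
  · have := hasSum_single (f := fun a : Fin m → ℤ =>
      (Pi.single e 1 : (Fin m → ℤ) → ℂ) a * ∏ i, t i ^ a i) e
      (fun a ha => by simp [Pi.single_eq_of_ne ha])
    simpa using this

theorem const (z : ℂ) :
    HasLaurentExpansion k (fun _ : Fin m → ℂ => z)
      (fun a => z * (Pi.single 0 1 : (Fin m → ℤ) → ℂ) a) := by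
  have := (monomial (k := k) (e := (0 : Fin m → ℤ)) fun _ _ => le_rfl).const_mul z
  simpa using this

theorem sum {ι : Type*} (s : Finset ι) {g : ι → (Fin m → ℂ) → ℂ} {c : ι → (Fin m → ℤ) → ℂ}
    (hg : ∀ i ∈ s, HasLaurentExpansion k (g i) (c i)) :
    HasLaurentExpansion k (fun t => ∑ i ∈ s, g i t) (fun a => ∑ i ∈ s, c i a) := by
  classical
  induction s using Finset.induction_on with
  | empty => simpa using const (m := m) (k := k) 0
  | insert a s has ih =>
    simp only [Finset.sum_insert has]
    exact add (hg a (by simp)) (ih fun i hi => hg i (by simp [hi]))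

theorem coord_mul (hg : HasLaurentExpansion k g c) (i : Fin m) :
    HasLaurentExpansion k (fun t => t i * g t) (fun a => c (a - Pi.single i 1)) := by
  obtain ⟨⟨N, hN⟩, ρ, hρ, hs⟩ := hg
  refine ⟨⟨N, fun a ha j => (hN _ ha j).trans ?_⟩, ρ, hρ, fun t ht htc => ?_⟩
  · rw [Pi.sub_apply]
    have : (0 : ℤ) ≤ (Pi.single i 1 : Fin m → ℤ) j := by
      rw [Pi.single_apply]; split_ifs <;> simp
    omega
  · rw [← (Equiv.addRight (Pi.single i 1 : Fin m → ℤ)).hasSum_iff]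
    refine hasSum_of_eq ((hs t ht htc).mul_left (t i)) fun a => ?_
    simp only [Function.comp, Equiv.coe_addRight, add_sub_cancel_right, Pi.add_apply]
    by_cases hca : c a = 0
    · simp [hca]
    · have h1 : ∏ j, t j ^ (Pi.single i 1 : Fin m → ℤ) j = t i := by
        rw [Finset.prod_eq_single i]
        · simp
        · intro j _ hj
          simp [Pi.single_eq_of_ne hj]
        · simp
      rw [monomial_add htc, h1]
      · ring
      · intro j hj
        refine ⟨PoleOrderLE.nonneg (k := k) hN hca hj, ?_⟩
        rw [Pi.single_apply]; split_ifs <;> simp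

lemma _root_.PfaffianSystem.hasSum_mul_hasSum {ι κ : Type*} {f : ι → ℂ} {g : κ → ℂ} {a b : ℂ}
    (hf : HasSum f a) (hg : HasSum g b) :
    HasSum (fun x : ι × κ => f x.1 * g x.2) (a * b) :=
  hf.mul hg (summable_mul_of_summable_norm hf.summable.norm hg.summable.norm)

lemma finite_support_conv {N N' : ℕ} {R : Type*} [MulZeroClass R] {c d : (Fin m → ℤ) → R}
    (hc : PoleOrderLE k N c) (hd : PoleOrderLE k N' d) (e : Fin m → ℤ) :
    Function.support (fun a => c (e - a) * d a) ⊆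
      Finset.Icc (fun _ => -(N' : ℤ)) (e + fun _ => (N : ℤ)) := by
  intro a ha
  have h1 := hc.neg_le (left_ne_zero_of_mul ha)
  have h2 := hd.neg_le (right_ne_zero_of_mul ha)
  rw [Finset.coe_Icc, mem_Icc]
  refine ⟨fun i => h2 i, fun i => ?_⟩
  have := h1 i
  simp only [Pi.sub_apply, Pi.add_apply] at *
  omega

lemma _root_.PfaffianSystem.PoleOrderLE.conv {N N' : ℕ} {R : Type*} [NonUnitalNonAssocSemiring R]
    {c d : (Fin m → ℤ) → R} (hc : PoleOrderLE k N c) (hd : PoleOrderLE k N' d) :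
    PoleOrderLE k (N + N') (fun e => ∑ᶠ a, c (e - a) * d a) := by
  intro e he i
  obtain ⟨a, ha⟩ : ∃ a, c (e - a) * d a ≠ 0 := by
    by_contra! hall
    exact he (finsum_eq_zero_of_forall_eq_zero hall)
  have h1 := hc _ (left_ne_zero_of_mul ha) i
  have h2 := hd _ (right_ne_zero_of_mul ha) i
  rw [Pi.sub_apply] at h1
  split_ifs at * <;> omega

/-- The Laurent expansion of a product is the convolution of the expansions. -/
theorem mul (hg : HasLaurentExpansion k g c) (hh : HasLaurentExpansion k h d) :
    HasLaurentExpansion k (fun t => g t * h t) (fun e => ∑ᶠ a, c (e - a) * d a) := by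
  obtain ⟨⟨N, hN⟩, ρ, hρ, hs⟩ := hg
  obtain ⟨⟨N', hN'⟩, ρ', hρ', hs'⟩ := hh
  have hpole : PoleOrderLE k (N + N') (fun e => ∑ᶠ a, c (e - a) * d a) :=
    PoleOrderLE.conv hN hN'
  replace hN : PoleOrderLE k N c := hN
  replace hN' : PoleOrderLE k N' d := hN'
  refine ⟨⟨N + N', hpole⟩, min ρ ρ', lt_min hρ hρ', fun t ht htc => ?_⟩
  have h1 := hs t (fun i => (ht i).trans_le (min_le_left _ _)) htc
  have h2 := hs' t (fun i => (ht i).trans_le (min_le_right _ _)) htc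
  have h3 := hasSum_mul_hasSum h1 h2
  let E : (Fin m → ℤ) × (Fin m → ℤ) ≃ (Fin m → ℤ) × (Fin m → ℤ) :=
    { toFun := fun x => (x.1 - x.2, x.2)
      invFun := fun x => (x.1 + x.2, x.2)
      left_inv := fun x => by simp
      right_inv := fun x => by simp }
  rw [← E.hasSum_iff] at h3
  have h4 : HasSum (fun x : (Fin m → ℤ) × (Fin m → ℤ) =>
      (c (x.1 - x.2) * d x.2) * ∏ i, t i ^ x.1 i) (g t * h t) := by
    refine hasSum_of_eq h3 fun x => ?_
    simp only [Function.comp, E, Equiv.coe_fn_mk]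
    by_cases hc : c (x.1 - x.2) = 0
    · simp [hc]
    by_cases hd : d x.2 = 0
    · simp [hd]
    have := monomial_add (k := k) htc (a := x.1 - x.2) (b := x.2) fun i hi =>
      ⟨hN.nonneg hc hi, hN'.nonneg hd hi⟩
    simp only [Pi.sub_apply, sub_add_cancel] at this
    rw [this]
    simp only [Pi.sub_apply]
    ring
  refine HasSum.prod_fiberwise (f := fun x : (Fin m → ℤ) × (Fin m → ℤ) =>
    (c (x.1 - x.2) * d x.2) * ∏ i, t i ^ x.1 i) h4 fun e => ?_
  have h5 := finite_support_conv hN hN' e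
  dsimp only
  rw [finsum_eq_sum_of_support_subset _ h5, Finset.sum_mul]
  refine hasSum_sum_of_ne_finset_zero fun a ha => ?_
  have : c (e - a) * d a = 0 := by
    by_contra hne
    exact ha (Finset.mem_coe.1 (h5 hne))
  simp [this]

/-- The coefficients of the zero function vanish: they are Fourier coefficients on a torus. -/
theorem eq_zero (hg : HasLaurentExpansion k (fun _ => 0) c) : c = 0 := by
  -- the normalisation of the measure on the circle used for multivariate Fourier series
  let : MeasureSpace UnitAddCircle := ⟨AddCircle.haarAddCircle⟩
  have : IsProbabilityMeasure (volume : Measure UnitAddCircle) :=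
    inferInstanceAs (IsProbabilityMeasure AddCircle.haarAddCircle)
  obtain ⟨-, ρ, hρ, hs⟩ := hg
  funext b
  set r : ℝ := ρ / 2 with hr
  have hr0 : 0 < r := by positivity
  have hrC : (r : ℂ) ≠ 0 := by exact_mod_cast hr0.ne'
  have hval : ∀ x : UnitAddTorus (Fin m),
      HasSum (fun a : Fin m → ℤ => (c a * ∏ i, (r : ℂ) ^ a i) * UnitAddTorus.mFourier a x) 0 := by
    intro x
    have h1 := hs (fun i => (r : ℂ) * fourier 1 (x i)) (fun i => ?_) ?_
    · refine hasSum_of_eq h1 fun a => ?_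
      rw [mul_assoc]
      congr 1
      simp only [UnitAddTorus.mFourier, ContinuousMap.coe_mk, ← Finset.prod_mul_distrib]
      refine Finset.prod_congr rfl fun i _ => ?_
      rw [mul_zpow]
      congr 1
      simp [fourier_apply, AddCircle.toCircle_zsmul]
    · simp [fourier_apply, abs_of_pos hr0, Circle.norm_coe]
      linarith
    · rw [notMem_cross_iff]
      intro i _
      simp [hr0.ne', fourier_apply]
  have hsum : Summable fun a : Fin m → ℤ => ‖c a * ∏ i, (r : ℂ) ^ a i‖ := by
    have := (hval 0).summable.norm
    refine this.congr fun a => ?_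
    simp [UnitAddTorus.mFourier]
  have hC : HasSum (fun a : Fin m → ℤ => (c a * ∏ i, (r : ℂ) ^ a i) • UnitAddTorus.mFourier a)
      (0 : C(UnitAddTorus (Fin m), ℂ)) := by
    have h2 : Summable fun a : Fin m → ℤ =>
        (c a * ∏ i, (r : ℂ) ^ a i) • UnitAddTorus.mFourier a := by
      refine Summable.of_norm ?_
      simpa only [norm_smul, UnitAddTorus.mFourier_norm, mul_one] using hsum
    convert h2.hasSum
    ext x
    have h3 := h2.hasSum.mapL (ContinuousMap.evalCLM ℂ x)
    exact (hval x).unique h3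
  have hL : HasSum (fun a : Fin m → ℤ =>
      (c a * ∏ i, (r : ℂ) ^ a i) • UnitAddTorus.mFourierLp (d := Fin m) 2 a) 0 := by
    have := hC.mapL (ContinuousMap.toLp (E := ℂ) 2 volume ℂ)
    simp only [map_smul, map_zero] at this
    exact this
  have hI := hL.mapL (innerSL ℂ (UnitAddTorus.mFourierLp (d := Fin m) 2 b))
  have hI' : HasSum (fun a : Fin m → ℤ => if a = b then c a * ∏ i, (r : ℂ) ^ a i else 0) 0 := by
    rw [map_zero] at hI
    refine hasSum_of_eq hI fun a => ?_
    have := orthonormal_iff_ite.1 UnitAddTorus.orthonormal_mFourier b a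
    rw [map_smul, innerSL_apply_apply, smul_eq_mul, this]
    by_cases hab : a = b
    · simp [hab]
    · simp [hab, Ne.symm hab]
  have h6 := hI'.unique (hasSum_single b fun a ha => if_neg ha)
  rw [if_pos rfl] at h6
  have h7 : ∏ i, (r : ℂ) ^ b i ≠ 0 := Finset.prod_ne_zero_iff.2 fun i _ => zpow_ne_zero _ hrC
  exact (mul_eq_zero.1 h6.symm).resolve_right h7

theorem unique (hg : HasLaurentExpansion k g c) (hh : HasLaurentExpansion k h d) {ρ : ℝ}
    (hρ : 0 < ρ) (hgh : ∀ t ∈ ball 0 ρ \ cross m k, g t = h t) : c = d := by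
  have := ((hg.sub hh).congr (h := fun _ => 0) hρ fun t ht => by simp [hgh t ht]).eq_zero
  funext a
  exact sub_eq_zero.1 (congrFun this a)

end HasLaurentExpansion

end Laurent

/-! ### Euler derivatives of Laurent expansions -/

section LaurentDerivative

variable {m n k : ℕ}

namespace HasLaurentExpansion

variable {g h : (Fin m → ℂ) → ℂ} {c d : (Fin m → ℤ) → ℂ}

/-- The expansion of the logarithmic derivative `t_i ∂g/∂t_i`: the series is differentiated along
`z ↦ (t_1, …, t_i e^z, …, t_m)`. -/
theorem euler (hg : HasLaurentExpansion k g c) {ρ : ℝ} (hρ : 0 < ρ)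
    (hd : AnalyticOnNhd ℂ g (ball 0 ρ \ cross m k)) (i : Fin m) :
    HasLaurentExpansion k (fun t => t i * partialDeriv i g t) (fun a => (a i : ℂ) * c a) := by
  obtain ⟨⟨N, hN⟩, ρ', hρ', hs⟩ := hg
  refine ⟨⟨N, fun a ha => hN a (right_ne_zero_of_mul ha)⟩, min ρ ρ', lt_min hρ hρ',
    fun t ht htc => ?_⟩
  obtain ⟨η, hη, hηt⟩ : ∃ η : ℝ, 0 < η ∧ ‖t i‖ * Real.exp η < ρ' := by
    have h1 : Filter.Tendsto (fun η : ℝ => ‖t i‖ * Real.exp η) (𝓝[>] 0) (𝓝 (‖t i‖ * Real.exp 0)) :=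
      ((continuous_const.mul Real.continuous_exp).tendsto 0).mono_left nhdsWithin_le_nhds
    rw [Real.exp_zero, mul_one] at h1
    have h2 := h1.eventually (gt_mem_nhds ((ht i).trans_le (min_le_right _ _)))
    obtain ⟨η, h3, h4⟩ := (h2.and self_mem_nhdsWithin).exists
    exact ⟨η, h4, h3⟩
  let τ : ℂ → Fin m → ℂ := fun z => Function.update t i (t i * Complex.exp z)
  have hτc : ∀ z, τ z ∉ cross m k := fun z => by
    rw [notMem_cross_iff] at htc ⊢
    intro j hj
    rcases eq_or_ne j i with rfl | hji
    · simpa [τ] using htc j hj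
    · simpa [τ, hji] using htc j hj
  have hτs : ∀ z : ℂ, |z.re| ≤ η → HasSum (fun a => c a * ∏ j, τ z j ^ a j) (g (τ z)) := by
    intro z hz
    refine hs _ (fun j => ?_) (hτc z)
    rcases eq_or_ne j i with rfl | hji
    · simp only [τ, Function.update_self, norm_mul, Complex.norm_exp]
      refine lt_of_le_of_lt ?_ hηt
      gcongr
      exact (le_abs_self _).trans hz
    · simpa [τ, hji] using (ht j).trans_le (min_le_right _ _)
  have hmon : ∀ (z : ℂ) (a : Fin m → ℤ),
      ∏ j, τ z j ^ a j = (∏ j, t j ^ a j) * Complex.exp (a i * z) := by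
    intro z a
    have h1 : ∀ j, τ z j ^ a j = t j ^ a j * (if j = i then Complex.exp (a i * z) else 1) := by
      intro j
      rcases eq_or_ne j i with rfl | hji
      · simp [τ, mul_zpow, Complex.exp_int_mul]
      · simp [τ, hji]
    rw [Finset.prod_congr rfl fun j _ => h1 j, Finset.prod_mul_distrib]
    simp
  set F : (Fin m → ℤ) → ℂ → ℂ := fun a z => c a * ((∏ j, t j ^ a j) * Complex.exp (a i * z)) with hF
  have hFs : ∀ z : ℂ, |z.re| ≤ η → HasSum (fun a => F a z) (g (τ z)) := fun z hz =>
    hasSum_of_eq (hτs z hz) fun a => by rw [hmon]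
  have hu : Summable fun a => ‖F a η‖ + ‖F a (-η)‖ :=
    (hFs η (by simp [abs_of_pos hη])).summable.norm.add
      (hFs (-η) (by simp [abs_of_pos hη])).summable.norm
  have hmem : ∀ z ∈ ball (0 : ℂ) η, |z.re| ≤ η := fun z hz =>
    (Complex.abs_re_le_norm z).trans (mem_ball_zero_iff.1 hz).le
  have hderiv := Complex.hasSum_deriv_of_summable_norm (F := F) (z := 0) hu
    (fun a => by fun_prop) isOpen_ball (fun a z hz => ?_) (mem_ball_self hη)
  · have h1 : (fun z => ∑' a, F a z) =ᶠ[𝓝 0] fun z => g (τ z) := by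
      filter_upwards [isOpen_ball.mem_nhds (mem_ball_self hη)] with z hz
      exact (hFs z (hmem z hz)).tsum_eq
    have htB : t ∈ ball (0 : Fin m → ℂ) ρ := by
      rw [mem_ball_zero_iff, pi_norm_lt_iff hρ]
      exact fun j => (ht j).trans_le (min_le_left _ _)
    have h2 : HasDerivAt (fun z => g (τ z)) (t i * partialDeriv i g t) 0 := by
      have h3 : HasDerivAt τ (Pi.single i (t i)) 0 := by
        have h4 := (hasDerivAt_update t i (t i * Complex.exp 0)).scomp (0 : ℂ)
          ((Complex.hasDerivAt_exp 0).const_mul (t i))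
        simpa [τ, Function.comp_def, ← Pi.single_smul] using h4
      have h5 : τ 0 = t := by simp [τ]
      have h6 : HasFDerivAt g (fderiv ℂ g t) (τ 0) := by
        rw [h5]
        exact (hd t ⟨htB, htc⟩).differentiableAt.hasFDerivAt
      have h7 := h6.comp_hasDerivAt 0 h3
      have h9 : t i * partialDeriv i g t = fderiv ℂ g t (Pi.single i (t i)) := by
        rw [partialDeriv, ← smul_eq_mul, ← map_smul, ← Pi.single_smul, smul_eq_mul, mul_one]
      rw [h9]
      exact h7
    rw [h1.deriv_eq, h2.deriv] at hderiv
    refine hasSum_of_eq hderiv fun a => ?_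
    have h8 : HasDerivAt (F a) (c a * ((∏ j, t j ^ a j) * (Complex.exp (a i * 0) * (a i * 1)))) 0 :=
      ((((hasDerivAt_id (0 : ℂ)).const_mul (a i : ℂ)).cexp).const_mul _).const_mul _
    rw [h8.deriv]
    simp
    ring
  · simp only [hF, norm_mul, Complex.norm_exp, ← mul_add]
    refine mul_le_mul_of_nonneg_left ?_ (norm_nonneg _)
    refine mul_le_mul_of_nonneg_left ?_ (norm_nonneg _)
    have hz' := abs_le.1 (hmem z hz)
    have e1 : ((a i : ℂ) * z).re = a i * z.re := by simp
    have e2 : ((a i : ℂ) * (η : ℂ)).re = a i * η := by simp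
    have e3 : ((a i : ℂ) * (-(η : ℂ))).re = -(a i * η) := by simp
    rw [e1, e2, e3]
    rcases le_total 0 (a i : ℝ) with h | h
    · exact le_add_of_le_of_nonneg (Real.exp_le_exp.2 (by nlinarith)) (Real.exp_pos _).le
    · exact le_add_of_nonneg_of_le (Real.exp_pos _).le (Real.exp_le_exp.2 (by nlinarith))

/-- A Laurent expansion without negative exponents defines a bounded function near `0`. -/
theorem exists_bound (hg : HasLaurentExpansion k g c) (hc : ∀ a, c a ≠ 0 → ∀ i, 0 ≤ a i) :
    ∃ ρ K : ℝ, 0 < ρ ∧ ∀ t ∈ ball 0 ρ \ cross m k, ‖g t‖ ≤ K := by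
  obtain ⟨-, ρ, hρ, hs⟩ := hg
  have hr : 0 < ρ / 2 := by positivity
  have h0 := hs (fun _ => ((ρ / 2 : ℝ) : ℂ))
    (fun i => by rw [Complex.norm_real, Real.norm_eq_abs, abs_of_pos hr]; linarith)
    (notMem_cross_iff.2 fun i _ => by exact_mod_cast hr.ne')
  refine ⟨ρ / 2, ∑' a, ‖c a * ∏ i : Fin m, ((ρ / 2 : ℝ) : ℂ) ^ a i‖, hr, fun t ht => ?_⟩
  have hti : ∀ i, ‖t i‖ < ρ / 2 := (pi_norm_lt_iff hr).1 (mem_ball_zero_iff.1 ht.1)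
  have h1 := hs t (fun i => (hti i).trans (by linarith)) ht.2
  rw [← h1.tsum_eq]
  refine tsum_of_norm_bounded h0.summable.norm.hasSum fun a => ?_
  by_cases hca : c a = 0
  · simp [hca]
  · rw [norm_mul, norm_mul, norm_prod, norm_prod]
    refine mul_le_mul_of_nonneg_left ?_ (norm_nonneg _)
    refine Finset.prod_le_prod (fun _ _ => norm_nonneg _) fun i _ => ?_
    rw [norm_zpow, norm_zpow, Complex.norm_real, Real.norm_eq_abs, abs_of_pos hr]
    lift a i to ℕ using hc a hca i with b
    simpa using pow_le_pow_left₀ (norm_nonneg _) (hti i).le b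

end HasLaurentExpansion

/-- Comparison key for exponents: first the `j`-th coordinate, then lexicographically. -/
def lexKey (j : Fin m) (a : Fin m → ℤ) : ℤ ×ₗ Lex (Fin m → ℤ) := toLex (a j, toLex a)

lemma lexKey_add (j : Fin m) (a b : Fin m → ℤ) : lexKey j (a + b) = lexKey j a + lexKey j b := rfl

lemma lexKey_injective (j : Fin m) : Function.Injective (lexKey j) := by
  intro a b h
  exact toLex.injective (congrArg Prod.snd (toLex.injective h))

lemma lexKey_mono (j : Fin m) : Monotone (lexKey j) := by
  intro a b h
  exact Prod.Lex.toLex_mono ⟨h j, Pi.toLex_monotone h⟩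

/-- A nonzero family of coefficients which are bounded below has a smallest exponent. -/
lemma PoleOrderLE.exists_min {N : ℕ} {c : (Fin m → ℤ) → ℂ} (hc : PoleOrderLE k N c) (j : Fin m)
    {a₀ : Fin m → ℤ} (h0 : c a₀ ≠ 0) :
    ∃ a, c a ≠ 0 ∧ ∀ b, c b ≠ 0 → lexKey j a ≤ lexKey j b := by
  let φ : (Fin m → ℕ) → ℤ ×ₗ Lex (Fin m → ℤ) := fun b => lexKey j fun i => (b i : ℤ) - N
  have hφ : Monotone φ := fun b b' h => lexKey_mono j fun i => by
    have : b i ≤ b' i := h i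
    show (b i : ℤ) - N ≤ b' i - N
    omega
  have hpwo : (φ '' univ).IsPWO := (Set.isPWO_of_wellQuasiOrderedLE univ).image_of_monotone hφ
  have hsub : lexKey j '' {a | c a ≠ 0} ⊆ φ '' univ := by
    rintro _ ⟨a, ha, rfl⟩
    refine ⟨fun i => (a i + N).toNat, trivial, ?_⟩
    simp only [φ]
    congr 1
    funext i
    have := hc.neg_le ha i
    omega
  have hwf := (hpwo.mono hsub).isWF
  have hne : (lexKey j '' {a | c a ≠ 0}).Nonempty := ⟨_, a₀, h0, rfl⟩
  obtain ⟨a, ha, hmin⟩ := hwf.min_mem hne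
  exact ⟨a, ha, fun b hb => hmin ▸ hwf.min_le hne ⟨b, hb, rfl⟩⟩

/-- If `t_i ∂g/∂t_i = w g` for a nonzero Laurent series `g`, then `w` has no negative exponents:
otherwise the product of the smallest terms of `w` and `g` would occur on the right, but its
exponent is too small to occur on the left. -/
lemma nonneg_of_euler_eq_conv {N N' : ℕ} {w c : (Fin m → ℤ) → ℂ} (hw : PoleOrderLE k N w)
    (hc : PoleOrderLE k N' c) (hc0 : c ≠ 0) (i : Fin m)
    (h : ∀ e, (e i : ℂ) * c e = ∑ᶠ a, w (e - a) * c a) :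
    ∀ a, w a ≠ 0 → ∀ j, 0 ≤ a j := by
  intro a₀ ha₀ j
  by_contra! hneg
  obtain ⟨b₀, hb₀⟩ := Function.ne_iff.1 hc0
  obtain ⟨a, ha, hamin⟩ := hw.exists_min j ha₀
  obtain ⟨b, hb, hbmin⟩ := hc.exists_min j hb₀
  have haj : a j < 0 := by
    have h1 := hamin a₀ ha₀
    have h2 : a j ≤ a₀ j := by
      rcases Prod.Lex.le_iff.1 h1 with h3 | h3
      · exact h3.le
      · exact h3.1.le
    omega
  have hlt : lexKey j a < 0 := Prod.Lex.lt_iff.2 (Or.inl haj)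
  have h3 := h (a + b)
  have h4 : c (a + b) = 0 := by
    by_contra hne
    have h5 := hbmin _ hne
    rw [lexKey_add] at h5
    have h6 : lexKey j a + lexKey j b < 0 + lexKey j b := add_lt_add_left hlt _
    rw [zero_add] at h6
    exact absurd h5 (not_le.2 h6)
  rw [h4, mul_zero, finsum_eq_single _ b] at h3
  · rw [add_sub_cancel_right] at h3
    exact mul_ne_zero ha hb h3.symm
  · intro x hx
    by_contra hne
    have h5 := hamin _ (left_ne_zero_of_mul hne)
    have h6 := hbmin _ (right_ne_zero_of_mul hne)
    have h7 : lexKey j (a + b - x) + lexKey j x = lexKey j a + lexKey j b := by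
      rw [← lexKey_add, sub_add_cancel, lexKey_add]
    have h8 : lexKey j x = lexKey j b := by
      refine le_antisymm ?_ h6
      by_contra! hlt'
      exact absurd h7 (add_lt_add_of_le_of_lt h5 hlt').ne'
    exact hx (lexKey_injective j h8)

end LaurentDerivative

/-! ### Radial solutions of linear systems -/

section Frobenius

variable {m : ℕ} {𝔸 : Type*} [NormedRing 𝔸] [NormedAlgebra ℂ 𝔸]

section RayIntegral

lemma continuousOn_ray {H : Set (Fin m → ℂ)}
    (hstar : ∀ s ∈ H, ∀ τ ∈ Icc (0 : ℝ) 1, (τ : ℂ) • s ∈ H) {E : Type*} [TopologicalSpace E]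
    {G : (Fin m → ℂ) → E}
    (hG : ContinuousOn G H) {s : Fin m → ℂ} (hs : s ∈ H) :
    ContinuousOn (fun τ : ℝ => G ((τ : ℂ) • s)) (Icc 0 1) :=
  hG.comp (Continuous.continuousOn (by fun_prop)) fun τ hτ => hstar s hs τ hτ

variable {E : Type*} [NormedAddCommGroup E] [NormedSpace ℂ E] [CompleteSpace E]

/-- Every point of an open set which is star-shaped about the origin has a neighbourhood contained
in a compact star-shaped subset. -/
lemma exists_compact_star {H : Set (Fin m → ℂ)} (hH : IsOpen H)
    (hstar : ∀ s ∈ H, ∀ τ ∈ Icc (0 : ℝ) 1, (τ : ℂ) • s ∈ H) {s : Fin m → ℂ} (hs : s ∈ H) :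
    ∃ (ε : ℝ) (C : Set (Fin m → ℂ)), 0 < ε ∧ IsCompact C ∧ C ⊆ H ∧ ball s ε ⊆ C ∧
      ∀ x ∈ C, ∀ τ ∈ Icc (0 : ℝ) 1, (τ : ℂ) • x ∈ C := by
  obtain ⟨ε, hε, hsub⟩ := nhds_basis_closedBall.mem_iff.1 (hH.mem_nhds hs)
  refine ⟨ε, (fun p : ℝ × (Fin m → ℂ) => (p.1 : ℂ) • p.2) '' (Icc 0 1 ×ˢ closedBall s ε), hε,
    (isCompact_Icc.prod (isCompact_closedBall _ _)).image (by fun_prop), ?_, ?_, ?_⟩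
  · rintro _ ⟨⟨τ, x⟩, ⟨hτ, hx⟩, rfl⟩
    exact hstar x (hsub hx) τ hτ
  · intro x hx
    exact ⟨(1, x), ⟨⟨zero_le_one, le_rfl⟩, ball_subset_closedBall hx⟩, by simp⟩
  · rintro _ ⟨⟨τ, x⟩, ⟨hτ, hx⟩, rfl⟩ σ hσ
    refine ⟨(σ * τ, x), ⟨⟨mul_nonneg hσ.1 hτ.1, mul_le_one₀ hσ.2 hτ.1 hτ.2⟩, hx⟩, ?_⟩
    simp [mul_smul]

lemma analyticOnNhd_integral_ray {H : Set (Fin m → ℂ)} (hH : IsOpen H)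
    (hstar : ∀ s ∈ H, ∀ τ ∈ Icc (0 : ℝ) 1, (τ : ℂ) • s ∈ H) {G : (Fin m → ℂ) → E}
    (hG : AnalyticOnNhd ℂ G H) :
    AnalyticOnNhd ℂ (fun s => ∫ τ in (0 : ℝ)..1, G ((τ : ℂ) • s)) H := by
  refine analyticOnNhd_of_differentiableOn hH fun s hs =>
    DifferentiableAt.differentiableWithinAt ?_
  obtain ⟨ε, C, hε, hC, hCH, hball, hCstar⟩ := exists_compact_star hH hstar hs
  have hG' : ContinuousOn (fderiv ℂ G) H := hG.fderiv.continuousOn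
  obtain ⟨K, hK⟩ := hC.exists_bound_of_continuousOn (hG'.mono hCH)
  have hsub : uIoc (0 : ℝ) 1 ⊆ Icc 0 1 := by
    rw [uIoc_of_le zero_le_one]; exact Ioc_subset_Icc_self
  have hmeas : ∀ {F : Type _} [NormedAddCommGroup F] [NormedSpace ℂ F] (f : ℝ → F),
      ContinuousOn f (Icc 0 1) → AEStronglyMeasurable f (volume.restrict (uIoc 0 1)) :=
    fun f hf => (hf.mono hsub).aestronglyMeasurable measurableSet_uIoc
  have := intervalIntegral.hasFDerivAt_integral_of_dominated_of_fderiv_le (𝕜 := ℂ) (μ := volume)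
    (a := 0) (b := 1) (F := fun s (τ : ℝ) => G ((τ : ℂ) • s))
    (F' := fun s (τ : ℝ) => (τ : ℂ) • fderiv ℂ G ((τ : ℂ) • s)) (x₀ := s) (bound := fun _ => K)
    (isOpen_ball.mem_nhds (mem_ball_self hε)) ?_ ?_ ?_ ?_ ?_ ?_
  · exact this.differentiableAt
  · filter_upwards [hH.mem_nhds hs] with x hx
    exact hmeas _ (continuousOn_ray hstar hG.continuousOn hx)
  · refine ContinuousOn.intervalIntegrable ?_
    rw [uIcc_of_le zero_le_one]
    exact continuousOn_ray hstar hG.continuousOn hs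
  · refine hmeas _ (ContinuousOn.smul Complex.continuous_ofReal.continuousOn ?_)
    exact continuousOn_ray hstar hG' hs
  · refine Filter.Eventually.of_forall fun τ hτ x hx => ?_
    have hτ' := hsub hτ
    rw [norm_smul, Complex.norm_real, Real.norm_eq_abs, abs_of_nonneg hτ'.1]
    exact (mul_le_of_le_one_left (norm_nonneg _) hτ'.2).trans (hK _ (hCstar x (hball hx) τ hτ'))
  · exact intervalIntegrable_const
  · refine Filter.Eventually.of_forall fun τ hτ x hx => ?_
    have h1 := (hG _ (hCH (hCstar x (hball hx) τ (hsub hτ)))).differentiableAt.hasFDerivAt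
    have h2 : HasFDerivAt (fun x : Fin m → ℂ => (τ : ℂ) • x)
        ((τ : ℂ) • ContinuousLinearMap.id ℂ (Fin m → ℂ)) x :=
      ((τ : ℂ) • ContinuousLinearMap.id ℂ (Fin m → ℂ)).hasFDerivAt
    have h3 := h1.comp x h2
    rwa [ContinuousLinearMap.comp_smul, ContinuousLinearMap.comp_id] at h3

end RayIntegral

/-- The Picard iterates along rays from the origin of the equation `dY = (∑ i, Θ i ds_i) Y`. -/
noncomputable def picardTerm (Θ : Fin m → (Fin m → ℂ) → 𝔸) : ℕ → (Fin m → ℂ) → 𝔸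
  | 0, _ => 1
  | j + 1, s => ∑ i, s i • ∫ τ in (0 : ℝ)..1, Θ i ((τ : ℂ) • s) * picardTerm Θ j ((τ : ℂ) • s)

variable {H : Set (Fin m → ℂ)} {Θ : Fin m → (Fin m → ℂ) → 𝔸}

lemma picardTerm_succ_smul (j : ℕ) (u : ℝ) (s : Fin m → ℂ) :
    picardTerm Θ (j + 1) ((u : ℂ) • s) =
      ∑ i, s i • ∫ v in (0 : ℝ)..u, Θ i ((v : ℂ) • s) * picardTerm Θ j ((v : ℂ) • s) := by
  rw [picardTerm]
  refine Finset.sum_congr rfl fun i _ => ?_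
  have h1 := intervalIntegral.smul_integral_comp_mul_right
    (f := fun v : ℝ => Θ i ((v : ℂ) • s) * picardTerm Θ j ((v : ℂ) • s)) (a := 0) (b := 1) u
  rw [zero_mul, one_mul] at h1
  rw [← h1, Pi.smul_apply, smul_eq_mul, mul_comm, mul_smul, Complex.coe_smul]
  simp only [smul_smul, Complex.ofReal_mul]

lemma norm_picardTerm_le {s : Fin m → ℂ} {K : ℝ} (hK0 : 0 ≤ K)
    (hK : ∀ τ ∈ Icc (0 : ℝ) 1, ∀ i, ‖Θ i ((τ : ℂ) • s)‖ ≤ K) (j : ℕ) :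
    ∀ u ∈ Icc (0 : ℝ) 1, ‖picardTerm Θ j ((u : ℂ) • s)‖ ≤
      ‖(1 : 𝔸)‖ * (((∑ i, ‖s i‖) * K) ^ j * (u ^ j / j.factorial)) := by
  set M := (∑ i, ‖s i‖) * K with hM
  have hM0 : 0 ≤ M := mul_nonneg (Finset.sum_nonneg fun _ _ => norm_nonneg _) hK0
  induction j with
  | zero => intro u _; simp [picardTerm]
  | succ j ih =>
    intro u hu
    rw [picardTerm_succ_smul]
    have hint : ∀ i, ‖∫ v in (0 : ℝ)..u, Θ i ((v : ℂ) • s) * picardTerm Θ j ((v : ℂ) • s)‖ ≤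
        K * (‖(1 : 𝔸)‖ * (M ^ j * (u ^ (j + 1) / (j + 1).factorial))) := by
      intro i
      have h1 := intervalIntegral.norm_integral_le_of_norm_le (μ := volume) hu.1
        (f := fun v : ℝ => Θ i ((v : ℂ) • s) * picardTerm Θ j ((v : ℂ) • s))
        (g := fun v => K * (‖(1 : 𝔸)‖ * (M ^ j * (v ^ j / j.factorial))))
        (Filter.Eventually.of_forall fun v hv => by
          have hv' : v ∈ Icc (0 : ℝ) 1 := ⟨hv.1.le, hv.2.trans hu.2⟩
          exact (norm_mul_le _ _).trans
            (mul_le_mul (hK v hv' i) (ih v hv') (norm_nonneg _) hK0))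
        (Continuous.intervalIntegrable (by fun_prop) _ _)
      refine h1.trans_eq ?_
      simp only [intervalIntegral.integral_const_mul, intervalIntegral.integral_div, integral_pow]
      rw [Nat.factorial_succ]
      push_cast
      have : ((j : ℝ) + 1) ≠ 0 := by positivity
      field_simp
      simp
    calc ‖∑ i, s i • ∫ v in (0 : ℝ)..u, Θ i ((v : ℂ) • s) * picardTerm Θ j ((v : ℂ) • s)‖
        ≤ ∑ i, ‖s i‖ * (K * (‖(1 : 𝔸)‖ * (M ^ j * (u ^ (j + 1) / (j + 1).factorial)))) := by
          refine norm_sum_le_of_le _ fun i _ => ?_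
          rw [norm_smul]
          exact mul_le_mul_of_nonneg_left (hint i) (norm_nonneg _)
      _ = _ := by
          rw [← Finset.sum_mul, pow_succ, hM]; ring

variable [CompleteSpace 𝔸]

lemma analyticOnNhd_picardTerm (hH : IsOpen H)
    (hstar : ∀ s ∈ H, ∀ τ ∈ Icc (0 : ℝ) 1, (τ : ℂ) • s ∈ H) (hΘ : ∀ i, AnalyticOnNhd ℂ (Θ i) H)
    (j : ℕ) : AnalyticOnNhd ℂ (picardTerm Θ j) H := by
  induction j with
  | zero => exact fun _ _ => analyticAt_const
  | succ j ih =>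
    refine Finset.analyticOnNhd_fun_sum _ fun i _ => ?_
    refine AnalyticOnNhd.smul (fun s _ => ?_) (analyticOnNhd_integral_ray hH hstar ((hΘ i).mul ih))
    exact (ContinuousLinearMap.proj (R := ℂ) (φ := fun _ : Fin m => ℂ) i).analyticAt s

/-- The Euler field maps each Picard iterate to `R` times the preceding one,
`R = ∑ i, s_i Θ i`. -/
lemma fderiv_picardTerm_succ (hH : IsOpen H)
    (hstar : ∀ s ∈ H, ∀ τ ∈ Icc (0 : ℝ) 1, (τ : ℂ) • s ∈ H) (hΘ : ∀ i, AnalyticOnNhd ℂ (Θ i) H)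
    (j : ℕ) {s : Fin m → ℂ} (hs : s ∈ H) :
    fderiv ℂ (picardTerm Θ (j + 1)) s s = (∑ i, s i • Θ i s) * picardTerm Θ j s := by
  have hT := analyticOnNhd_picardTerm hH hstar hΘ
  have hG : ∀ i, ContinuousOn (fun x => Θ i x * picardTerm Θ j x) H := fun i =>
    ((hΘ i).mul (hT j)).continuousOn
  have hopen : IsOpen {v : ℝ | (v : ℂ) • s ∈ H} := hH.preimage (by fun_prop)
  have h1s : (1 : ℝ) ∈ {v : ℝ | (v : ℂ) • s ∈ H} := by simpa using hs
  have h1 : HasDerivAt (fun u : ℝ => ∑ i, s i • ∫ v in (0 : ℝ)..u,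
      Θ i ((v : ℂ) • s) * picardTerm Θ j ((v : ℂ) • s))
      (∑ i, s i • (Θ i (((1 : ℝ) : ℂ) • s) * picardTerm Θ j (((1 : ℝ) : ℂ) • s))) 1 := by
    refine HasDerivAt.fun_sum fun i _ => HasDerivAt.const_smul (s i) ?_
    have hc : ContinuousOn (fun v : ℝ => Θ i ((v : ℂ) • s) * picardTerm Θ j ((v : ℂ) • s))
        {v : ℝ | (v : ℂ) • s ∈ H} :=
      (hG i).comp (Continuous.continuousOn (by fun_prop)) fun v hv => hv
    refine intervalIntegral.integral_hasDerivAt_right ?_ ?_ ?_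
    · refine ContinuousOn.intervalIntegrable ?_
      rw [uIcc_of_le zero_le_one]
      exact continuousOn_ray hstar (hG i) hs
    · exact hc.stronglyMeasurableAtFilter hopen _ h1s
    · exact hc.continuousAt (hopen.mem_nhds h1s)
  have h2 : HasDerivAt (fun u : ℝ => picardTerm Θ (j + 1) ((u : ℂ) • s))
      (fderiv ℂ (picardTerm Θ (j + 1)) s s) 1 := by
    have h3 : HasFDerivAt (picardTerm Θ (j + 1)) (fderiv ℂ (picardTerm Θ (j + 1)) s)
        (((1 : ℝ) : ℂ) • s) := by
      simpa using (hT (j + 1) s hs).differentiableAt.hasFDerivAt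
    have h4 : HasDerivAt (fun u : ℝ => (u : ℂ) • s) s 1 := by
      simpa using (Complex.ofRealCLM.hasDerivAt (x := 1)).smul_const s
    exact (h3.restrictScalars ℝ).comp_hasDerivAt 1 h4
  simp only [picardTerm_succ_smul] at h2
  rw [h2.unique h1]
  simp [Finset.sum_mul]

/-- The sum of the Picard iterates solves the equation along the rays. -/
lemma exists_radial_solution (hH : IsOpen H)
    (hstar : ∀ s ∈ H, ∀ τ ∈ Icc (0 : ℝ) 1, (τ : ℂ) • s ∈ H)
    (hΘ : ∀ i, AnalyticOnNhd ℂ (Θ i) H) :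
    ∃ Y : (Fin m → ℂ) → 𝔸, AnalyticOnNhd ℂ Y H ∧ Y 0 = 1 ∧
      ∀ s ∈ H, fderiv ℂ Y s s = (∑ i, s i • Θ i s) * Y s := by
  have hT := analyticOnNhd_picardTerm hH hstar hΘ
  -- locally uniform bounds
  have hbound : ∀ s ∈ H, ∃ (ε : ℝ) (b : ℕ → ℝ), 0 < ε ∧ ball s ε ⊆ H ∧ Summable b ∧
      ∀ j, ∀ x ∈ ball s ε, ‖picardTerm Θ j x‖ ≤ b j := by
    intro s hs
    obtain ⟨ε, C, hε, hC, hCH, hball, hCstar⟩ := exists_compact_star hH hstar hs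
    obtain ⟨K, hK⟩ : ∃ K : ℝ, ∀ x ∈ C, ∀ i, ‖Θ i x‖ ≤ K := by
      have h1 : ContinuousOn (fun x => fun i => Θ i x) C :=
        continuousOn_pi.2 fun i => (hΘ i).continuousOn.mono hCH
      obtain ⟨K, hK⟩ := hC.exists_bound_of_continuousOn h1
      exact ⟨K, fun x hx i => (norm_le_pi_norm (fun i => Θ i x) i).trans (hK x hx)⟩
    obtain ⟨D, hD⟩ := hC.exists_bound_of_continuousOn (f := fun x : Fin m → ℂ => ∑ i, ‖x i‖)
      (Continuous.continuousOn (by fun_prop))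
    have hsC : s ∈ C := hball (mem_ball_self hε)
    refine ⟨ε, fun j => ‖(1 : 𝔸)‖ * ((D * max K 0) ^ j / j.factorial), hε, hball.trans hCH,
      (Real.summable_pow_div_factorial _).mul_left _, fun j x hx => ?_⟩
    have h1 := norm_picardTerm_le (s := x) (le_max_right K 0)
      (fun τ hτ i => (hK _ (hCstar x (hball hx) τ hτ) i).trans (le_max_left _ _)) j 1
      ⟨zero_le_one, le_rfl⟩
    rw [Complex.ofReal_one, one_smul] at h1
    refine h1.trans (mul_le_mul_of_nonneg_left ?_ (norm_nonneg _))
    rw [one_pow, mul_one_div]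
    have h2 := (le_abs_self _).trans (hD x (hball hx))
    gcongr
  have hsum : ∀ s ∈ H, Summable fun j => picardTerm Θ j s := fun s hs => by
    obtain ⟨ε, b, hε, -, hb, hle⟩ := hbound s hs
    exact Summable.of_norm_bounded hb fun j => hle j s (mem_ball_self hε)
  have hYan : AnalyticOnNhd ℂ (fun s => ∑' j, picardTerm Θ j s) H := by
    refine analyticOnNhd_of_continuousOn hH (fun s hs => ?_) fun s hs i => ?_
    · obtain ⟨ε, b, hε, hεH, hb, hle⟩ := hbound s hs
      refine ContinuousAt.continuousWithinAt ?_
      exact (continuousOn_tsum (fun j => (hT j).continuousOn.mono hεH) hb hle).continuousAt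
        (isOpen_ball.mem_nhds (mem_ball_self hε))
    · obtain ⟨ε, b, hε, hεH, hb, hle⟩ := hbound s hs
      have hW : IsOpen {z : ℂ | Function.update s i z ∈ ball s ε} :=
        isOpen_ball.preimage (by fun_prop)
      refine (Complex.differentiableOn_tsum_of_summable_norm hb (fun j z hz => ?_) hW
        fun j z hz => hle j _ hz).differentiableAt (hW.mem_nhds ?_)
      · exact ((hT j _ (hεH hz)).differentiableAt.comp z
          (hasFDerivAt_update s z).differentiableAt).differentiableWithinAt
      · simpa using hε
  refine ⟨_, hYan, ?_, fun s hs => ?_⟩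
  · rw [tsum_eq_single 0]
    · rfl
    · intro j hj
      obtain ⟨j, rfl⟩ := Nat.exists_eq_succ_of_ne_zero hj
      simp [picardTerm]
  · obtain ⟨ε, b, hε, hεH, hb, hle⟩ := hbound s hs
    have hW : IsOpen {z : ℂ | z • s ∈ ball s ε} := isOpen_ball.preimage (by fun_prop)
    have h1W : (1 : ℂ) ∈ {z : ℂ | z • s ∈ ball s ε} := by simpa using hε
    have hline : ∀ f : (Fin m → ℂ) → 𝔸, AnalyticOnNhd ℂ f H → ∀ z : ℂ, z • s ∈ H →
        HasDerivAt (fun z : ℂ => f (z • s)) (fderiv ℂ f (z • s) s) z := by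
      intro f hf z hz
      have h4 : HasDerivAt (fun u : ℂ => u • s) s z := by
        simpa using (hasDerivAt_id z).smul_const s
      exact (hf _ hz).differentiableAt.hasFDerivAt.comp_hasDerivAt z h4
    have h1 := Complex.hasSum_deriv_of_summable_norm hb
      (fun j z hz => (hline _ (hT j) z (hεH hz)).differentiableAt.differentiableWithinAt) hW
      (fun j z hz => hle j _ hz) h1W
    rw [(hline _ hYan 1 (by simpa using hs)).deriv] at h1
    simp only [(hline _ (hT _) 1 (by simpa using hs)).deriv, one_smul] at h1
    have h2 := (hasSum_nat_add_iff' 1).2 h1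
    have h3 : fderiv ℂ (picardTerm Θ 0) s s = 0 := by
      have : picardTerm Θ 0 = fun _ => (1 : 𝔸) := rfl
      rw [this]; simp
    simp only [Finset.range_one, Finset.sum_singleton, h3, sub_zero,
      fderiv_picardTerm_succ hH hstar hΘ _ hs] at h2
    exact h2.unique ((hsum s hs).hasSum.mul_left _)

end Frobenius

/-! ### Integrability -/

section Frobenius

variable {m : ℕ} {𝔸 : Type*} [NormedRing 𝔸] [NormedAlgebra ℂ 𝔸] [CompleteSpace 𝔸]

/-- The Frobenius theorem for linear systems: a solution along the rays solves the whole integrable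
system, because the defects `E i = ∂Y/∂s_i - Θ i Y` satisfy a homogeneous linear equation along the
rays and `τ E i` vanishes at `τ = 0`. -/
lemma fderiv_eq_of_radial {H : Set (Fin m → ℂ)} {Θ : Fin m → (Fin m → ℂ) → 𝔸} (hH : IsOpen H)
    (hstar : ∀ s ∈ H, ∀ τ ∈ Icc (0 : ℝ) 1, (τ : ℂ) • s ∈ H) (hΘ : ∀ i, AnalyticOnNhd ℂ (Θ i) H)
    (hint : ∀ s ∈ H, ∀ i j, fderiv ℂ (Θ j) s (Pi.single i 1) - fderiv ℂ (Θ i) s (Pi.single j 1) =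
      Θ i s * Θ j s - Θ j s * Θ i s)
    {Y : (Fin m → ℂ) → 𝔸} (hY : AnalyticOnNhd ℂ Y H)
    (hrad : ∀ s ∈ H, fderiv ℂ Y s s = (∑ i, s i • Θ i s) * Y s) :
    ∀ s ∈ H, ∀ i, fderiv ℂ Y s (Pi.single i 1) = Θ i s * Y s := by
  intro s hs i
  set R : (Fin m → ℂ) → 𝔸 := fun x => ∑ j, x j • Θ j x with hR
  set D : (Fin m → ℂ) → 𝔸 := fun x => fderiv ℂ Y x (Pi.single i 1) - Θ i x * Y x with hD
  have hY' : AnalyticOnNhd ℂ (fderiv ℂ Y) H := hY.fderiv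
  have hsingle : ∀ (L : (Fin m → ℂ) →L[ℂ] 𝔸) (x : Fin m → ℂ),
      L x = ∑ j, x j • L (Pi.single j 1) := fun L x => by
    have h : x = ∑ j, x j • (Pi.single j 1 : Fin m → ℂ) := (pi_eq_sum_univ' x).trans (by simp)
    conv_lhs => rw [h]
    rw [map_sum]
    simp only [map_smul]
  -- the equation satisfied by the defect along the rays
  have key : ∀ x ∈ H, HasFDerivAt D (fderiv ℂ D x) x ∧ fderiv ℂ D x x = R x * D x - D x := by
    intro x hx
    have hYx := (hY x hx).differentiableAt.hasFDerivAt
    have hY'x := (hY' x hx).differentiableAt.hasFDerivAt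
    have hΘx := fun j => (hΘ j x hx).differentiableAt.hasFDerivAt
    have hDx := (hY'x.clm_apply (hasFDerivAt_const (Pi.single i 1 : Fin m → ℂ) x)).sub
      ((hΘx i).mul' hYx)
    have hDx' : HasFDerivAt D _ x := hDx
    refine ⟨hDx'.differentiableAt.hasFDerivAt, ?_⟩
    -- differentiate the radial equation in the direction of the `i`-th coordinate
    have hproj : ∀ j, HasFDerivAt (fun x : Fin m → ℂ => x j)
      (ContinuousLinearMap.proj (R := ℂ) (φ := fun _ : Fin m => ℂ) j) x := fun j =>
      (ContinuousLinearMap.proj (R := ℂ) (φ := fun _ : Fin m => ℂ) j).hasFDerivAt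
    have h1 := hY'x.clm_apply (hasFDerivAt_id x)
    have h2 := (HasFDerivAt.fun_sum (u := Finset.univ) fun j _ => (hproj j).smul (hΘx j)).mul' hYx
    have h3 : (fun x => fderiv ℂ Y x x) =ᶠ[𝓝 x] fun x => (∑ j, x j • Θ j x) * Y x := by
      filter_upwards [hH.mem_nhds hx] with y hy using hrad y hy
    have h4 := DFunLike.congr_fun (h1.unique (h2.congr_of_eventuallyEq h3))
      (Pi.single i 1 : Fin m → ℂ)
    have hsymm : fderiv ℂ (fderiv ℂ Y) x x (Pi.single i 1) =
        fderiv ℂ (fderiv ℂ Y) x (Pi.single i 1) x :=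
      (hY x hx).contDiffAt.isSymmSndFDerivAt_of_omega.eq _ _
    have h5 : ∑ j, x j • fderiv ℂ (Θ j) x (Pi.single i 1) - fderiv ℂ (Θ i) x x =
        Θ i x * R x - R x * Θ i x := by
      rw [hsingle, ← Finset.sum_sub_distrib]
      simp only [← smul_sub, hint x hx, hR, Finset.mul_sum, Finset.sum_mul, mul_smul_comm,
        smul_mul_assoc]
      simp only [smul_sub, Finset.sum_sub_distrib]
    rw [hDx'.fderiv]
    simp only [_root_.sub_apply, _root_.add_apply,
      _root_.smul_apply, ContinuousLinearMap.comp_apply,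
      ContinuousLinearMap.flip_apply, ContinuousLinearMap.smulRight_apply,
      _root_.zero_apply, map_zero, zero_add,
      MulOpposite.smul_eq_mul_unop, MulOpposite.unop_op, smul_eq_mul, _root_.sum_apply,
      ContinuousLinearMap.id_apply, ContinuousLinearMap.proj_apply, id] at h4 ⊢
    have h6 : ∑ j, (x j • fderiv ℂ (Θ j) x (Pi.single i 1) +
        (Pi.single i 1 : Fin m → ℂ) j • Θ j x) = fderiv ℂ (Θ i) x x + (Θ i x * R x - R x * Θ i x) +
          Θ i x := by
      rw [← h5, Finset.sum_add_distrib]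
      simp [Pi.single_apply, ite_smul]
    have h7 : (∑ j, ((fun x : Fin m → ℂ => x j) • Θ j) x) = R x := rfl
    rw [h6, h7] at h4
    rw [hsymm, hrad x hx, eq_sub_of_add_eq' h4]
    simp only [hD]
    change _ - (_ * (R x * Y x) + _) = _
    noncomm_ring
  -- Grönwall's inequality along the ray through `s`
  have hφ : ∀ τ ∈ Icc (0 : ℝ) 1, HasDerivAt (fun τ : ℝ => (τ : ℂ) • D ((τ : ℂ) • s))
      ((∑ j, s j • Θ j ((τ : ℂ) • s)) * ((τ : ℂ) • D ((τ : ℂ) • s))) τ := by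
    intro τ hτ
    obtain ⟨h1, h2⟩ := key _ (hstar s hs τ hτ)
    have h3 : HasDerivAt (fun u : ℝ => (u : ℂ) • s) s τ := by
      simpa using (Complex.ofRealCLM.hasDerivAt (x := τ)).smul_const s
    have h4 : HasDerivAt (fun u : ℝ => D ((u : ℂ) • s)) (fderiv ℂ D ((τ : ℂ) • s) s) τ :=
      HasFDerivAt.comp_hasDerivAt (l := D) (f := fun u : ℝ => (u : ℂ) • s) τ
        (h1.restrictScalars ℝ) h3
    have h5 := (Complex.ofRealCLM.hasDerivAt (x := τ)).smul h4
    refine h5.congr_deriv ?_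
    rw [map_smul] at h2
    simp only [Complex.ofRealCLM_apply, Complex.ofReal_one, one_smul]
    rw [h2, sub_add_cancel, hR]
    simp only [Pi.smul_apply, smul_eq_mul, mul_smul, ← Finset.smul_sum, mul_smul_comm,
      smul_mul_assoc]
  obtain ⟨K, hK⟩ := (isCompact_Icc (a := (0 : ℝ)) (b := 1)).exists_bound_of_continuousOn
    (f := fun τ : ℝ => ∑ j, s j • Θ j ((τ : ℂ) • s))
    (continuousOn_finsetSum _ fun j _ =>
      (continuousOn_ray hstar (hΘ j).continuousOn hs).const_smul (s j))
  have hzero := eq_zero_of_abs_deriv_le_mul_abs_self_of_eq_zero_right (K := K) (a := 0) (b := 1)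
    (fun τ hτ => (hφ τ hτ).continuousAt.continuousWithinAt)
    (fun τ hτ => (hφ τ ⟨hτ.1, hτ.2.le⟩).hasDerivWithinAt) (by simp)
    (fun τ hτ => (norm_mul_le _ _).trans
      (mul_le_mul_of_nonneg_right (hK τ ⟨hτ.1, hτ.2.le⟩) (norm_nonneg _))) 1 ⟨zero_le_one, le_rfl⟩
  simp only [Complex.ofReal_one, one_smul] at hzero
  exact sub_eq_zero.1 hzero

end Frobenius

/-! ### Fundamental solutions on convex sets -/

section FundamentalSolution

variable {m : ℕ}

lemma clm_eq_sum {E : Type*} [NormedAddCommGroup E] [NormedSpace ℂ E] (L : (Fin m → ℂ) →L[ℂ] E)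
    (x : Fin m → ℂ) : L x = ∑ j, x j • L (Pi.single j 1) := by
  have h : x = ∑ j, x j • (Pi.single j 1 : Fin m → ℂ) := (pi_eq_sum_univ' x).trans (by simp)
  conv_lhs => rw [h]
  rw [map_sum]
  simp only [map_smul]

lemma eq_of_partial_eq_zero {E : Type*} [NormedAddCommGroup E] [NormedSpace ℂ E]
    {H : Set (Fin m → ℂ)} (hH : IsOpen H) (hconv : Convex ℝ H) {f : (Fin m → ℂ) → E}
    (hf : DifferentiableOn ℂ f H) (h : ∀ s ∈ H, ∀ i, fderiv ℂ f s (Pi.single i 1) = 0)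
    {s s' : Fin m → ℂ} (hs : s ∈ H) (hs' : s' ∈ H) : f s = f s' := by
  refine hH.is_const_of_fderiv_eq_zero (𝕜 := ℂ) hconv.isPreconnected hf (fun x hx => ?_) hs hs'
  refine ContinuousLinearMap.ext fun v => ?_
  rw [clm_eq_sum]
  simp [h x hx]

variable {𝔸 : Type*} [NormedRing 𝔸] [NormedAlgebra ℂ 𝔸] [CompleteSpace 𝔸]

lemma exists_solution {H : Set (Fin m → ℂ)} {Θ : Fin m → (Fin m → ℂ) → 𝔸}
    (hH : IsOpen H) (hconv : Convex ℝ H) {s₀ : Fin m → ℂ} (hs₀ : s₀ ∈ H)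
    (hΘ : ∀ i, AnalyticOnNhd ℂ (Θ i) H)
    (hint : ∀ s ∈ H, ∀ i j, fderiv ℂ (Θ j) s (Pi.single i 1) - fderiv ℂ (Θ i) s (Pi.single j 1) =
      Θ i s * Θ j s - Θ j s * Θ i s) :
    ∃ Y : (Fin m → ℂ) → 𝔸, AnalyticOnNhd ℂ Y H ∧ Y s₀ = 1 ∧
      ∀ s ∈ H, ∀ i, fderiv ℂ Y s (Pi.single i 1) = Θ i s * Y s := by
  have hH' : IsOpen {x | x + s₀ ∈ H} := hH.preimage (by fun_prop)
  have hstar : ∀ s ∈ {x | x + s₀ ∈ H}, ∀ τ ∈ Icc (0 : ℝ) 1, (τ : ℂ) • s ∈ {x | x + s₀ ∈ H} := by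
    intro s hs τ hτ
    have h1 := hconv.add_smul_mem hs₀ (show s₀ + s ∈ H by rw [add_comm]; exact hs) hτ
    rw [mem_ofPred_eq, add_comm, Complex.coe_smul]
    exact h1
  have htrans : ∀ s : Fin m → ℂ, AnalyticAt ℂ (fun x : Fin m → ℂ => x + s₀) s := fun s =>
    analyticAt_id.add analyticAt_const
  have hΘ' : ∀ i, AnalyticOnNhd ℂ (fun x => Θ i (x + s₀)) {x | x + s₀ ∈ H} := fun i s hs =>
    AnalyticAt.fun_comp (f := fun x => x + s₀) (hΘ i _ hs) (htrans s)
  obtain ⟨Y, hY, hY0, hrad⟩ := exists_radial_solution hH' hstar hΘ'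
  have hsol := fderiv_eq_of_radial hH' hstar hΘ' (fun s hs i j => by
    simp only [fderiv_comp_add_right]
    exact hint _ hs i j) hY hrad
  refine ⟨fun s => Y (s - s₀), fun s hs => ?_, by simpa using hY0, fun s hs i => ?_⟩
  · refine (hY (s - s₀) (by simpa using hs)).fun_comp (f := fun s => s - s₀) ?_
    exact analyticAt_id.sub analyticAt_const
  · simp only [sub_eq_add_neg, fderiv_comp_add_right]
    simpa [sub_eq_add_neg] using hsol (s - s₀) (by simpa using hs) i

/-- On a convex open set an integrable linear system has a fundamental solution `Y`; its inverse
`Z` is a solution of the adjoint system, obtained from the opposite algebra. -/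
theorem exists_fundamental_pair {H : Set (Fin m → ℂ)} {Θ : Fin m → (Fin m → ℂ) → 𝔸}
    (hH : IsOpen H) (hconv : Convex ℝ H) {s₀ : Fin m → ℂ} (hs₀ : s₀ ∈ H)
    (hΘ : ∀ i, AnalyticOnNhd ℂ (Θ i) H)
    (hint : ∀ s ∈ H, ∀ i j, fderiv ℂ (Θ j) s (Pi.single i 1) - fderiv ℂ (Θ i) s (Pi.single j 1) =
      Θ i s * Θ j s - Θ j s * Θ i s) :
    ∃ Y Z : (Fin m → ℂ) → 𝔸, AnalyticOnNhd ℂ Y H ∧ AnalyticOnNhd ℂ Z H ∧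
      (∀ s ∈ H, ∀ i, fderiv ℂ Y s (Pi.single i 1) = Θ i s * Y s) ∧
      (∀ s ∈ H, ∀ i, fderiv ℂ Z s (Pi.single i 1) = -(Z s * Θ i s)) ∧
      ∀ s ∈ H, Z s * Y s = 1 := by
  obtain ⟨Y, hY, hY0, hYs⟩ := exists_solution hH hconv hs₀ hΘ hint
  let op : 𝔸 ≃L[ℂ] 𝔸ᵐᵒᵖ := MulOpposite.opContinuousLinearEquiv ℂ
  have hop : ∀ a, op a = MulOpposite.op a := fun a => rfl
  have hΘ' : ∀ i, AnalyticOnNhd ℂ (fun s => op (-Θ i s)) H := fun i s hs =>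
    (op.toContinuousLinearMap.analyticAt _).fun_comp ((hΘ i s hs).neg)
  have hder : ∀ i s v, fderiv ℂ (fun s => op (-Θ i s)) s v = op (-fderiv ℂ (Θ i) s v) := by
    intro i s v
    have h1 := op.comp_fderiv (f := fun s => -Θ i s) (x := s)
    have h2 : (fun s => op (-Θ i s)) = op ∘ fun s => -Θ i s := rfl
    rw [h2, h1, fderiv_fun_neg]
    rfl
  obtain ⟨W, hW, hW0, hWs⟩ := exists_solution hH hconv hs₀ hΘ' (fun s hs i j => by
    rw [hder, hder, ← map_sub]
    simp only [hop, ← MulOpposite.op_mul, ← MulOpposite.op_sub]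
    congr 1
    have := hint s hs i j
    rw [neg_sub_neg, ← neg_sub, this]
    noncomm_ring)
  let unop := op.symm
  have hunop : ∀ a, unop a = MulOpposite.unop a := fun a => rfl
  have hZ : AnalyticOnNhd ℂ (fun s => unop (W s)) H := fun s hs =>
    (unop.toContinuousLinearMap.analyticAt _).fun_comp (hW s hs)
  have hZs : ∀ s ∈ H, ∀ i, fderiv ℂ (fun s => unop (W s)) s (Pi.single i 1) =
      -(unop (W s) * Θ i s) := by
    intro s hs i
    have h1 := unop.comp_fderiv (f := W) (x := s)
    have h2 : (fun s => unop (W s)) = unop ∘ W := rfl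
    rw [h2, h1, ContinuousLinearMap.comp_apply, hWs s hs i]
    change MulOpposite.unop (MulOpposite.op (-Θ i s) * W s) = _
    simp [hunop]
  refine ⟨Y, fun s => unop (W s), hY, hZ, hYs, hZs, fun s hs => ?_⟩
  have hder0 : ∀ s ∈ H, ∀ i, fderiv ℂ (fun s => unop (W s) * Y s) s (Pi.single i 1) = 0 := by
    intro s hs i
    rw [fderiv_fun_mul' (hZ s hs).differentiableAt (hY s hs).differentiableAt]
    change unop (W s) * fderiv ℂ Y s (Pi.single i 1) +
      fderiv ℂ (fun s => unop (W s)) s (Pi.single i 1) * Y s = 0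
    rw [hYs s hs, hZs s hs]
    noncomm_ring
  have := eq_of_partial_eq_zero hH hconv (f := fun s => unop (W s) * Y s)
    (fun s hs => ((hZ s hs).mul (hY s hs)).differentiableAt.differentiableWithinAt) hder0 hs hs₀
  rw [this, hW0, hY0, hunop, MulOpposite.unop_one, mul_one]

end FundamentalSolution

/-! ### Commuting logarithms -/

section MatrixLogarithm

variable {𝔸 : Type*} [NormedRing 𝔸] [NormedAlgebra ℂ 𝔸] [FiniteDimensional ℂ 𝔸]

/-- A unit of a finite-dimensional algebra is a unit in every subalgebra containing it. -/
lemma isUnit_of_isUnit_coe (B : Subalgebra ℂ 𝔸) (b : B)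
    (hb : IsUnit (b : 𝔸)) : IsUnit b := by
  have hinj : Function.Injective (LinearMap.mulLeft ℂ b) := by
    intro x y hxy
    have h1 : (b : 𝔸) * x = b * y := congrArg Subtype.val hxy
    exact Subtype.ext (hb.mul_left_cancel h1)
  obtain ⟨c, hc⟩ := LinearMap.injective_iff_surjective.1 hinj 1
  have hc' : b * c = 1 := hc
  have hcb : c * b = 1 := by
    have h2 : b * (c * b) = b * 1 := by rw [← mul_assoc, hc', one_mul, mul_one]
    exact hinj h2
  exact ⟨⟨b, c, hc', hcb⟩, rfl⟩

lemma finite_spectrum (x : 𝔸) : (spectrum ℂ x).Finite := by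
  refine (Module.End.finite_spectrum (LinearMap.mulLeft ℂ x)).subset fun z hz hu => hz ?_
  have h1 : algebraMap ℂ (Module.End ℂ 𝔸) z - LinearMap.mulLeft ℂ x =
      LinearMap.mulLeft ℂ (algebraMap ℂ 𝔸 z - x) := by
    ext y
    simp [sub_mul, Algebra.smul_def]
  replace hu : IsUnit (LinearMap.mulLeft ℂ (algebraMap ℂ 𝔸 z - x)) := h1 ▸ hu
  obtain ⟨c, hc⟩ := ((Module.End.isUnit_iff _).1 hu).2 1
  have hc' : (algebraMap ℂ 𝔸 z - x) * c = 1 := hc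
  have hc2 : c * (algebraMap ℂ 𝔸 z - x) = 1 := by
    refine ((Module.End.isUnit_iff _).1 hu).1 ?_
    change (algebraMap ℂ 𝔸 z - x) * (c * (algebraMap ℂ 𝔸 z - x)) = (algebraMap ℂ 𝔸 z - x) * 1
    rw [← mul_assoc, hc', one_mul, mul_one]
  exact ⟨⟨_, c, hc', hc2⟩, rfl⟩

/-- Every unit of a commutative finite-dimensional complex algebra is an exponential: the
exponentials form an open and closed subset of the units `1 + z (b - 1)`, where `z` runs
through the complement of a finite subset of `ℂ`. -/
lemma exists_exp_eq_of_commutative (B : Subalgebra ℂ 𝔸)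
    (hcomm : ∀ x y : B, x * y = y * x) (b : B) (hb : IsUnit (b : 𝔸)) :
    ∃ a : B, NormedSpace.exp a = b := by
  have : CompleteSpace B := FiniteDimensional.complete ℂ B
  let : NormedAlgebra ℚ B := NormedAlgebra.restrictScalars ℚ ℂ B
  have hadd : ∀ x y : B, NormedSpace.exp (x + y) = NormedSpace.exp x * NormedSpace.exp y :=
    fun x y => NormedSpace.exp_add_of_commute (hcomm x y)
  have hopen : ∀ c : B, IsUnit c → Filter.map (fun a => c * NormedSpace.exp a) (𝓝 0) = 𝓝 c := by
    intro c hc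
    obtain ⟨u, rfl⟩ := hc
    have h1 : Filter.map (NormedSpace.exp : B → B) (𝓝 0) = 𝓝 1 := by
      have := (hasStrictFDerivAt_exp_zero (𝕂 := ℂ) (𝔸 := B)).map_nhds_eq_of_equiv
        (f' := ContinuousLinearEquiv.refl ℂ B)
      rwa [NormedSpace.exp_zero] at this
    have h2 : Filter.map (fun x : B => (u : B) * x) (𝓝 1) = 𝓝 (u : B) := by
      let e : B ≃ₜ B :=
        { Units.mulLeft u with
          continuous_toFun := continuous_const_mul (u : B)
          continuous_invFun := continuous_const_mul ((u⁻¹ : Bˣ) : B) }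
      have h8 := e.map_nhds_eq 1
      rwa [show e 1 = (u : B) from mul_one (u : B)] at h8
    rw [← h2, ← h1, Filter.map_map]
    rfl
  set γ : ℂ → B := fun z => 1 + z • (b - 1) with hγ
  have hγc : Continuous γ := by fun_prop
  set D : Set ℂ := {z | IsUnit (γ z : 𝔸)} with hD
  have hDcon : IsPreconnected D := by
    have hfin : Dᶜ.Finite := by
      refine ((finite_spectrum (b - 1 : 𝔸)).image
        fun w => -w⁻¹).subset fun z hz => ?_
      have hz0 : z ≠ 0 := by
        rintro rfl
        exact hz (by simp [hD, hγ])
      refine ⟨-z⁻¹, ?_, by simp⟩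
      rw [spectrum.mem_iff]
      intro hu
      refine hz ?_
      have h3 : (γ z : 𝔸) =
          (-z) • (algebraMap ℂ 𝔸 (-z⁻¹) - (b - 1)) := by
        have h7 : (-z) • algebraMap ℂ 𝔸 (-z⁻¹) = 1 := by
          rw [Algebra.algebraMap_eq_smul_one, smul_smul, neg_mul_neg, mul_inv_cancel₀ hz0, one_smul]
        rw [smul_sub, h7, neg_smul, sub_neg_eq_add]
        rfl
      rw [hD, mem_ofPred_eq, h3]
      exact hu.smul (Units.mk0 (-z) (neg_ne_zero.2 hz0))
    have h4 := hfin.countable.isConnected_compl_of_one_lt_rank (E := ℂ) (by simp)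
    rw [compl_compl] at h4
    exact h4.isPreconnected
  set R : Set ℂ := {z | ∃ a : B, NormedSpace.exp a = γ z} with hR
  have hnear : ∀ z ∈ D, ∀ᶠ w in 𝓝 z, (w ∈ R ↔ z ∈ R) := by
    intro z hz
    have h5 := hopen (γ z) (isUnit_of_isUnit_coe B _ hz)
    have h6 : ∀ᶠ x in 𝓝 (γ z), ∃ a : B, x = γ z * NormedSpace.exp a := by
      rw [← h5]
      exact Filter.eventually_map.2 (Filter.Eventually.of_forall fun a => ⟨a, rfl⟩)
    filter_upwards [hγc.continuousAt.eventually h6] with w hw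
    obtain ⟨a, ha⟩ := hw
    constructor
    · rintro ⟨x, hx⟩
      refine ⟨x + -a, ?_⟩
      rw [hadd, hx, ha, mul_assoc, ← hadd, add_neg_cancel, NormedSpace.exp_zero, mul_one]
    · rintro ⟨x, hx⟩
      exact ⟨x + a, by rw [hadd, hx, ha]⟩
  have h1R : (1 : ℂ) ∈ R := by
    by_contra hnot
    have h0D : (0 : ℂ) ∈ D := by simp [hD, hγ]
    have h1D : (1 : ℂ) ∈ D := by simpa [hD, hγ] using hb
    obtain ⟨z, hzD, hz1, hz2⟩ := hDcon (interior R) (interior Rᶜ) isOpen_interior isOpen_interior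
      (fun z hz => by
        by_cases hzR : z ∈ R
        · exact Or.inl (mem_interior_iff_mem_nhds.2
            ((hnear z hz).mono fun w hw => hw.2 hzR))
        · exact Or.inr (mem_interior_iff_mem_nhds.2
            ((hnear z hz).mono fun w hw hwR => hzR (hw.1 hwR))))
      ⟨0, h0D, mem_interior_iff_mem_nhds.2 ((hnear 0 h0D).mono fun w hw =>
        hw.2 ⟨0, by simp [hγ]⟩)⟩
      ⟨1, h1D, mem_interior_iff_mem_nhds.2 ((hnear 1 h1D).mono fun w hw hwR => hnot (hw.1 hwR))⟩
    exact interior_subset hz2 (interior_subset hz1)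
  obtain ⟨a, ha⟩ := h1R
  exact ⟨a, by rw [ha]; simp [hγ]⟩

/-- Commuting units of a finite-dimensional complex algebra have commuting logarithms. -/
theorem exists_commuting_logs {ι : Type*} (M : ι → 𝔸)
    (hM : ∀ i, IsUnit (M i)) (hcomm : ∀ i j, Commute (M i) (M j)) :
    ∃ A : ι → 𝔸, (∀ i j, Commute (A i) (A j)) ∧
      ∀ i, NormedSpace.exp (A i) = M i := by
  set B := Algebra.adjoin ℂ (range M) with hB
  have hBcomm : ∀ x y : B, x * y = y * x := by
    have := Algebra.isMulCommutative_adjoin ℂ (s := range M) (by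
      rintro _ ⟨i, rfl⟩ _ ⟨j, rfl⟩
      exact hcomm i j)
    exact fun x y => mul_comm' x y
  have hmem : ∀ i, M i ∈ B := fun i => Algebra.subset_adjoin ⟨i, rfl⟩
  choose a ha using fun i => exists_exp_eq_of_commutative B hBcomm ⟨M i, hmem i⟩ (hM i)
  refine ⟨fun i => a i, fun i j => congrArg Subtype.val (hBcomm (a i) (a j)), fun i => ?_⟩
  have : CompleteSpace B := FiniteDimensional.complete ℂ B
  let : NormedAlgebra ℚ B := NormedAlgebra.restrictScalars ℚ ℂ B
  let : NormedAlgebra ℚ 𝔸 := NormedAlgebra.restrictScalars ℚ ℂ 𝔸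
  have h1 := NormedSpace.map_exp B.val (continuous_subtype_val) (a i)
  rw [ha i] at h1
  exact h1.symm

end MatrixLogarithm

/-! ### Floquet theory -/

section Floquet

variable {m : ℕ} {𝔸 : Type*} [NormedRing 𝔸] [NormedAlgebra ℂ 𝔸] [FiniteDimensional ℂ 𝔸]

lemma norm_exp_le (x : 𝔸) : ‖NormedSpace.exp x‖ ≤ ‖(1 : 𝔸)‖ * Real.exp ‖x‖ := by
  have : CompleteSpace 𝔸 := FiniteDimensional.complete ℂ 𝔸
  have h1 : HasSum (fun j : ℕ => ‖(1 : 𝔸)‖ * (‖x‖ ^ j / j.factorial))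
      (‖(1 : 𝔸)‖ * Real.exp ‖x‖) := by
    have := NormedSpace.expSeries_div_hasSum_exp ‖x‖
    rw [← Real.exp_eq_exp_ℝ] at this
    exact this.mul_left _
  have h2 : NormedSpace.exp x = ∑' j : ℕ, ((j.factorial : ℂ)⁻¹) • x ^ j := by
    rw [NormedSpace.exp_eq_tsum ℂ]
  rw [h2]
  refine tsum_of_norm_bounded h1 fun j => ?_
  have h3 : ‖x ^ j‖ ≤ ‖(1 : 𝔸)‖ * ‖x‖ ^ j := by
    induction j with
    | zero => simp
    | succ j ih =>
      rw [pow_succ, pow_succ, ← mul_assoc]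
      exact (norm_mul_le _ _).trans (mul_le_mul_of_nonneg_right ih (norm_nonneg _))
  rw [norm_smul, norm_inv, Complex.norm_natCast, inv_mul_eq_div, ← mul_div_assoc]
  gcongr

lemma isUnit_of_mul_eq_one' {a b : 𝔸} (h : a * b = 1) : IsUnit a ∧ IsUnit b := by
  have hinj : Function.Injective (LinearMap.mulLeft ℂ b) := fun x y hxy => by
    have h1 : a * (b * x) = a * (b * y) := congrArg (a * ·) hxy
    rwa [← mul_assoc, ← mul_assoc, h, one_mul, one_mul] at h1
  obtain ⟨c, hc⟩ := LinearMap.injective_iff_surjective.1 hinj 1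
  have hc' : b * c = 1 := hc
  have hac : a = c := by rw [← mul_one a, ← hc', ← mul_assoc, h, one_mul]
  rw [← hac] at hc'
  exact ⟨⟨⟨a, b, h, hc'⟩, rfl⟩, ⟨⟨b, a, hc', h⟩, rfl⟩⟩

lemma analyticAt_exp_neg_sum (A : Fin m → 𝔸) (s : Fin m → ℂ) :
    AnalyticAt ℂ (fun s : Fin m → ℂ => NormedSpace.exp (-∑ i, s i • A i)) s := by
  have : CompleteSpace 𝔸 := FiniteDimensional.complete ℂ 𝔸
  refine (NormedSpace.exp_analytic (𝕂 := ℂ) _).fun_comp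
    (f := fun s : Fin m → ℂ => -∑ i, s i • A i) ?_
  refine (Finset.analyticAt_fun_sum _ fun i _ => ?_).neg
  exact ((ContinuousLinearMap.proj (R := ℂ) (φ := fun _ : Fin m => ℂ) i).analyticAt s).smul
    analyticAt_const

lemma exp_neg_sum_add_single {A : Fin m → 𝔸} (hA : ∀ i j, Commute (A i) (A j)) (s : Fin m → ℂ)
    (i : Fin m) (z : ℂ) :
    NormedSpace.exp (-∑ j, (s + Pi.single i z : Fin m → ℂ) j • A j) =
      NormedSpace.exp (-z • A i) * NormedSpace.exp (-∑ j, s j • A j) := by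
  have : CompleteSpace 𝔸 := FiniteDimensional.complete ℂ 𝔸
  let : NormedAlgebra ℚ 𝔸 := NormedAlgebra.restrictScalars ℚ ℂ 𝔸
  have h1 : ∑ j, (s + Pi.single i z : Fin m → ℂ) j • A j = ∑ j, s j • A j + z • A i := by
    simp [add_smul, Finset.sum_add_distrib, Pi.single_apply, ite_smul]
  rw [h1, neg_add_rev, ← neg_smul]
  refine NormedSpace.exp_add_of_commute ?_
  exact (Commute.neg_right (Commute.sum_right _ _ _ fun j _ =>
    ((hA i j).smul_left _).smul_right _))

lemma fderiv_exp_neg_sum {A : Fin m → 𝔸} (hA : ∀ i j, Commute (A i) (A j)) (s : Fin m → ℂ)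
    (i : Fin m) :
    fderiv ℂ (fun s : Fin m → ℂ => NormedSpace.exp (-∑ j, s j • A j)) s (Pi.single i 1) =
      -(A i * NormedSpace.exp (-∑ j, s j • A j)) := by
  have : CompleteSpace 𝔸 := FiniteDimensional.complete ℂ 𝔸
  have h1 := (analyticAt_exp_neg_sum A s).differentiableAt.hasFDerivAt
  have h2 : HasDerivAt (fun z : ℂ => s + Pi.single i z) (Pi.single i (1 : ℂ)) 0 := by
    have := (ContinuousLinearMap.single ℂ (fun _ : Fin m => ℂ) i).hasDerivAt (x := 0)
    exact this.const_add s
  have h3 := h1.comp_hasDerivAt_of_eq 0 h2 (by simp)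
  have h4 : (fun s : Fin m → ℂ => NormedSpace.exp (-∑ j, s j • A j)) ∘
      (fun z : ℂ => s + Pi.single i z) =
      fun z => NormedSpace.exp (-z • A i) * NormedSpace.exp (-∑ j, s j • A j) := by
    funext z
    exact exp_neg_sum_add_single hA s i z
  rw [h4] at h3
  have h5 : HasDerivAt (fun z : ℂ => NormedSpace.exp (-z • A i)) (-A i) 0 := by
    have := hasDerivAt_exp_smul_const' (𝕂 := ℂ) (-A i) 0
    simpa using this
  rw [h3.unique (h5.mul_const _), neg_mul]

/-- Floquet's theorem: if an integrable system on a convex open set is invariant under the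
translations by `2πi` in the coordinates of index `< k`, its solution `Y` can be written as
`P(s) exp(∑ s_i A_i)` with a periodic function `P` and commuting constant `A_i`. -/
theorem exists_floquet {H : Set (Fin m → ℂ)} {Θ : Fin m → (Fin m → ℂ) → 𝔸}
    (hH : IsOpen H) (hconv : Convex ℝ H) {s₀ : Fin m → ℂ} (hs₀ : s₀ ∈ H)
    (hΘ : ∀ i, AnalyticOnNhd ℂ (Θ i) H)
    (hint : ∀ s ∈ H, ∀ i j, fderiv ℂ (Θ j) s (Pi.single i 1) - fderiv ℂ (Θ i) s (Pi.single j 1) =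
      Θ i s * Θ j s - Θ j s * Θ i s) (k : ℕ)
    (hHper : ∀ j : Fin m, (j : ℕ) < k → ∀ s,
      s + Pi.single j (2 * Real.pi * Complex.I) ∈ H ↔ s ∈ H)
    (hΘper : ∀ j : Fin m, (j : ℕ) < k → ∀ s ∈ H, ∀ i,
      Θ i (s + Pi.single j (2 * Real.pi * Complex.I)) = Θ i s) :
    ∃ (Y P : (Fin m → ℂ) → 𝔸) (A : Fin m → 𝔸), AnalyticOnNhd ℂ Y H ∧ AnalyticOnNhd ℂ P H ∧
      (∀ s ∈ H, IsUnit (Y s)) ∧ (∀ s ∈ H, IsUnit (P s)) ∧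
      (∀ s ∈ H, ∀ i, fderiv ℂ Y s (Pi.single i 1) = Θ i s * Y s) ∧
      (∀ s, P s = Y s * NormedSpace.exp (-∑ i, s i • A i)) ∧
      (∀ i : Fin m, ¬ (i : ℕ) < k → A i = 0) ∧
      (∀ s ∈ H, ∀ i, fderiv ℂ P s (Pi.single i 1) = Θ i s * P s - P s * A i) ∧
      ∀ j : Fin m, (j : ℕ) < k → ∀ s ∈ H,
        P (s + Pi.single j (2 * Real.pi * Complex.I)) = P s := by
  have : CompleteSpace 𝔸 := FiniteDimensional.complete ℂ 𝔸
  let : NormedAlgebra ℚ 𝔸 := NormedAlgebra.restrictScalars ℚ ℂ 𝔸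
  obtain ⟨Y, Z, hY, hZ, hYs, hZs, hZY⟩ := exists_fundamental_pair hH hconv hs₀ hΘ hint
  set τ : Fin m → Fin m → ℂ := fun j => Pi.single j (2 * Real.pi * Complex.I) with hτ
  have hYu : ∀ s ∈ H, IsUnit (Y s) := fun s hs => (isUnit_of_mul_eq_one' (hZY s hs)).2
  have hYZ : ∀ s ∈ H, Y s * Z s = 1 := fun s hs =>
    (hYu s hs).mul_right_cancel (by rw [mul_assoc, hZY s hs, mul_one, one_mul])
  -- the monodromy of `Y`
  set M : Fin m → 𝔸 := fun j => if (j : ℕ) < k then Z s₀ * Y (s₀ + τ j) else 1 with hM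
  have hmono : ∀ j : Fin m, (j : ℕ) < k → ∀ s ∈ H, Y (s + τ j) = Y s * M j := by
    intro j hj s hs
    have htr : ∀ s, AnalyticAt ℂ (fun s : Fin m → ℂ => s + τ j) s := fun s =>
      analyticAt_id.add analyticAt_const
    have hYt : ∀ s ∈ H, AnalyticAt ℂ (fun s => Y (s + τ j)) s := fun s hs =>
      AnalyticAt.fun_comp (f := fun s => s + τ j) (hY _ ((hHper j hj s).2 hs)) (htr s)
    have hder0 : ∀ s ∈ H, ∀ i, fderiv ℂ (fun s => Z s * Y (s + τ j)) s (Pi.single i 1) = 0 := by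
      intro s hs i
      rw [fderiv_fun_mul' (hZ s hs).differentiableAt (hYt s hs).differentiableAt]
      change Z s * fderiv ℂ (fun s => Y (s + τ j)) s (Pi.single i 1) +
        fderiv ℂ Z s (Pi.single i 1) * Y (s + τ j) = 0
      rw [fderiv_comp_add_right, hYs _ ((hHper j hj s).2 hs), hZs s hs, hΘper j hj s hs, neg_mul,
        ← mul_assoc]
      exact add_neg_cancel _
    have h1 := eq_of_partial_eq_zero hH hconv (f := fun s => Z s * Y (s + τ j))
      (fun s hs => ((hZ s hs).mul (hYt s hs)).differentiableAt.differentiableWithinAt) hder0 hs hs₀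
    have h2 : M j = Z s₀ * Y (s₀ + τ j) := if_pos hj
    rw [h2, ← h1, ← mul_assoc, hYZ s hs, one_mul]
  have hMu : ∀ j, IsUnit (M j) := by
    intro j
    by_cases hj : (j : ℕ) < k
    · have h2 : M j = Z s₀ * Y (s₀ + τ j) := if_pos hj
      rw [h2]
      exact (isUnit_of_mul_eq_one' (hZY s₀ hs₀)).1.mul (hYu _ ((hHper j hj _).2 hs₀))
    · have h2 : M j = 1 := if_neg hj
      rw [h2]
      exact isUnit_one
  have hMc : ∀ i j, Commute (M i) (M j) := by
    intro i j
    by_cases hi : (i : ℕ) < k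
    swap
    · rw [show M i = 1 from if_neg hi]
      exact Commute.one_left _
    by_cases hj : (j : ℕ) < k
    swap
    · rw [show M j = 1 from if_neg hj]
      exact Commute.one_right _
    have h1 := hmono j hj _ ((hHper i hi s₀).2 hs₀)
    have h2 := hmono i hi _ ((hHper j hj s₀).2 hs₀)
    rw [hmono i hi s₀ hs₀] at h1
    rw [hmono j hj s₀ hs₀, add_right_comm, h1, mul_assoc, mul_assoc] at h2
    exact (hYu s₀ hs₀).mul_left_cancel h2
  obtain ⟨L, hLc, hL⟩ := exists_commuting_logs M hMu hMc
  have hpi : (2 * Real.pi * Complex.I : ℂ) ≠ 0 := Complex.two_pi_I_ne_zero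
  set A : Fin m → 𝔸 := fun j => if (j : ℕ) < k then (2 * Real.pi * Complex.I : ℂ)⁻¹ • L j else 0
    with hA
  have hAc : ∀ i j, Commute (A i) (A j) := by
    intro i j
    simp only [hA]
    split_ifs
    · exact ((hLc i j).smul_left _).smul_right _
    · exact Commute.zero_right _
    · exact Commute.zero_left _
    · exact Commute.zero_left _
  have hexp : ∀ s, AnalyticAt ℂ (fun s : Fin m → ℂ => NormedSpace.exp (-∑ j, s j • A j)) s :=
    analyticAt_exp_neg_sum A
  refine ⟨Y, fun s => Y s * NormedSpace.exp (-∑ i, s i • A i), A, hY,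
    fun s hs => (hY s hs).mul (hexp s), hYu, fun s hs => (hYu s hs).mul (NormedSpace.isUnit_exp _),
    hYs, fun _ => rfl, fun i hi => if_neg hi, fun s hs i => ?_, fun j hj s hs => ?_⟩
  · rw [fderiv_fun_mul' (hY s hs).differentiableAt (hexp s).differentiableAt]
    change Y s * fderiv ℂ (fun s : Fin m → ℂ => NormedSpace.exp (-∑ j, s j • A j)) s
      (Pi.single i 1) + fderiv ℂ Y s (Pi.single i 1) * NormedSpace.exp (-∑ j, s j • A j) = _
    have hcomm : Commute (A i) (NormedSpace.exp (-∑ j, s j • A j)) :=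
      Commute.exp_right (Commute.neg_right (Commute.sum_right _ _ _ fun j _ =>
        (hAc i j).smul_right _))
    rw [hYs s hs, fderiv_exp_neg_sum hAc, hcomm.eq]
    noncomm_ring
  · change Y (s + τ j) * NormedSpace.exp (-∑ i, (s + τ j) i • A i) = _
    have h1 : -(2 * Real.pi * Complex.I : ℂ) • A j = -L j := by
      rw [show A j = (2 * Real.pi * Complex.I : ℂ)⁻¹ • L j from if_pos hj, neg_smul, smul_smul,
        mul_inv_cancel₀ hpi, one_smul]
    have h2 : M j * NormedSpace.exp (-L j) = 1 := by
      rw [← hL j, ← NormedSpace.exp_add_of_commute (Commute.refl (L j)).neg_right,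
        add_neg_cancel, NormedSpace.exp_zero]
    rw [hτ, exp_neg_sum_add_single hAc, hmono j hj s hs, h1, mul_assoc, ← mul_assoc (M j), h2,
      one_mul]

end Floquet

/-! ### Logarithmic coordinates -/

section LogCoordinates

variable {m k : ℕ}

/-- The covering of the complement of the cross given by the exponential function in the coordinates
of index `< k`. -/
noncomputable def expCoord (k : ℕ) (s : Fin m → ℂ) : Fin m → ℂ :=
  fun i => if (i : ℕ) < k then Complex.exp (s i) else s i

/-- The branch of the inverse of `expCoord` near the point `u` outside the cross. -/
noncomputable def logCoord (k : ℕ) (u t : Fin m → ℂ) : Fin m → ℂ :=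
  fun i => if (i : ℕ) < k then Complex.log (t i / u i) + Complex.log (u i) else t i

/-- The vector field `logFactor k t i • ∂/∂t_i` is `t_i ∂/∂t_i` for `i < k` and `∂/∂t_i` otherwise;
it corresponds to `∂/∂s_i` under `expCoord`. -/
noncomputable def logFactor (k : ℕ) (t : Fin m → ℂ) (i : Fin m) : ℂ :=
  if (i : ℕ) < k then t i else 1

lemma logFactor_ne_zero {t : Fin m → ℂ} (ht : t ∉ cross m k) (i : Fin m) :
    logFactor k t i ≠ 0 := by
  unfold logFactor
  split_ifs with hi
  · exact notMem_cross_iff.1 ht i hi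
  · exact one_ne_zero

lemma expCoord_notMem_cross (s : Fin m → ℂ) : expCoord k s ∉ cross m k :=
  notMem_cross_iff.2 fun i hi => by
    rw [expCoord, if_pos hi]
    exact Complex.exp_ne_zero _

lemma expCoord_logCoord {u t : Fin m → ℂ} (hu : u ∉ cross m k) (ht : t ∉ cross m k) :
    expCoord k (logCoord k u t) = t := by
  funext i
  by_cases hi : (i : ℕ) < k
  · have h1 := notMem_cross_iff.1 hu i hi
    have h2 := notMem_cross_iff.1 ht i hi
    simp only [expCoord, logCoord, if_pos hi]
    rw [Complex.exp_add, Complex.exp_log (div_ne_zero h2 h1), Complex.exp_log h1,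
      div_mul_cancel₀ _ h1]
  · simp [expCoord, logCoord, hi]

lemma expCoord_add_period {j : Fin m} (hj : (j : ℕ) < k) (s : Fin m → ℂ) :
    expCoord k (s + Pi.single j (2 * Real.pi * Complex.I)) = expCoord k s := by
  funext i
  by_cases hij : i = j
  · subst hij
    simp only [expCoord, if_pos hj, Pi.add_apply, Pi.single_eq_same]
    exact Complex.exp_periodic _
  · simp [expCoord, Pi.single_eq_of_ne hij]

lemma hasFDerivAt_expCoord (s : Fin m → ℂ) :
    HasFDerivAt (expCoord k) (ContinuousLinearMap.pi fun i =>
      logFactor k (expCoord k s) i • ContinuousLinearMap.proj (R := ℂ) (φ := fun _ : Fin m => ℂ) i)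
      s := by
  refine hasFDerivAt_pi.2 fun i => ?_
  have h1 := (ContinuousLinearMap.proj (R := ℂ) (φ := fun _ : Fin m => ℂ) i).hasFDerivAt (x := s)
  by_cases hi : (i : ℕ) < k
  · simp only [expCoord, logFactor, if_pos hi]
    exact (Complex.hasDerivAt_exp (s i)).comp_hasFDerivAt s h1
  · simp only [expCoord, logFactor, if_neg hi, one_smul]
    exact h1

lemma differentiable_expCoord : Differentiable ℂ (expCoord k : (Fin m → ℂ) → Fin m → ℂ) :=
  fun s => (hasFDerivAt_expCoord s).differentiableAt

lemma hasFDerivAt_logCoord {u t : Fin m → ℂ} (hu : u ∉ cross m k)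
    (ht : ∀ i : Fin m, (i : ℕ) < k → t i / u i ∈ Complex.slitPlane) :
    HasFDerivAt (logCoord k u) (ContinuousLinearMap.pi fun i =>
      (logFactor k t i)⁻¹ • ContinuousLinearMap.proj (R := ℂ) (φ := fun _ : Fin m => ℂ) i) t := by
  refine hasFDerivAt_pi.2 fun i => ?_
  have h1 := (ContinuousLinearMap.proj (R := ℂ) (φ := fun _ : Fin m => ℂ) i).hasFDerivAt (x := t)
  by_cases hi : (i : ℕ) < k
  · have hui := notMem_cross_iff.1 hu i hi
    have hti : t i ≠ 0 := fun h => by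
      have := ht i hi
      rw [h, zero_div] at this
      exact Complex.zero_notMem_slitPlane this
    simp only [logCoord, logFactor, if_pos hi]
    have h2 := (((hasDerivAt_id (t i)).div_const (u i)).clog (ht i hi)).add_const
      (Complex.log (u i))
    have h3 : 1 / u i / (id (t i) / u i) = (t i)⁻¹ := by
      simp only [id]
      field_simp
    rw [h3] at h2
    exact h2.comp_hasFDerivAt t h1
  · simp only [logCoord, logFactor, if_neg hi, inv_one, one_smul]
    exact h1

/-- The chain rule for changes of coordinates with a diagonal Jacobian matrix. -/
lemma fderiv_comp_diagonal {E : Type*} [NormedAddCommGroup E] [NormedSpace ℂ E]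
    {g : (Fin m → ℂ) → E} {ψ : (Fin m → ℂ) → Fin m → ℂ} {s c : Fin m → ℂ}
    (hg : DifferentiableAt ℂ g (ψ s))
    (hψ : HasFDerivAt ψ (ContinuousLinearMap.pi fun i =>
      c i • ContinuousLinearMap.proj (R := ℂ) (φ := fun _ : Fin m => ℂ) i) s) (i : Fin m) :
    fderiv ℂ (fun s => g (ψ s)) s (Pi.single i 1) = c i • fderiv ℂ g (ψ s) (Pi.single i 1) := by
  have h1 := (hg.hasFDerivAt.comp s hψ).fderiv
  have h2 : (fun s => g (ψ s)) = g ∘ ψ := rfl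
  rw [h2, h1, ContinuousLinearMap.comp_apply, ← map_smul]
  congr 1
  funext j
  by_cases hij : j = i
  · subst hij
    simp
  · simp [Pi.single_eq_of_ne hij]

/-- The polydisc outside the cross in logarithmic coordinates. -/
def logPolydisc (m k : ℕ) (ρ : ℝ) : Set (Fin m → ℂ) := expCoord k ⁻¹' ball 0 ρ

lemma isOpen_logPolydisc (ρ : ℝ) : IsOpen (logPolydisc m k ρ) :=
  isOpen_ball.preimage differentiable_expCoord.continuous

lemma convex_logPolydisc {ρ : ℝ} (hρ : 0 < ρ) : Convex ℝ (logPolydisc m k ρ) := by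
  have h1 : logPolydisc m k ρ = univ.pi fun i : Fin m =>
      if (i : ℕ) < k then {z : ℂ | z.re < Real.log ρ} else ball 0 ρ := by
    ext s
    simp only [logPolydisc, mem_preimage, mem_ball_zero_iff, pi_norm_lt_iff hρ, mem_univ_pi]
    refine forall_congr' fun i => ?_
    by_cases hi : (i : ℕ) < k
    · simp only [expCoord, if_pos hi, Complex.norm_exp, mem_ofPred_eq]
      rw [Real.lt_log_iff_exp_lt hρ]
    · simp [expCoord, hi]
  rw [h1]
  refine convex_pi fun i _ => ?_
  split_ifs
  · exact convex_halfSpace_re_lt _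
  · exact convex_ball _ _

/-- A function with periods `2πi` in the first `k` coordinates descends along `expCoord`. -/
lemma eq_of_expCoord_eq {E : Type*} {ρ : ℝ} {P : (Fin m → ℂ) → E}
    (hP : ∀ j : Fin m, (j : ℕ) < k → ∀ s ∈ logPolydisc m k ρ,
      P (s + Pi.single j (2 * Real.pi * Complex.I)) = P s)
    {s s' : Fin m → ℂ} (hs : s ∈ logPolydisc m k ρ) (h : expCoord k s' = expCoord k s) :
    P s' = P s := by
  let G : AddSubgroup (Fin m → ℂ) :=
    { carrier := {v | ∀ s, (s + v ∈ logPolydisc m k ρ ↔ s ∈ logPolydisc m k ρ) ∧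
        (s ∈ logPolydisc m k ρ → P (s + v) = P s)}
      zero_mem' := fun s => by simp
      add_mem' := fun {a b} ha hb s => by
        rw [← add_assoc]
        exact ⟨(hb _).1.trans (ha s).1,
          fun hs => ((hb _).2 ((ha s).1.2 hs)).trans ((ha s).2 hs)⟩
      neg_mem' := fun {a} ha s => by
        have h1 := ha (s + -a)
        rw [neg_add_cancel_right] at h1
        exact ⟨h1.1.symm, fun hs => (h1.2 (h1.1.1 hs)).symm⟩ }
  have hsub : s' - s ∈ G := by
    have h1 : s' - s = ∑ i, Pi.single i (s' i - s i) :=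
      (Finset.univ_sum_single (s' - s)).symm
    rw [h1]
    refine sum_mem fun i _ => ?_
    have h2 := congrFun h i
    by_cases hi : (i : ℕ) < k
    · simp only [expCoord, if_pos hi] at h2
      obtain ⟨N, hN⟩ := Complex.exp_eq_exp_iff_exists_int.1 h2
      have h3 : (Pi.single i (s' i - s i) : Fin m → ℂ) =
          N • Pi.single i (2 * Real.pi * Complex.I) := by
        rw [← Pi.single_smul', hN, add_sub_cancel_left, zsmul_eq_mul]
      rw [h3]
      refine zsmul_mem (fun s => ⟨?_, hP i hi s⟩) N
      simp only [logPolydisc, mem_preimage, expCoord_add_period hi]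
    · simp only [expCoord, if_neg hi] at h2
      rw [h2, sub_self, Pi.single_zero]
      exact zero_mem G
  have := (hsub s).2 hs
  rwa [add_sub_cancel] at this

end LogCoordinates

/-! ### A frame of moderate growth -/

section Frame

variable {m k : ℕ} {𝔸 : Type*} [NormedRing 𝔸] [NormedAlgebra ℂ 𝔸]

/-- The product of sectors with opening `π` and axes `δ_i` (`i < k`), in the polydisc of
radius `ρ`. -/
def sector (k : ℕ) (ρ : ℝ) (δ : Fin m → ℂ) : Set (Fin m → ℂ) :=
  {t | t ∈ ball 0 ρ ∧ ∀ i : Fin m, (i : ℕ) < k → 0 < (t i / δ i).re}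

lemma sector_subset (ρ : ℝ) (δ : Fin m → ℂ) : sector k ρ δ ⊆ ball 0 ρ \ cross m k :=
  fun t ht => ⟨ht.1, notMem_cross_iff.2 fun i hi h => by
    have := ht.2 i hi
    simp [h] at this⟩

lemma isOpen_sector (ρ : ℝ) (δ : Fin m → ℂ) : IsOpen (sector k ρ δ) := by
  have h1 : sector k ρ δ = ball 0 ρ ∩ ⋂ i : Fin m, {t | (i : ℕ) < k → 0 < (t i / δ i).re} := by
    ext t
    simp [sector]
  rw [h1]
  refine isOpen_ball.inter (isOpen_iInter_of_finite fun i => ?_)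
  by_cases hi : (i : ℕ) < k
  · simp only [hi, forall_const]
    exact isOpen_lt continuous_const
      (Complex.continuous_re.comp ((continuous_apply i).div_const _))
  · simp [hi]

/-- Every point outside the cross lies in a sector whose axes are powers of `i`. -/
lemma exists_mem_sector {ρ : ℝ} {t : Fin m → ℂ} (ht : t ∈ ball 0 ρ \ cross m k) :
    ∃ φ : Fin m → Fin 4, t ∈ sector k ρ (fun i => Complex.I ^ (φ i : ℕ)) := by
  have h1 : ∀ i : Fin m, ∃ l : Fin 4, (i : ℕ) < k → 0 < (t i / Complex.I ^ (l : ℕ)).re := by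
    intro i
    by_cases hi : (i : ℕ) < k
    swap
    · exact ⟨0, fun h => absurd h hi⟩
    have h0 := notMem_cross_iff.1 ht.2 i hi
    rcases lt_trichotomy (t i).re 0 with h | h | h
    · exact ⟨2, fun _ => by simpa [div_neg] using h⟩
    · rcases lt_trichotomy (t i).im 0 with h' | h' | h'
      · refine ⟨3, fun _ => ?_⟩
        have : (Complex.I ^ ((3 : Fin 4) : ℕ)) = -Complex.I := by
          norm_num [pow_succ]
        rw [this, div_neg, Complex.div_I]
        simpa using h'
      · exact absurd (Complex.ext h h') h0
      · refine ⟨1, fun _ => ?_⟩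
        have : (Complex.I ^ ((1 : Fin 4) : ℕ)) = Complex.I := by simp
        rw [this, Complex.div_I]
        simpa using h'
    · exact ⟨0, fun _ => by simpa using h⟩
  choose φ hφ using h1
  exact ⟨φ, ht.1, hφ⟩

lemma norm_logCoord_le {ρ : ℝ} (hρ : ρ ≤ 1) {δ t : Fin m → ℂ} (hδ : ∀ i, ‖δ i‖ = 1)
    (ht : t ∈ ball 0 ρ \ cross m k) {i : Fin m} (hi : (i : ℕ) < k) :
    ‖logCoord k δ t i‖ ≤ -Real.log ‖t i‖ + 2 * Real.pi := by
  have h0 := notMem_cross_iff.1 ht.2 i hi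
  have h1 : ‖t i‖ ≤ 1 :=
    (norm_le_pi_norm t i).trans ((mem_ball_zero_iff.1 ht.1).le.trans hρ)
  have h2 : Real.log ‖t i‖ ≤ 0 := Real.log_nonpos (norm_nonneg _) h1
  refine (Complex.norm_le_abs_re_add_abs_im _).trans ?_
  simp only [logCoord, if_pos hi, Complex.add_re, Complex.add_im, Complex.log_re, Complex.log_im,
    norm_div, hδ, div_one, Real.log_one, add_zero]
  rw [abs_of_nonpos h2]
  have h3 := Complex.abs_arg_le_pi (t i / δ i)
  have h4 := Complex.abs_arg_le_pi (δ i)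
  have h5 := abs_add_le (Complex.arg (t i / δ i)) (Complex.arg (δ i))
  linarith

/-- Growth of the exponential part `exp(-∑ A_i log t_i)` of a fundamental solution. -/
lemma norm_exp_logCoord_le [FiniteDimensional ℂ 𝔸] {A : Fin m → 𝔸}
    (hA : ∀ i : Fin m, ¬ (i : ℕ) < k → A i = 0) :
    ∃ C a : ℝ, 0 ≤ C ∧ ∀ ρ ≤ (1 : ℝ), ∀ δ : Fin m → ℂ, (∀ i, ‖δ i‖ = 1) →
      ∀ t ∈ ball 0 ρ \ cross m k,
        ‖NormedSpace.exp (-∑ i, logCoord k δ t i • A i)‖ ≤ C * ‖crossEq k t‖ ^ (-a) := by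
  set a := ∑ i, ‖A i‖ with ha
  have ha0 : 0 ≤ a := Finset.sum_nonneg fun _ _ => norm_nonneg _
  set s := Finset.univ.filter (fun i : Fin m => (i : ℕ) < k) with hs
  refine ⟨‖(1 : 𝔸)‖ * Real.exp (a * (s.card * (2 * Real.pi))), a, by positivity,
    fun ρ hρ δ hδ t ht => ?_⟩
  have hf : 0 < ‖crossEq k t‖ := norm_pos_iff.2 (crossEq_ne_zero ht.2)
  refine (norm_exp_le _).trans ?_
  rw [mul_assoc, Real.rpow_def_of_pos hf, ← Real.exp_add]
  refine mul_le_mul_of_nonneg_left (Real.exp_le_exp.2 ?_) (norm_nonneg _)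
  rw [norm_neg]
  calc ‖∑ i, logCoord k δ t i • A i‖ = ‖∑ i ∈ s, logCoord k δ t i • A i‖ := by
        rw [hs, Finset.sum_filter]
        congr 1
        refine Finset.sum_congr rfl fun i _ => ?_
        split_ifs with hi
        · rfl
        · rw [hA i hi, smul_zero]
    _ ≤ ∑ i ∈ s, (-Real.log ‖t i‖ + 2 * Real.pi) * a := by
        refine norm_sum_le_of_le _ fun i hi => ?_
        rw [norm_smul]
        have h1 := norm_logCoord_le hρ hδ ht (Finset.mem_filter.1 hi).2
        have h2 : ‖A i‖ ≤ a := Finset.single_le_sum (f := fun i => ‖A i‖)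
          (fun _ _ => norm_nonneg _) (Finset.mem_univ i)
        exact mul_le_mul h1 h2 (norm_nonneg _) ((norm_nonneg _).trans h1)
    _ = _ := by
        rw [norm_crossEq, Real.log_prod (fun i hi => norm_ne_zero_iff.2
          (notMem_cross_iff.1 ht.2 i (Finset.mem_filter.1 hi).2)), ← Finset.sum_mul,
          Finset.sum_add_distrib, Finset.sum_neg_distrib, Finset.sum_const, nsmul_eq_mul]
        ring

/-- The system in logarithmic coordinates is again integrable. -/
lemma integrable_expCoord {ρ : ℝ} {Ω : Fin m → (Fin m → ℂ) → 𝔸}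
    (hΩ : ∀ i, AnalyticOnNhd ℂ (Ω i) (ball 0 ρ \ cross m k))
    (hint : ∀ t ∈ ball 0 ρ \ cross m k, ∀ i j,
      fderiv ℂ (Ω j) t (Pi.single i 1) - fderiv ℂ (Ω i) t (Pi.single j 1) =
        Ω i t * Ω j t - Ω j t * Ω i t) {s : Fin m → ℂ} (hs : s ∈ logPolydisc m k ρ) (i j : Fin m) :
    fderiv ℂ (fun s => logFactor k (expCoord k s) j • Ω j (expCoord k s)) s (Pi.single i 1) -
      fderiv ℂ (fun s => logFactor k (expCoord k s) i • Ω i (expCoord k s)) s (Pi.single j 1) =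
    (logFactor k (expCoord k s) i • Ω i (expCoord k s)) *
      (logFactor k (expCoord k s) j • Ω j (expCoord k s)) -
    (logFactor k (expCoord k s) j • Ω j (expCoord k s)) *
      (logFactor k (expCoord k s) i • Ω i (expCoord k s)) := by
  have hmem : expCoord k s ∈ ball 0 ρ \ cross m k := ⟨hs, expCoord_notMem_cross s⟩
  have key : ∀ i j, i ≠ j →
      fderiv ℂ (fun s => logFactor k (expCoord k s) j • Ω j (expCoord k s)) s (Pi.single i 1) =
        (logFactor k (expCoord k s) j * logFactor k (expCoord k s) i) •
          fderiv ℂ (Ω j) (expCoord k s) (Pi.single i 1) := by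
    intro i j hij
    have h1 : HasFDerivAt (fun s : Fin m → ℂ => logFactor k (expCoord k s) j)
        ((if (j : ℕ) < k then Complex.exp (s j) else 0) •
          ContinuousLinearMap.proj (R := ℂ) (φ := fun _ : Fin m => ℂ) j) s := by
      have h2 := (ContinuousLinearMap.proj (R := ℂ) (φ := fun _ : Fin m => ℂ) j).hasFDerivAt
        (x := s)
      by_cases hj : (j : ℕ) < k
      · simp only [logFactor, expCoord, if_pos hj]
        exact (Complex.hasDerivAt_exp (s j)).comp_hasFDerivAt s h2
      · simp only [logFactor, if_neg hj]
        exact (hasFDerivAt_const (1 : ℂ) s).congr_fderiv (by ext v; simp)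
    have h3 : DifferentiableAt ℂ (Ω j) (expCoord k s) := (hΩ j _ hmem).differentiableAt
    have h4 : DifferentiableAt ℂ (fun s => Ω j (expCoord k s)) s :=
      h3.comp s (differentiable_expCoord s)
    rw [fderiv_fun_smul h1.differentiableAt h4, h1.fderiv]
    simp only [_root_.add_apply, _root_.smul_apply,
      ContinuousLinearMap.smulRight_apply]
    rw [fderiv_comp_diagonal h3 (hasFDerivAt_expCoord s), smul_smul]
    simp [Pi.single_eq_of_ne hij.symm]
  by_cases hij : i = j
  · subst hij
    simp
  rw [key i j hij, key j i (Ne.symm hij), mul_comm (logFactor k (expCoord k s) i), ← smul_sub,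
    hint _ hmem]
  simp only [smul_mul_smul_comm, smul_sub]
  rw [mul_comm (logFactor k (expCoord k s) i)]

/-- Under the growth condition of a regular singularity, an integrable system has a single-valued
frame `Φ` of moderate growth which transforms it into the system with constant coefficients
`A_i dt_i / t_i`, up to sign. -/
theorem exists_moderate_frame [FiniteDimensional ℂ 𝔸] {ρ : ℝ} (hρ0 : 0 < ρ) (hρ : ρ ≤ 1)
    {Ω : Fin m → (Fin m → ℂ) → 𝔸}
    (hΩ : ∀ i, AnalyticOnNhd ℂ (Ω i) (ball 0 ρ \ cross m k))
    (hint : ∀ t ∈ ball 0 ρ \ cross m k, ∀ i j,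
      fderiv ℂ (Ω j) t (Pi.single i 1) - fderiv ℂ (Ω i) t (Pi.single j 1) =
        Ω i t * Ω j t - Ω j t * Ω i t)
    (hgrow : ∀ δ : Fin m → ℂ, (∀ i, ‖δ i‖ = 1) → ∀ X : (Fin m → ℂ) → 𝔸,
      AnalyticOnNhd ℂ X (sector k ρ δ) → (∀ t ∈ sector k ρ δ, IsUnit (X t)) →
      (∀ t ∈ sector k ρ δ, ∀ i, fderiv ℂ X t (Pi.single i 1) = Ω i t * X t) →
      ∃ c r : ℝ, 0 < c ∧ ∀ t ∈ sector k ρ δ, ‖X t‖ ≤ c * ‖crossEq k t‖ ^ (-r)) :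
    ∃ (Φ : (Fin m → ℂ) → 𝔸) (A : Fin m → 𝔸), AnalyticOnNhd ℂ Φ (ball 0 ρ \ cross m k) ∧
      (∀ t ∈ ball 0 ρ \ cross m k, IsUnit (Φ t)) ∧ (∀ i : Fin m, ¬ (i : ℕ) < k → A i = 0) ∧
      (∀ t ∈ ball 0 ρ \ cross m k, ∀ i,
        fderiv ℂ Φ t (Pi.single i 1) = Ω i t * Φ t - (t i)⁻¹ • (Φ t * A i)) ∧
      ∃ (C : ℝ) (N : ℕ), ∀ t ∈ ball 0 ρ \ cross m k, ‖crossEq k t‖ ^ N * ‖Φ t‖ ≤ C := by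
  have : CompleteSpace 𝔸 := FiniteDimensional.complete ℂ 𝔸
  set B : Set (Fin m → ℂ) := ball 0 ρ \ cross m k with hB
  have hEB : ∀ s ∈ logPolydisc m k ρ, expCoord k s ∈ B := fun s hs =>
    ⟨hs, expCoord_notMem_cross s⟩
  -- a base point in the logarithmic polydisc
  have hs₀ : logCoord k (fun _ => 1) (fun _ : Fin m => ((ρ / 2 : ℝ) : ℂ)) ∈ logPolydisc m k ρ := by
    rw [logPolydisc, mem_preimage, expCoord_logCoord (notMem_cross_iff.2 fun _ _ => one_ne_zero)
      (notMem_cross_iff.2 fun _ _ => by exact_mod_cast (half_pos hρ0).ne'),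
      mem_ball_zero_iff, pi_norm_lt_iff hρ0]
    intro i
    rw [Complex.norm_real, Real.norm_eq_abs, abs_of_pos (half_pos hρ0)]
    linarith
  have hfac : ∀ i s, AnalyticAt ℂ (fun s : Fin m → ℂ => logFactor k (expCoord k s) i) s := by
    intro i s
    refine analyticOnNhd_of_differentiableOn isOpen_univ
      (Differentiable.differentiableOn fun s => ?_) s trivial
    by_cases hi : (i : ℕ) < k
    · simp only [logFactor, if_pos hi]
      exact differentiableAt_pi.1 (differentiable_expCoord (k := k) s) i
    · simp only [logFactor, if_neg hi]
      exact differentiableAt_const _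
  have hE : ∀ s, AnalyticAt ℂ (expCoord k : (Fin m → ℂ) → Fin m → ℂ) s := fun s =>
    analyticOnNhd_of_differentiableOn isOpen_univ differentiable_expCoord.differentiableOn s trivial
  obtain ⟨Y, P, A, hY, hP, hYu, hPu, hYs, hPY, hA, hPs, hper⟩ :=
    exists_floquet (Θ := fun i s => logFactor k (expCoord k s) i • Ω i (expCoord k s))
    (isOpen_logPolydisc ρ) (convex_logPolydisc hρ0) hs₀
    (fun i s hs => (hfac i s).smul ((hΩ i _ (hEB s hs)).fun_comp (hE s)))
    (fun s hs i j => integrable_expCoord hΩ hint hs i j) k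
    (fun j hj s => by simp only [logPolydisc, mem_preimage, expCoord_add_period hj])
    (fun j hj s hs i => by simp only [expCoord_add_period hj])
  have hLmem : ∀ u ∉ cross m k, ∀ t ∈ B, logCoord k u t ∈ logPolydisc m k ρ := fun u hu t ht => by
    rw [logPolydisc, mem_preimage, expCoord_logCoord hu ht.2]
    exact ht.1
  have h1c : (fun _ : Fin m => (1 : ℂ)) ∉ cross m k := notMem_cross_iff.2 fun _ _ => one_ne_zero
  -- the frame does not depend on the branch of the logarithm
  have hΦ : ∀ u ∉ cross m k, ∀ t ∈ B, P (logCoord k (fun _ => 1) t) = P (logCoord k u t) :=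
    fun u hu t ht => eq_of_expCoord_eq hper (hLmem u hu t ht)
      (by rw [expCoord_logCoord h1c ht.2, expCoord_logCoord hu ht.2])
  have hloc : ∀ u ∈ B, (fun t => P (logCoord k (fun _ => 1) t)) =ᶠ[𝓝 u]
      fun t => P (logCoord k u t) := fun u hu =>
    Filter.eventually_of_mem ((isOpen_ball_diff_cross ρ).mem_nhds hu) fun t ht => hΦ u hu.2 t ht
  have hslit : ∀ u ∈ B, ∀ i : Fin m, (i : ℕ) < k → u i / u i ∈ Complex.slitPlane := by
    intro u hu i hi
    rw [div_self (notMem_cross_iff.1 hu.2 i hi)]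
    exact Complex.one_mem_slitPlane
  have hder : ∀ (u : Fin m → ℂ), u ∉ cross m k → ∀ t ∈ B,
      (∀ i : Fin m, (i : ℕ) < k → t i / u i ∈ Complex.slitPlane) →
      ∀ (Q : (Fin m → ℂ) → 𝔸) (R : Fin m → (Fin m → ℂ) → 𝔸),
      AnalyticOnNhd ℂ Q (logPolydisc m k ρ) →
      (∀ s ∈ logPolydisc m k ρ, ∀ i, fderiv ℂ Q s (Pi.single i 1) =
        logFactor k (expCoord k s) i • (Ω i (expCoord k s) * Q s) - R i s) → ∀ i,
      fderiv ℂ (fun t => Q (logCoord k u t)) t (Pi.single i 1) =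
        Ω i t * Q (logCoord k u t) - (logFactor k t i)⁻¹ • R i (logCoord k u t) := by
    intro u hu t ht hsl Q R hQ hQs i
    have hmem := hLmem u hu t ht
    rw [fderiv_comp_diagonal (hQ _ hmem).differentiableAt (hasFDerivAt_logCoord hu hsl),
      hQs _ hmem, expCoord_logCoord hu ht.2, smul_sub, smul_smul,
      inv_mul_cancel₀ (logFactor_ne_zero ht.2 i), one_smul]
  refine ⟨fun t => P (logCoord k (fun _ => 1) t), A, ?_, fun t ht => hPu _ (hLmem _ h1c t ht), hA,
    fun t ht i => ?_, ?_⟩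
  · refine analyticOnNhd_of_differentiableOn (isOpen_ball_diff_cross ρ) fun u hu =>
      DifferentiableAt.differentiableWithinAt ?_
    exact ((hP _ (hLmem u hu.2 u hu)).differentiableAt.comp u
      (hasFDerivAt_logCoord hu.2 (hslit u hu)).differentiableAt).congr_of_eventuallyEq (hloc u hu)
  · beta_reduce
    rw [(hloc t ht).fderiv_eq, hΦ t ht.2 t ht, hder t ht.2 t ht (hslit t ht) P
      (fun i s => P s * A i) hP (fun s hs i => by rw [hPs s hs, smul_mul_assoc]) i]
    by_cases hi : (i : ℕ) < k
    · simp [logFactor, hi]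
    · simp [hA i hi]
  · obtain ⟨C, a, hC0, hC⟩ := norm_exp_logCoord_le hA
    have hsec : ∀ φ : Fin m → Fin 4, ∃ (C : ℝ) (N : ℕ), 0 ≤ C ∧
        ∀ t ∈ sector k ρ (fun i => Complex.I ^ (φ i : ℕ)),
          ‖crossEq k t‖ ^ N * ‖P (logCoord k (fun _ => 1) t)‖ ≤ C := by
      intro φ
      set δ : Fin m → ℂ := fun i => Complex.I ^ (φ i : ℕ) with hδ
      have hδ1 : ∀ i, ‖δ i‖ = 1 := fun i => by simp [hδ]
      have hδc : δ ∉ cross m k := notMem_cross_iff.2 fun i _ => by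
        rw [← norm_ne_zero_iff, hδ1]
        exact one_ne_zero
      have hsl : ∀ t ∈ sector k ρ δ, ∀ i : Fin m, (i : ℕ) < k → t i / δ i ∈ Complex.slitPlane :=
        fun t ht i hi => Or.inl (ht.2 i hi)
      have hsub := sector_subset (k := k) ρ δ
      obtain ⟨c, r, hc0, hcr⟩ := hgrow δ hδ1 (fun t => Y (logCoord k δ t))
        (analyticOnNhd_of_differentiableOn (isOpen_sector ρ δ) fun t ht =>
          DifferentiableAt.differentiableWithinAt
          ((hY _ (hLmem δ hδc t (hsub ht))).differentiableAt.comp t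
            (hasFDerivAt_logCoord hδc (hsl t ht)).differentiableAt))
        (fun t ht => hYu _ (hLmem δ hδc t (hsub ht)))
        (fun t ht i => by
          rw [hder δ hδc t (hsub ht) (hsl t ht) Y (fun _ _ => 0) hY
            (fun s hs i => by rw [hYs s hs, smul_mul_assoc, sub_zero]) i, smul_zero, sub_zero])
      refine ⟨c * C, ⌈r + a⌉₊, by positivity, fun t ht => ?_⟩
      have hf : 0 < ‖crossEq k t‖ := norm_pos_iff.2 (crossEq_ne_zero (hsub ht).2)
      have hf1 : ‖crossEq k t‖ ≤ 1 := norm_crossEq_le_one hρ (hsub ht).1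
      rw [hΦ δ hδc t (hsub ht), hPY]
      have h1 := hcr t ht
      have h2 := hC ρ hρ δ hδ1 t (hsub ht)
      have h3 : ‖crossEq k t‖ ^ ⌈r + a⌉₊ * (‖crossEq k t‖ ^ (-r) * ‖crossEq k t‖ ^ (-a)) ≤ 1 := by
        rw [← Real.rpow_natCast, ← Real.rpow_add hf, ← Real.rpow_add hf]
        refine Real.rpow_le_one hf.le hf1 ?_
        have := Nat.le_ceil (r + a)
        linarith
      calc ‖crossEq k t‖ ^ ⌈r + a⌉₊ *
            ‖Y (logCoord k δ t) * NormedSpace.exp (-∑ i, logCoord k δ t i • A i)‖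
          ≤ ‖crossEq k t‖ ^ ⌈r + a⌉₊ *
            ((c * ‖crossEq k t‖ ^ (-r)) * (C * ‖crossEq k t‖ ^ (-a))) := by
            refine mul_le_mul_of_nonneg_left ((norm_mul_le _ _).trans ?_) (by positivity)
            exact mul_le_mul h1 h2 (norm_nonneg _) (by positivity)
        _ = (c * C) * (‖crossEq k t‖ ^ ⌈r + a⌉₊ *
            (‖crossEq k t‖ ^ (-r) * ‖crossEq k t‖ ^ (-a))) := by ring
        _ ≤ c * C := mul_le_of_le_one_right (by positivity) h3
    choose C' N' hC'0 hC' using hsec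
    refine ⟨∑ φ, C' φ, ∑ φ, N' φ, fun t ht => ?_⟩
    obtain ⟨φ, hφ⟩ := exists_mem_sector ht
    have hf1 : ‖crossEq k t‖ ≤ 1 := norm_crossEq_le_one hρ ht.1
    have hN : N' φ ≤ ∑ φ, N' φ := Finset.single_le_sum (fun _ _ => Nat.zero_le _)
      (Finset.mem_univ φ)
    have hC'' : C' φ ≤ ∑ φ, C' φ := Finset.single_le_sum (fun φ _ => hC'0 φ) (Finset.mem_univ φ)
    refine (mul_le_mul_of_nonneg_right (pow_le_pow_of_le_one (norm_nonneg _) hf1 hN)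
      (norm_nonneg _)).trans ((hC' φ t hφ).trans hC'')

end Frame

/-! ### Sectors, and systems with a regular singularity -/

section Sectors

variable {m k : ℕ}

lemma convex_sector (ρ : ℝ) (δ : Fin m → ℂ) : Convex ℝ (sector k ρ δ) := by
  have h1 : sector k ρ δ = ball 0 ρ ∩ ⋂ i : Fin m, {t | (i : ℕ) < k → 0 < (t i / δ i).re} := by
    ext t
    simp [sector]
  rw [h1]
  refine (convex_ball _ _).inter (convex_iInter fun i => ?_)
  by_cases hi : (i : ℕ) < k
  · simp only [hi, forall_const]
    have h2 : IsLinearMap ℝ fun t : Fin m → ℂ => (t i / δ i).re :=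
      { map_add := fun x y => by simp [add_div]
        map_smul := fun c x => by
          rw [Pi.smul_apply, smul_div_assoc, Complex.smul_re] }
    exact convex_halfSpace_gt h2 0
  · simp only [hi, false_imp_iff]
    exact convex_univ

lemma sector_nonempty {ρ : ℝ} (hρ : 0 < ρ) {δ : Fin m → ℂ} (hδ : ∀ i, ‖δ i‖ = 1) :
    (sector k ρ δ).Nonempty := by
  refine ⟨fun i => ((ρ / 2 : ℝ) : ℂ) * δ i, ?_, fun i _ => ?_⟩
  · rw [mem_ball_zero_iff, pi_norm_lt_iff hρ]
    intro i
    rw [norm_mul, hδ, mul_one, Complex.norm_real, Real.norm_eq_abs, abs_of_pos (half_pos hρ)]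
    linarith
  · have h1 : δ i ≠ 0 := by
      rw [← norm_ne_zero_iff, hδ]
      exact one_ne_zero
    rw [mul_div_cancel_right₀ _ h1, Complex.ofReal_re]
    exact half_pos hρ

lemma isSimplyConnected_sector {ρ : ℝ} (hρ : 0 < ρ) {δ : Fin m → ℂ} (hδ : ∀ i, ‖δ i‖ = 1) :
    IsSimplyConnected (sector k ρ δ) := by
  have := (convex_sector (k := k) ρ δ).contractibleSpace (sector_nonempty hρ hδ)
  exact SimplyConnectedSpace.ofContractible _

lemma isSemianalytic_sector {ρ : ℝ} (hρ : 0 < ρ) (δ : Fin m → ℂ) :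
    IsSemianalytic (sector k ρ δ) := by
  let h : Fin m ⊕ Fin m → (Fin m → ℂ) → ℝ := Sum.elim
    (fun i t => ρ ^ 2 - ((t i).re ^ 2 + (t i).im ^ 2))
    (fun i t => if (i : ℕ) < k then (t i / δ i).re else 1)
  intro a
  refine ⟨univ, isOpen_univ, trivial, 1, m + m, fun _ _ _ => 0,
    fun _ j => h (finSumFinEquiv.symm j), fun _ j => ⟨fun _ _ => analyticAt_const, ?_⟩,
    fun t _ => ?_⟩
  · revert j
    refine finSumFinEquiv.forall_congr_right.1 fun x => ?_
    simp only [Equiv.symm_apply_apply]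
    intro t _
    let pr : Fin m → (Fin m → ℂ) →L[ℝ] ℂ := fun i =>
      ContinuousLinearMap.proj (R := ℝ) (φ := fun _ : Fin m => ℂ) i
    have hre : ∀ i, AnalyticAt ℝ (fun t : Fin m → ℂ => (t i).re) t := fun i =>
      (Complex.reCLM.comp (pr i)).analyticAt t
    have him : ∀ i, AnalyticAt ℝ (fun t : Fin m → ℂ => (t i).im) t := fun i =>
      (Complex.imCLM.comp (pr i)).analyticAt t
    rcases x with i | i
    · simp only [h, Sum.elim_inl]
      exact analyticAt_const.sub (((hre i).pow 2).add ((him i).pow 2))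
    · simp only [h, Sum.elim_inr]
      split_ifs
      · have h1 : (fun t : Fin m → ℂ => (t i / δ i).re) =
            fun t => (t i).re * (δ i)⁻¹.re - (t i).im * (δ i)⁻¹.im := by
          funext t
          rw [div_eq_mul_inv, Complex.mul_re]
        rw [h1]
        exact ((hre i).mul analyticAt_const).sub ((him i).mul analyticAt_const)
      · exact analyticAt_const
  · have h1 : ∀ i, 0 < h (Sum.inl i) t ↔ ‖t i‖ < ρ := fun i => by
      simp only [h, Sum.elim_inl, sub_pos]
      rw [← sq_lt_sq₀ (norm_nonneg _) hρ.le, Complex.sq_norm, Complex.normSq_apply, sq, sq]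
    have h2 : ∀ i, 0 < h (Sum.inr i) t ↔ ((i : ℕ) < k → 0 < (t i / δ i).re) := fun i => by
      simp only [h, Sum.elim_inr]
      split_ifs with hi <;> simp [hi]
    have h3 : (∀ j, 0 < h (finSumFinEquiv.symm j) t) ↔ ∀ x : Fin m ⊕ Fin m, 0 < h x t :=
      finSumFinEquiv.symm.forall_congr_left.trans (by simp)
    simp only [exists_const, true_and]
    rw [h3, Sum.forall]
    simp only [h1, h2]
    rw [sector, mem_ofPred_eq, mem_ball_zero_iff, pi_norm_lt_iff hρ]

end Sectors

section MatrixFrame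

attribute [local instance] Matrix.linftyOpNormedRing Matrix.linftyOpNormedAlgebra

variable {m n k : ℕ}

lemma analyticAt_matrix_iff {X : (Fin m → ℂ) → Matrix (Fin n) (Fin n) ℂ} {t : Fin m → ℂ} :
    AnalyticAt ℂ X t ↔ ∀ p q, AnalyticAt ℂ (fun s => X s p q) t := by
  refine ⟨fun h p q => ?_, fun h => ?_⟩
  · exact ((LinearMap.toContinuousLinearMap
      (Matrix.entryLinearMap ℂ ℂ p q : Matrix (Fin n) (Fin n) ℂ →ₗ[ℂ] ℂ)).analyticAt _).fun_comp h
  · have h1 : X = fun s => ∑ p, ∑ q, X s p q • Matrix.single p q (1 : ℂ) := by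
      funext s
      conv_lhs => rw [Matrix.matrix_eq_sum_single (X s)]
      simp [Matrix.smul_single]
    rw [h1]
    exact Finset.analyticAt_fun_sum _ fun p _ => Finset.analyticAt_fun_sum _ fun q _ =>
      (h p q).smul analyticAt_const

lemma partialDeriv_entry {X : (Fin m → ℂ) → Matrix (Fin n) (Fin n) ℂ} {t : Fin m → ℂ}
    (h : AnalyticAt ℂ X t) {i : Fin m} {D : Matrix (Fin n) (Fin n) ℂ}
    (hD : fderiv ℂ X t (Pi.single i 1) = D) (p q : Fin n) :
    partialDeriv i (fun s => X s p q) t = D p q := by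
  let L : Matrix (Fin n) (Fin n) ℂ →L[ℂ] ℂ := LinearMap.toContinuousLinearMap
      (Matrix.entryLinearMap ℂ ℂ p q : Matrix (Fin n) (Fin n) ℂ →ₗ[ℂ] ℂ)
  have h1 := (L.hasFDerivAt (x := X t)).comp t h.differentiableAt.hasFDerivAt
  have h2 : (fun s => X s p q) = L ∘ X := rfl
  rw [partialDeriv, h2, h1.fderiv, ← hD]
  rfl

lemma norm_matrix_le (X : Matrix (Fin n) (Fin n) ℂ) {K : ℝ} (hK0 : 0 ≤ K)
    (hK : ∀ p q, ‖X p q‖ ≤ K) : ‖X‖ ≤ n * K := by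
  rw [Matrix.linfty_opNorm_def]
  have : (Finset.univ.sup fun p => ∑ q, ‖X p q‖₊) ≤ n * K.toNNReal := by
    refine Finset.sup_le fun p _ => ?_
    refine (Finset.sum_le_card_nsmul _ _ K.toNNReal fun q _ => ?_).trans (by simp)
    exact NNReal.le_toNNReal_of_coe_le (hK p q)
  have h2 : ((n * K.toNNReal : NNReal) : ℝ) = n * K := by
    simp [hK0]
  rw [← h2]
  exact_mod_cast this

lemma norm_entry_le (X : Matrix (Fin n) (Fin n) ℂ) (p q : Fin n) : ‖X p q‖ ≤ ‖X‖ := by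
  rw [Matrix.linfty_opNorm_def]
  have h1 : ‖X p q‖₊ ≤ Finset.univ.sup fun p => ∑ q, ‖X p q‖₊ :=
    (Finset.single_le_sum (f := fun q => ‖X p q‖₊) (fun _ _ => zero_le) (Finset.mem_univ q)).trans
      (Finset.le_sup (f := fun p => ∑ q, ‖X p q‖₊) (Finset.mem_univ p))
  exact_mod_cast h1

/-- A system with a regular singularity has a single-valued frame `Φ` of moderate growth, with
`t_i ∂Φ/∂t_i = t_i Ω_i Φ - Φ A_i` for constant matrices `A_i`. -/
theorem exists_moderate_matrix_frame {U : Set (Fin m → ℂ)} (hU : IsOpen U) (h0 : 0 ∈ U)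
    {Ω : MatrixForm m n} (hmero : MatrixForm.IsMeromorphicOn k U Ω)
    (hint : MatrixForm.IsIntegrableOn Ω (U \ cross m k)) (hreg : HasRegularSingularity k U Ω) :
    ∃ (ρ : ℝ) (Φ : (Fin m → ℂ) → Matrix (Fin n) (Fin n) ℂ)
      (A : Fin m → Matrix (Fin n) (Fin n) ℂ), 0 < ρ ∧ ρ ≤ 1 ∧ ball 0 ρ ⊆ U ∧
      (∀ p q, IsModerate k ρ (fun t => Φ t p q)) ∧
      (∀ t ∈ ball 0 ρ \ cross m k, (Φ t).det ≠ 0) ∧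
      (∀ i : Fin m, ¬ (i : ℕ) < k → A i = 0) ∧
      ∀ t ∈ ball 0 ρ \ cross m k, ∀ i p q, partialDeriv i (fun s => Φ s p q) t =
        (Ω i t * Φ t) p q - (t i)⁻¹ * (Φ t * A i) p q := by
  obtain ⟨ε, hε, hεU⟩ := nhds_basis_closedBall.mem_iff.1 (hU.mem_nhds h0)
  set ρ := min ε 1 with hρdef
  have hρ0 : 0 < ρ := lt_min hε one_pos
  have hρ1 : ρ ≤ 1 := min_le_right _ _
  have hclU : closedBall 0 ρ ⊆ U := (closedBall_subset_closedBall (min_le_left _ _)).trans hεU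
  have hsub : ball (0 : Fin m → ℂ) ρ \ cross m k ⊆ U \ cross m k :=
    sdiff_subset_sdiff_left (ball_subset_closedBall.trans hclU)
  have hΩ : ∀ i, AnalyticOnNhd ℂ (Ω i) (ball 0 ρ \ cross m k) := fun i t ht =>
    analyticAt_matrix_iff.2 fun p q => (hmero i p q).1 t (hsub ht)
  obtain ⟨Φ, A, hΦ, hΦu, hA, hΦs, C, N, hC⟩ := exists_moderate_frame hρ0 hρ1 hΩ
    (fun t ht i j => by
      ext p q
      have h1 := hint t (hsub ht) i j p q
      rwa [partialDeriv_entry (hΩ j t ht) rfl, partialDeriv_entry (hΩ i t ht) rfl] at h1)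
    (fun δ hδ X hX hXu hXs => by
      have hSB := sector_subset (k := k) ρ δ
      have hcl : closure (sector k ρ δ) ⊆ closedBall 0 ρ :=
        closure_minimal ((hSB.trans sdiff_subset).trans ball_subset_closedBall) isClosed_closedBall
      obtain ⟨c, r, hc, hcr⟩ := hreg (sector k ρ δ) (hSB.trans hsub) (isSemianalytic_sector hρ0 δ)
        (isSimplyConnected_sector hρ0 hδ)
        ((isCompact_closedBall _ _).of_isClosed_subset isClosed_closure hcl) (hcl.trans hclU)
        (sector k ρ δ) X (isOpen_sector ρ δ) subset_rfl (hSB.trans hsub)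
        ⟨fun p q t ht => analyticAt_matrix_iff.1 (hX t ht) p q,
          fun t ht => (Matrix.isUnit_iff_isUnit_det _).1 (hXu t ht),
          fun t ht i p q => partialDeriv_entry (hX t ht) (hXs t ht i) p q⟩
      refine ⟨(n + 1) * c, r, by positivity, fun t ht => ?_⟩
      have h1 : 0 ≤ c * ‖crossEq k t‖ ^ (-r) := by positivity
      refine (norm_matrix_le _ h1 (hcr t ht)).trans ?_
      rw [mul_assoc]
      exact mul_le_mul_of_nonneg_right (by linarith) h1)
  refine ⟨ρ, Φ, A, hρ0, hρ1, ball_subset_closedBall.trans hclU,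
    fun p q => ⟨fun t ht => analyticAt_matrix_iff.1 (hΦ t ht) p q, C, N, fun t ht => ?_⟩,
    fun t ht => ((Matrix.isUnit_iff_isUnit_det _).1 (hΦu t ht)).ne_zero, hA, fun t ht i p q => ?_⟩
  · exact (mul_le_mul_of_nonneg_left (norm_entry_le _ p q) (by positivity)).trans (hC t ht)
  · exact partialDeriv_entry (hΦ t ht) (hΦs t ht i) p q

end MatrixFrame

/-! ### The growth of reciprocals -/

section Inverse

variable {m n k : ℕ}

lemma exists_pos_le {ι : Type*} [Finite ι] {r : ι → ℝ} (hr : ∀ i, 0 < r i) :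
    ∃ x, 0 < x ∧ ∀ i, x ≤ r i := by
  have h1 : ∀ᶠ x in 𝓝[>] (0 : ℝ), 0 < x ∧ ∀ i, x ≤ r i :=
    Filter.Eventually.and self_mem_nhdsWithin (Filter.eventually_all.2 fun i =>
      mem_nhdsWithin_of_mem_nhds (Iic_mem_nhds (hr i)))
  exact h1.exists

/-- A nonvanishing function whose logarithmic derivatives `t_i ∂ log G/∂t_i` are bounded
has an inverse of moderate growth, by Gronwall's inequality along the paths
`σ ↦ t_i exp((1 - σ) l_i)` leading to `t` from a compact set outside the cross. -/
theorem isModerate_inv {ρ r K : ℝ} (hr : 0 < r) (hrρ : r < ρ) (hρ : ρ ≤ 1) (hK : 0 ≤ K)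
    {G : (Fin m → ℂ) → ℂ} (hG : AnalyticOnNhd ℂ G (ball 0 ρ \ cross m k))
    (hne : ∀ t ∈ ball 0 ρ \ cross m k, G t ≠ 0) {ω : Fin m → (Fin m → ℂ) → ℂ}
    (hω : ∀ i, ∀ t ∈ ball 0 ρ \ cross m k, ‖ω i t‖ ≤ K)
    (hGs : ∀ i, ∀ t ∈ ball 0 ρ \ cross m k, t i * partialDeriv i G t = ω i t * G t) :
    IsModerate k r (fun t => (G t)⁻¹) := by
  set B : Set (Fin m → ℂ) := ball 0 ρ \ cross m k with hB
  have hrB : ∀ t ∈ ball 0 r \ cross m k, t ∈ B := fun t ht =>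
    ⟨ball_subset_ball hrρ.le ht.1, ht.2⟩
  have hinv : AnalyticOnNhd ℂ (fun t => (G t)⁻¹) B := fun t ht => (hG t ht).inv (hne t ht)
  set T : Set (Fin m → ℂ) :=
    {t | t ∈ closedBall 0 r ∧ ∀ i : Fin m, (i : ℕ) < k → ‖t i‖ = r} with hT
  have hTB : T ⊆ B := fun t ht => ⟨closedBall_subset_ball hrρ ht.1, notMem_cross_iff.2 fun i hi =>
    norm_ne_zero_iff.1 (by rw [ht.2 i hi]; exact hr.ne')⟩
  have hTc : IsCompact T := by
    have h1 : T = closedBall 0 r ∩ ⋂ i : Fin m, {t | (i : ℕ) < k → ‖t i‖ = r} := by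
      ext t
      simp [hT]
    rw [h1]
    refine (isCompact_closedBall _ _).inter_right (isClosed_iInter fun i => ?_)
    by_cases hi : (i : ℕ) < k
    · simp only [hi, forall_const]
      exact isClosed_eq (continuous_apply i).norm continuous_const
    · simp [hi]
  obtain ⟨C, hC⟩ := hTc.exists_bound_of_continuousOn (hinv.continuousOn.mono hTB)
  refine ⟨fun t ht => hinv t (hrB t ht), C, ⌈K⌉₊, fun t ht => ?_⟩
  have hti : ∀ i, ‖t i‖ < r := (pi_norm_lt_iff hr).1 (mem_ball_zero_iff.1 ht.1)
  set l : Fin m → ℝ := fun i => if (i : ℕ) < k then Real.log (r / ‖t i‖) else 0 with hl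
  have hl0 : ∀ i, 0 ≤ l i := fun i => by
    simp only [hl]
    split_ifs with hi
    · have h0 : 0 < ‖t i‖ := norm_pos_iff.2 (notMem_cross_iff.1 ht.2 i hi)
      exact Real.log_nonneg ((one_le_div h0).2 (hti i).le)
    · exact le_rfl
  have hexp : ∀ i : Fin m, (i : ℕ) < k → ‖t i‖ * Real.exp (l i) = r := fun i hi => by
    have h0 : 0 < ‖t i‖ := norm_pos_iff.2 (notMem_cross_iff.1 ht.2 i hi)
    rw [show l i = Real.log (r / ‖t i‖) from if_pos hi, Real.exp_log (div_pos hr h0),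
      mul_div_cancel₀ _ h0.ne']
  have hexp' : ∀ i, ‖t i‖ * Real.exp (l i) ≤ r := fun i => by
    by_cases hi : (i : ℕ) < k
    · exact (hexp i hi).le
    · rw [show l i = 0 from if_neg hi, Real.exp_zero, mul_one]
      exact (hti i).le
  set γ : ℝ → Fin m → ℂ := fun σ i => t i * Complex.exp (((1 - σ) * l i : ℝ) : ℂ) with hγ
  have hnγ : ∀ σ i, ‖γ σ i‖ = ‖t i‖ * Real.exp ((1 - σ) * l i) := fun σ i => by
    simp only [hγ]
    rw [norm_mul, Complex.norm_exp, Complex.ofReal_re]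
  have hγB : ∀ σ ∈ Icc (0 : ℝ) 1, γ σ ∈ B := by
    intro σ hσ
    refine ⟨closedBall_subset_ball hrρ ?_, notMem_cross_iff.2 fun i hi =>
      mul_ne_zero (notMem_cross_iff.1 ht.2 i hi) (Complex.exp_ne_zero _)⟩
    rw [mem_closedBall_zero_iff, pi_norm_le_iff_of_nonneg hr.le]
    intro i
    rw [hnγ]
    refine le_trans ?_ (hexp' i)
    gcongr
    have := mul_le_mul_of_nonneg_right (show 1 - σ ≤ 1 by linarith [hσ.1]) (hl0 i)
    linarith
  have hγ' : ∀ σ, HasDerivAt γ (fun i => -(l i : ℂ) * γ σ i) σ := by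
    intro σ
    refine hasDerivAt_pi.2 fun i => ?_
    have h1 : HasDerivAt (fun σ : ℝ => (1 - σ) * l i) (-1 * l i) σ :=
      ((hasDerivAt_id σ).const_sub 1).mul_const (l i)
    have h2 := (h1.ofReal_comp.cexp).const_mul (t i)
    refine h2.congr_deriv ?_
    simp only [hγ]
    push_cast
    ring
  have hder : ∀ σ ∈ Icc (0 : ℝ) 1, HasDerivAt (fun σ => (G (γ σ))⁻¹)
      ((∑ i, (l i : ℂ) * ω i (γ σ)) * (G (γ σ))⁻¹) σ := by
    intro σ hσ
    have hmem := hγB σ hσ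
    have h1 := (((hG _ hmem).differentiableAt.hasFDerivAt.restrictScalars ℝ).comp_hasDerivAt σ
      (hγ' σ)).fun_inv (hne _ hmem)
    refine h1.congr_deriv ?_
    have h2 : fderiv ℂ G (γ σ) (fun i => -(l i : ℂ) * γ σ i) =
        -((∑ i, (l i : ℂ) * ω i (γ σ)) * G (γ σ)) := by
      rw [clm_eq_sum, Finset.sum_mul, ← Finset.sum_neg_distrib]
      refine Finset.sum_congr rfl fun i _ => ?_
      have h3 := hGs i _ hmem
      rw [partialDeriv] at h3
      rw [smul_eq_mul]
      linear_combination -(l i : ℂ) * h3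
    have h4 := hne _ hmem
    simp only [ContinuousLinearMap.coe_restrictScalars', Function.comp_apply, h2]
    field_simp
  have hgr := norm_le_gronwallBound_of_norm_deriv_right_le (f := fun σ => (G (γ σ))⁻¹)
    (δ := C) (K := K * ∑ i, l i) (ε := 0) (a := 0) (b := 1)
    (fun σ hσ => (hder σ hσ).continuousAt.continuousWithinAt)
    (fun σ hσ => (hder σ ⟨hσ.1, hσ.2.le⟩).hasDerivWithinAt)
    (by
      refine hC _ ⟨?_, fun i hi => ?_⟩
      · rw [mem_closedBall_zero_iff, pi_norm_le_iff_of_nonneg hr.le]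
        intro i
        rw [hnγ, sub_zero, one_mul]
        exact hexp' i
      · rw [hnγ, sub_zero, one_mul, hexp i hi])
    (fun σ hσ => by
      rw [add_zero, norm_mul]
      refine mul_le_mul_of_nonneg_right ?_ (norm_nonneg _)
      rw [Finset.mul_sum]
      refine norm_sum_le_of_le _ fun i _ => ?_
      rw [norm_mul, Complex.norm_real, Real.norm_eq_abs, abs_of_nonneg (hl0 i), mul_comm]
      exact mul_le_mul_of_nonneg_right (hω i _ (hγB σ ⟨hσ.1, hσ.2.le⟩)) (hl0 i))
    1 (right_mem_Icc.2 zero_le_one)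
  have hγ1 : γ 1 = t := by
    funext i
    simp [hγ]
  have hf : 0 < ‖crossEq k t‖ := norm_pos_iff.2 (crossEq_ne_zero ht.2)
  have hf1 : ‖crossEq k t‖ ≤ 1 := norm_crossEq_le_one (hrρ.le.trans hρ) ht.1
  have hC0 : 0 ≤ C := by
    have h1 : γ 0 ∈ T := by
      refine ⟨?_, fun i hi => ?_⟩
      · rw [mem_closedBall_zero_iff, pi_norm_le_iff_of_nonneg hr.le]
        intro i
        rw [hnγ, sub_zero, one_mul]
        exact hexp' i
      · rw [hnγ, sub_zero, one_mul, hexp i hi]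
    exact (norm_nonneg _).trans (hC _ h1)
  -- `exp (∑ l_i) = r ^ k / |f(t)|`
  have hsum : Real.exp (∑ i, l i) * ‖crossEq k t‖ ≤ 1 := by
    rw [Real.exp_sum, norm_crossEq, Finset.prod_filter, ← Finset.prod_mul_distrib]
    refine Finset.prod_le_one (fun i _ => by positivity) fun i _ => ?_
    split_ifs with hi
    · rw [mul_comm, hexp i hi]
      linarith
    · rw [show l i = 0 from if_neg hi, Real.exp_zero, mul_one]
  rw [gronwallBound_ε0, hγ1, sub_zero, mul_one] at hgr
  have h5 : ‖crossEq k t‖ ^ ⌈K⌉₊ * Real.exp (K * ∑ i, l i) ≤ 1 := by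
    have h6 : ‖crossEq k t‖ ^ ⌈K⌉₊ ≤ ‖crossEq k t‖ ^ K := by
      rw [← Real.rpow_natCast]
      exact Real.rpow_le_rpow_of_exponent_ge hf hf1 (Nat.le_ceil K)
    refine (mul_le_mul_of_nonneg_right h6 (Real.exp_pos _).le).trans ?_
    rw [mul_comm K, Real.exp_mul, ← Real.mul_rpow hf.le (Real.exp_pos _).le, mul_comm]
    exact Real.rpow_le_one (by positivity) hsum hK
  calc ‖crossEq k t‖ ^ ⌈K⌉₊ * ‖(G t)⁻¹‖
      ≤ ‖crossEq k t‖ ^ ⌈K⌉₊ * (C * Real.exp (K * ∑ i, l i)) := by gcongr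
    _ = C * (‖crossEq k t‖ ^ ⌈K⌉₊ * Real.exp (K * ∑ i, l i)) := by ring
    _ ≤ C := mul_le_of_le_one_right hC0 h5

end Inverse

/-! ### The inverse frame -/

section Calculus

variable {m : ℕ}

lemma fderiv_comp_eq_of_hasDerivAt {E : Type*} [NormedAddCommGroup E] [NormedSpace ℂ E]
    {F : E → ℂ} {X : (Fin m → ℂ) → E} {t v : Fin m → ℂ} {D : E} {d : ℂ}
    (hF : DifferentiableAt ℂ F (X t)) (hX : DifferentiableAt ℂ X t) (hD : fderiv ℂ X t v = D)
    (hd : HasDerivAt (fun z : ℂ => F (X t + z • D)) d 0) :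
    fderiv ℂ (fun s => F (X s)) t v = d := by
  have h1 := (hF.hasFDerivAt.comp t hX.hasFDerivAt).fderiv
  have h2 : (fun s => F (X s)) = F ∘ X := rfl
  rw [h2, h1, ContinuousLinearMap.comp_apply, hD]
  have h3 : HasDerivAt (fun z : ℂ => X t + z • D) D 0 := by
    simpa using ((hasDerivAt_id (0 : ℂ)).smul_const D).const_add (X t)
  exact (hF.hasFDerivAt.comp_hasDerivAt_of_eq 0 h3 (by simp)).unique hd

lemma fderiv_of_mul_eq_one {𝔸 : Type*} [NormedRing 𝔸] [NormedAlgebra ℂ 𝔸]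
    {X Z : (Fin m → ℂ) → 𝔸} {t : Fin m → ℂ} (hX : DifferentiableAt ℂ X t)
    (hZ : DifferentiableAt ℂ Z t) (h : ∀ᶠ s in 𝓝 t, Z s * X s = 1) (h' : X t * Z t = 1)
    {v : Fin m → ℂ} {D : 𝔸} (hD : fderiv ℂ X t v = D) :
    fderiv ℂ Z t v = -(Z t * D * Z t) := by
  have h2 : fderiv ℂ (fun s => Z s * X s) t v = 0 := by
    rw [Filter.EventuallyEq.fderiv_eq (f₁ := fun s => Z s * X s) (f := fun _ => 1) h]
    simp
  rw [fderiv_fun_mul' hZ hX] at h2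
  change Z t * fderiv ℂ X t v + fderiv ℂ Z t v * X t = 0 at h2
  rw [hD] at h2
  calc fderiv ℂ Z t v = fderiv ℂ Z t v * X t * Z t := by rw [mul_assoc, h', mul_one]
    _ = _ := by rw [eq_neg_of_add_eq_zero_right h2, neg_mul]

end Calculus

section InverseFrame

attribute [local instance] Matrix.linftyOpNormedRing Matrix.linftyOpNormedAlgebra

variable {m n k : ℕ}

/-- Jacobi's formula for the derivative of a determinant. -/
lemma partialDeriv_det {X : (Fin m → ℂ) → Matrix (Fin n) (Fin n) ℂ} {t : Fin m → ℂ}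
    (hX : AnalyticAt ℂ X t) (hu : (X t).det ≠ 0) {i : Fin m} {D : Matrix (Fin n) (Fin n) ℂ}
    (hD : fderiv ℂ X t (Pi.single i 1) = D) :
    partialDeriv i (fun s => (X s).det) t = (X t).det * ((X t)⁻¹ * D).trace := by
  have hdet : Differentiable ℂ (fun M : Matrix (Fin n) (Fin n) ℂ => M.det) := by
    intro M
    simp only [Matrix.det_apply']
    refine (Finset.analyticAt_fun_sum _ fun σ _ => analyticAt_const.mul
      (Finset.analyticAt_fun_prod _ fun i _ => ?_)).differentiableAt
    exact (LinearMap.toContinuousLinearMap (Matrix.entryLinearMap ℂ ℂ (σ i) i :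
      Matrix (Fin n) (Fin n) ℂ →ₗ[ℂ] ℂ)).analyticAt _
  refine fderiv_comp_eq_of_hasDerivAt (hdet (X t)) hX.differentiableAt hD ?_
  have h5 : (fun z : ℂ => (X t + z • D).det) =
      fun z => (X t).det * (1 + z • ((X t)⁻¹ * D)).det := by
    funext z
    rw [← Matrix.det_mul, mul_add, mul_one, mul_smul_comm, ← mul_assoc,
      Matrix.mul_nonsing_inv _ hu.isUnit, one_mul]
  rw [h5]
  refine HasDerivAt.const_mul _ ?_
  have h6 : HasDerivAt (fun z : ℂ => 1 + ((X t)⁻¹ * D).trace * z +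
      (((1 + (Polynomial.X : Polynomial ℂ) • ((X t)⁻¹ * D).map Polynomial.C).det).divX.divX).eval z
        * z ^ 2) ((X t)⁻¹ * D).trace 0 := by
    have h7 := ((((hasDerivAt_id (0 : ℂ)).const_mul ((X t)⁻¹ * D).trace).const_add 1)).add
      ((((1 + (Polynomial.X : Polynomial ℂ) • ((X t)⁻¹ * D).map
        Polynomial.C).det).divX.divX.hasDerivAt (0 : ℂ)).mul (hasDerivAt_pow 2 (0 : ℂ)))
    refine h7.congr_deriv ?_
    simp
  refine h6.congr_of_eventuallyEq (Filter.Eventually.of_forall fun z => ?_)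
  exact Matrix.det_one_add_smul z _

/-- The derivative of the inverse matrix. -/
lemma partialDeriv_inv {X : (Fin m → ℂ) → Matrix (Fin n) (Fin n) ℂ} {W : Set (Fin m → ℂ)}
    (hW : IsOpen W) (hX : AnalyticOnNhd ℂ X W)
    (hXi : AnalyticOnNhd ℂ (fun s => (X s)⁻¹) W) (hu : ∀ t ∈ W, (X t).det ≠ 0)
    {t : Fin m → ℂ} (ht : t ∈ W) {i : Fin m} {D : Matrix (Fin n) (Fin n) ℂ}
    (hD : fderiv ℂ X t (Pi.single i 1) = D) (p q : Fin n) :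
    partialDeriv i (fun s => (X s)⁻¹ p q) t = (-((X t)⁻¹ * D * (X t)⁻¹)) p q := by
  refine partialDeriv_entry (hXi t ht) ?_ p q
  exact fderiv_of_mul_eq_one (hX t ht).differentiableAt (hXi t ht).differentiableAt
    (Filter.eventually_of_mem (hW.mem_nhds ht) fun s hs =>
      Matrix.nonsing_inv_mul _ (hu s hs).isUnit)
    (Matrix.mul_nonsing_inv _ (hu t ht).isUnit) hD

/-- The logarithmic derivatives of a nonzero function of moderate growth which are Laurent series
are bounded near `0`. -/
lemma exists_bound_of_euler_eq {ρ : ℝ} (hρ : 0 < ρ) {G ω : (Fin m → ℂ) → ℂ}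
    (hG : IsModerate k ρ G) (hne : ∀ t ∈ ball 0 ρ \ cross m k, G t ≠ 0)
    {w : (Fin m → ℤ) → ℂ} (hω : HasLaurentExpansion k ω w) (i : Fin m)
    (hGs : ∀ t ∈ ball 0 ρ \ cross m k, t i * partialDeriv i G t = ω t * G t) :
    ∃ r K : ℝ, 0 < r ∧ ∀ t ∈ ball 0 r \ cross m k, ‖ω t‖ ≤ K := by
  obtain ⟨g, hg⟩ := hG.exists_hasLaurentExpansion hρ
  have hg0 : g ≠ 0 := by
    rintro rfl
    obtain ⟨-, ρ', hρ', hs⟩ := hg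
    have hpos : 0 < min ρ ρ' / 2 := half_pos (lt_min hρ hρ')
    have hlt : min ρ ρ' / 2 < min ρ ρ' := half_lt_self (lt_min hρ hρ')
    have hn : ‖((min ρ ρ' / 2 : ℝ) : ℂ)‖ = min ρ ρ' / 2 := by
      rw [Complex.norm_real, Real.norm_eq_abs, abs_of_pos hpos]
    have hc : (fun _ : Fin m => ((min ρ ρ' / 2 : ℝ) : ℂ)) ∉ cross m k :=
      notMem_cross_iff.2 fun _ _ => by exact_mod_cast hpos.ne'
    refine hne (fun _ => ((min ρ ρ' / 2 : ℝ) : ℂ)) ⟨?_, hc⟩ ?_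
    · rw [mem_ball_zero_iff, pi_norm_lt_iff hρ]
      exact fun _ => hn.trans_lt (hlt.trans_le (min_le_left _ _))
    · refine (hs _ (fun _ => hn.trans_lt (hlt.trans_le (min_le_right _ _))) hc).unique ?_
      simp
  have h1 := (hg.euler hρ hG.1 i).unique (hω.mul hg) hρ hGs
  obtain ⟨N, hN⟩ := hω.poleOrderLE
  obtain ⟨N', hN'⟩ := hg.poleOrderLE
  exact hω.exists_bound (nonneg_of_euler_eq_conv hN hN' hg0 i fun e => congrFun h1 e)

/-- The frame of moderate growth and its inverse. -/
theorem exists_moderate_frame_pair {U : Set (Fin m → ℂ)} (hU : IsOpen U) (h0 : 0 ∈ U)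
    {Ω : MatrixForm m n} (hmero : MatrixForm.IsMeromorphicOn k U Ω)
    (hint : MatrixForm.IsIntegrableOn Ω (U \ cross m k)) (hreg : HasRegularSingularity k U Ω)
    {b : Fin m → (Fin m → ℤ) → Matrix (Fin n) (Fin n) ℂ}
    (hb : ∀ i p q, HasLaurentExpansion k (fun t => Ω i t p q) (fun a => b i a p q)) :
    ∃ (ρ : ℝ) (Φ Ψ : (Fin m → ℂ) → Matrix (Fin n) (Fin n) ℂ)
      (A : Fin m → Matrix (Fin n) (Fin n) ℂ), 0 < ρ ∧ ρ ≤ 1 ∧ ball 0 ρ ⊆ U ∧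
      (∀ p q, IsModerate k ρ (fun t => Φ t p q)) ∧ (∀ p q, IsModerate k ρ (fun t => Ψ t p q)) ∧
      (∀ t ∈ ball 0 ρ \ cross m k, Φ t * Ψ t = 1) ∧
      (∀ i : Fin m, ¬ (i : ℕ) < k → A i = 0) ∧
      (∀ t ∈ ball 0 ρ \ cross m k, ∀ i p q, partialDeriv i (fun s => Φ s p q) t =
        (Ω i t * Φ t) p q - (t i)⁻¹ * (Φ t * A i) p q) ∧
      ∀ t ∈ ball 0 ρ \ cross m k, ∀ i p q, t i * partialDeriv i (fun s => Ψ s p q) t =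
        (A i * Ψ t) p q - t i * (Ψ t * Ω i t) p q := by
  obtain ⟨ρ, Φ, A, hρ0, hρ1, hρU, hΦ, hdet, hA, hΦs⟩ :=
    exists_moderate_matrix_frame hU h0 hmero hint hreg
  have hΦa : AnalyticOnNhd ℂ Φ (ball 0 ρ \ cross m k) := fun t ht =>
    analyticAt_matrix_iff.2 fun p q => (hΦ p q).1 t ht
  have hΦd : ∀ t ∈ ball 0 ρ \ cross m k, ∀ i,
      fderiv ℂ Φ t (Pi.single i 1) = Ω i t * Φ t - (t i)⁻¹ • (Φ t * A i) := by
    intro t ht i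
    ext p q
    exact (partialDeriv_entry (hΦa t ht) rfl p q).symm.trans (hΦs t ht i p q)
  -- `t_i (t_i)⁻¹ A_i = A_i`, since `A_i = 0` if `t_i` may vanish
  have hcancel : ∀ t ∈ ball (0 : Fin m → ℂ) ρ \ cross m k, ∀ i, (t i * (t i)⁻¹) • A i = A i := by
    intro t ht i
    by_cases hi : (i : ℕ) < k
    · rw [mul_inv_cancel₀ (notMem_cross_iff.1 ht.2 i hi), one_smul]
    · rw [hA i hi, smul_zero]
  set ω : Fin m → (Fin m → ℂ) → ℂ := fun i t => t i * (∑ p, Ω i t p p) - (A i).trace with hω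
  have hωL : ∀ i, ∃ w, HasLaurentExpansion k (ω i) w := fun i =>
    ⟨_, ((HasLaurentExpansion.sum Finset.univ fun p _ => hb i p p).coord_mul i).sub
      (HasLaurentExpansion.const (A i).trace)⟩
  have hG : IsModerate k ρ (fun t => (Φ t).det) := IsModerate.det hρ1 hΦ
  have hGs : ∀ i, ∀ t ∈ ball 0 ρ \ cross m k,
      t i * partialDeriv i (fun t => (Φ t).det) t = ω i t * (Φ t).det := by
    intro i t ht
    have hu := (hdet t ht).isUnit
    have h1 : ((Φ t)⁻¹ * (Ω i t * Φ t)).trace = (Ω i t).trace := by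
      rw [Matrix.trace_mul_comm, mul_assoc, Matrix.mul_nonsing_inv _ hu, mul_one]
    have h2 : ((Φ t)⁻¹ * ((t i)⁻¹ • (Φ t * A i))).trace = (t i)⁻¹ * (A i).trace := by
      rw [mul_smul_comm, ← mul_assoc, Matrix.nonsing_inv_mul _ hu, one_mul, Matrix.trace_smul,
        smul_eq_mul]
    have h3 : t i * (t i)⁻¹ * (A i).trace = (A i).trace := by
      rw [← smul_eq_mul, ← Matrix.trace_smul, hcancel t ht i]
    rw [partialDeriv_det (hΦa t ht) (hdet t ht) (hΦd t ht i), mul_sub, Matrix.trace_sub, h1, h2]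
    have h4 : (∑ p, Ω i t p p) = (Ω i t).trace := rfl
    simp only [hω, h4]
    linear_combination -(Φ t).det * h3
  choose w hw using hωL
  choose r K hr hK using fun i => exists_bound_of_euler_eq hρ0 hG hdet (hw i) i (hGs i)
  obtain ⟨r', hr'0, hr'⟩ := exists_pos_le hr
  set σ := min ρ r' with hσ
  have hσ0 : 0 < σ := lt_min hρ0 hr'0
  have hsub : ∀ {s : ℝ}, s ≤ ρ → ball (0 : Fin m → ℂ) s \ cross m k ⊆ ball 0 ρ \ cross m k :=
    fun hs => sdiff_subset_sdiff_left (ball_subset_ball hs)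
  have hσB := hsub (min_le_left ρ r')
  have hinv : IsModerate k (σ / 2) (fun t => ((Φ t).det)⁻¹) :=
    isModerate_inv (K := ∑ i, |K i|) (half_pos hσ0) (half_lt_self hσ0)
      ((min_le_left _ _).trans hρ1) (Finset.sum_nonneg fun _ _ => abs_nonneg _) (hG.1.mono hσB)
      (fun t ht => hdet t (hσB ht)) (ω := ω)
      (fun i t ht => ((hK i t ⟨ball_subset_ball ((min_le_right _ _).trans (hr' i)) ht.1,
        ht.2⟩).trans (le_abs_self _)).trans
          (Finset.single_le_sum (f := fun i => |K i|) (fun _ _ => abs_nonneg _)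
            (Finset.mem_univ i)))
      (fun i t ht => hGs i t (hσB ht))
  have hσρ : σ / 2 ≤ ρ := (half_le_self hσ0.le).trans (min_le_left _ _)
  have hΦ' : ∀ p q, IsModerate k (σ / 2) (fun t => Φ t p q) := fun p q => (hΦ p q).mono hσρ
  have hΨ : ∀ p q, IsModerate k (σ / 2) (fun t => (Φ t)⁻¹ p q) := by
    intro p q
    have h1 : (fun t => (Φ t)⁻¹ p q) =
        fun t => ((Φ t).det)⁻¹ * ((Φ t).updateRow q (Pi.single p 1)).det := by
      funext t
      rw [Matrix.inv_def, Matrix.smul_apply, Matrix.adjugate_apply, Ring.inverse_eq_inv',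
        smul_eq_mul]
    rw [h1]
    refine hinv.mul (IsModerate.det (hσρ.trans hρ1) fun p' q' => ?_)
    by_cases hp : p' = q
    · subst hp
      simp only [Matrix.updateRow_self]
      exact IsModerate.const _ _
    · simp only [Matrix.updateRow_ne hp]
      exact hΦ' p' q'
  refine ⟨σ / 2, Φ, fun t => (Φ t)⁻¹, A, half_pos hσ0, hσρ.trans hρ1,
    (ball_subset_ball hσρ).trans hρU, hΦ', hΨ,
    fun t ht => Matrix.mul_nonsing_inv _ (hdet t (hsub hσρ ht)).isUnit, hA,
    fun t ht => hΦs t (hsub hσρ ht), fun t ht i p q => ?_⟩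
  have htρ := hsub hσρ ht
  have hu := (hdet t htρ).isUnit
  rw [partialDeriv_inv (isOpen_ball_diff_cross (σ / 2)) (hΦa.mono (hsub hσρ))
    (fun t ht => analyticAt_matrix_iff.2 fun p q => (hΨ p q).1 t ht)
    (fun t ht => hdet t (hsub hσρ ht)) ht (hΦd t htρ i) p q]
  have h1 : t i • -((Φ t)⁻¹ * (Ω i t * Φ t - (t i)⁻¹ • (Φ t * A i)) * (Φ t)⁻¹) =
      A i * (Φ t)⁻¹ - t i • ((Φ t)⁻¹ * Ω i t) := by
    rw [mul_sub, sub_mul, neg_sub, smul_sub]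
    congr 1
    · rw [mul_smul_comm, ← mul_assoc, Matrix.nonsing_inv_mul _ hu, one_mul, smul_mul_assoc,
        smul_smul, ← smul_mul_assoc, hcancel t htρ i]
    · rw [mul_assoc, mul_assoc, Matrix.mul_nonsing_inv _ hu, mul_one]
  exact congrFun (congrFun h1 p) q

end InverseFrame

/-! ### Formal Laurent series -/

section Formal

variable {m k : ℕ} {R : Type*} [Ring R]

/-- The coefficients of the product of two formal Laurent series. -/
noncomputable def conv (c d : (Fin m → ℤ) → R) (e : Fin m → ℤ) : R := ∑ᶠ a, c (e - a) * d a

/-- The family `d` has finitely many nonzero members below every exponent. -/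
def FiniteBelow (d : (Fin m → ℤ) → R) : Prop := ∀ e : Fin m → ℤ, {a | d a ≠ 0 ∧ a ≤ e}.Finite

variable {N N' : ℕ} {c d x : (Fin m → ℤ) → R}

lemma PoleOrderLE.le_add (hc : PoleOrderLE k N c) {e a : Fin m → ℤ} (h : c (e - a) ≠ 0) :
    a ≤ e + fun _ => (N : ℤ) := fun i => by
  have := hc.neg_le h i
  simp only [Pi.sub_apply, Pi.add_apply] at this ⊢
  omega

lemma FiniteBelow.finite_support (hx : FiniteBelow x) (hc : PoleOrderLE k N c) (e : Fin m → ℤ) :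
    (Function.support fun a => c (e - a) * x a).Finite :=
  (hx (e + fun _ => (N : ℤ))).subset fun _ ha =>
    ⟨right_ne_zero_of_mul ha, hc.le_add (left_ne_zero_of_mul ha)⟩

lemma exists_of_conv_ne_zero {e : Fin m → ℤ} (h : conv c x e ≠ 0) :
    ∃ a, c (e - a) ≠ 0 ∧ x a ≠ 0 := by
  by_contra! hall
  refine h (finsum_eq_zero_of_forall_eq_zero fun a => ?_)
  by_cases hc : c (e - a) = 0
  · rw [hc, zero_mul]
  · rw [hall a hc, mul_zero]

/-- The product of formal Laurent series is associative. -/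
theorem conv_assoc (hc : PoleOrderLE k N c) (hd : PoleOrderLE k N' d) (hx : FiniteBelow x) :
    conv (conv c d) x = conv c (conv d x) := by
  classical
  funext e
  have hcd : PoleOrderLE k (N + N') (conv c d) := hc.conv hd
  set S : Finset (Fin m → ℤ) := (hx (e + fun _ => ((N + N' : ℕ) : ℤ))).toFinset with hS
  set T : Finset (Fin m → ℤ) :=
    S.biUnion fun a => Finset.Icc (a - fun _ => (N' : ℤ)) (e + fun _ => (N : ℤ)) with hT
  have hlow : ∀ {b a : Fin m → ℤ}, d (b - a) ≠ 0 → (a - fun _ => (N' : ℤ)) ≤ b := by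
    intro b a h i
    have := hd.neg_le h i
    simp only [Pi.sub_apply] at this ⊢
    omega
  have hmemS : ∀ {b a : Fin m → ℤ}, b ≤ (e + fun _ => (N : ℤ)) → d (b - a) ≠ 0 → x a ≠ 0 →
      a ∈ S := fun {b a} hb h hxa => by
    refine (Set.Finite.mem_toFinset _).2 ⟨hxa, fun i => ?_⟩
    have h1 := hd.le_add h i
    have h2 := hb i
    simp only [Pi.add_apply] at h1 h2 ⊢
    push_cast
    omega
  have hinner1 : ∀ a ∈ S, conv c d (e - a) = ∑ b ∈ T, c (e - b) * d (b - a) := by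
    intro a ha
    rw [conv, ← finsum_comp_equiv (Equiv.subRight a)]
    have h1 : ∀ b, c (e - a - Equiv.subRight a b) * d (Equiv.subRight a b) =
        c (e - b) * d (b - a) := fun b => by
      rw [Equiv.subRight_apply, sub_sub_sub_cancel_right]
    simp only [h1]
    refine finsum_eq_sum_of_support_subset _ fun b hb => Finset.mem_coe.2
      (Finset.mem_biUnion.2 ⟨a, ha, Finset.mem_Icc.2 ⟨hlow (right_ne_zero_of_mul hb),
        hc.le_add (left_ne_zero_of_mul hb)⟩⟩)
  have hinner2 : ∀ b ∈ T, conv d x b = ∑ a ∈ S, d (b - a) * x a := by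
    intro b hb
    obtain ⟨a', -, hb'⟩ := Finset.mem_biUnion.1 hb
    exact finsum_eq_sum_of_support_subset _ fun a ha => Finset.mem_coe.2
      (hmemS (Finset.mem_Icc.1 hb').2 (left_ne_zero_of_mul ha) (right_ne_zero_of_mul ha))
  have h1 : conv (conv c d) x e = ∑ a ∈ S, conv c d (e - a) * x a :=
    finsum_eq_sum_of_support_subset _ fun a ha => Finset.mem_coe.2
      ((Set.Finite.mem_toFinset _).2 ⟨right_ne_zero_of_mul ha,
        hcd.le_add (left_ne_zero_of_mul ha)⟩)
  have h2 : conv c (conv d x) e = ∑ b ∈ T, c (e - b) * conv d x b := by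
    refine finsum_eq_sum_of_support_subset _ fun b hb => Finset.mem_coe.2 ?_
    obtain ⟨a, hda, hxa⟩ := exists_of_conv_ne_zero (right_ne_zero_of_mul hb)
    have hbe := hc.le_add (left_ne_zero_of_mul hb)
    exact Finset.mem_biUnion.2 ⟨a, hmemS hbe hda hxa, Finset.mem_Icc.2 ⟨hlow hda, hbe⟩⟩
  have h3 : ∑ a ∈ S, conv c d (e - a) * x a =
      ∑ a ∈ S, ∑ b ∈ T, c (e - b) * (d (b - a) * x a) :=
    Finset.sum_congr rfl fun a ha => by simp only [hinner1 a ha, Finset.sum_mul, mul_assoc]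
  have h4 : ∑ b ∈ T, c (e - b) * conv d x b =
      ∑ b ∈ T, ∑ a ∈ S, c (e - b) * (d (b - a) * x a) :=
    Finset.sum_congr rfl fun b hb => by rw [hinner2 b hb, Finset.mul_sum]
  rw [h1, h2, h3, h4, Finset.sum_comm]

lemma conv_single_one (x : (Fin m → ℤ) → R) : conv (Pi.single 0 1) x = x := by
  funext e
  rw [conv, finsum_eq_single _ e]
  · rw [sub_self, Pi.single_eq_same, one_mul]
  · intro a ha
    rw [Pi.single_eq_of_ne (sub_ne_zero.2 ha.symm), zero_mul]

lemma const_mul_conv (hc : PoleOrderLE k N c) (hx : FiniteBelow x) (r : R) (e : Fin m → ℤ) :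
    conv (fun a => r * c a) x e = r * conv c x e := by
  rw [conv, conv, mul_finsum' _ _ (hx.finite_support hc e)]
  simp only [mul_assoc]

lemma sub_conv (hc : PoleOrderLE k N c) (hd : PoleOrderLE k N' d) (hx : FiniteBelow x)
    (e : Fin m → ℤ) : conv (fun a => c a - d a) x e = conv c x e - conv d x e := by
  rw [conv, conv, conv, ← finsum_sub_distrib (hx.finite_support hc e) (hx.finite_support hd e)]
  simp only [sub_mul]

/-- The Leibniz rule for `t_i ∂/∂t_i` and formal Laurent series. -/
lemma euler_conv [Algebra ℂ R] (hc : PoleOrderLE k N c) (hx : FiniteBelow x) (i : Fin m)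
    (e : Fin m → ℤ) : (e i : ℂ) • conv c x e =
      conv (fun a => (a i : ℂ) • c a) x e + conv c (fun a => (a i : ℂ) • x a) e := by
  have h1 := hx.finite_support hc e
  have hc' : PoleOrderLE k N (fun a => (a i : ℂ) • c a) := fun a ha =>
    hc a (fun h => ha (by simp [h]))
  have hx' : FiniteBelow (fun a => (a i : ℂ) • x a) := fun e =>
    (hx e).subset fun a ha => ⟨fun h => ha.1 (by simp [h]), ha.2⟩
  rw [conv, conv, conv, smul_finsum' _ h1,
    ← finsum_add_distrib (hx.finite_support hc' e) (hx'.finite_support hc e)]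
  refine finsum_congr fun a => ?_
  rw [smul_mul_assoc, mul_smul_comm, ← add_smul]
  congr 1
  push_cast [Pi.sub_apply]
  ring

/-- If `ψ` transforms the formal system `t_i ∂/∂t_i - b_i` into `t_i ∂/∂t_i - A_i`, with constant
`A_i`, then `ψ x` solves the second system for every formal solution `x` of the first one. -/
theorem euler_conv_eq [Algebra ℂ R] {ψ b : (Fin m → ℤ) → R} (hψ : PoleOrderLE k N ψ)
    (hb : PoleOrderLE k N' b) (hx : FiniteBelow x) {A : R} {i : Fin m}
    (hψs : ∀ e, (e i : ℂ) • ψ e = A * ψ e - conv ψ b e)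
    (hxs : ∀ e, (e i : ℂ) • x e = conv b x e) (e : Fin m → ℤ) :
    (e i : ℂ) • conv ψ x e = A * conv ψ x e := by
  have hAψ : PoleOrderLE k N (fun a => A * ψ a) := fun a ha => hψ a (right_ne_zero_of_mul ha)
  rw [euler_conv hψ hx i e, funext hψs, funext hxs,
    sub_conv hAψ (d := conv ψ b) (hψ.conv hb) hx, const_mul_conv hψ hx]
  have h1 := congrFun (conv_assoc hψ hb hx) e
  change A * conv ψ x e - conv (conv ψ b) x e + conv ψ (conv b x) e = _
  rw [h1, sub_add_cancel]

end Formal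

section MatrixLaurent

variable {m n k : ℕ}

lemma PoleOrderLE.exists_of_entries {c : (Fin m → ℤ) → Matrix (Fin n) (Fin n) ℂ}
    (hc : ∀ p q, ∃ N, PoleOrderLE k N (fun a => c a p q)) : ∃ N, PoleOrderLE k N c := by
  choose N hN using hc
  refine ⟨∑ p, ∑ q, N p q, fun a ha => ?_⟩
  obtain ⟨p, q, hpq⟩ : ∃ p q, c a p q ≠ 0 := by
    by_contra! h
    exact ha (Matrix.ext h)
  refine PoleOrderLE.mono ?_ (hN p q) a hpq
  exact (Finset.single_le_sum (f := fun q => N p q) (fun _ _ => Nat.zero_le _)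
    (Finset.mem_univ q)).trans (Finset.single_le_sum (f := fun p => ∑ q, N p q)
      (fun _ _ => Nat.zero_le _) (Finset.mem_univ p))

lemma PoleOrderLE.entry {N : ℕ} {c : (Fin m → ℤ) → Matrix (Fin n) (Fin n) ℂ}
    (hc : PoleOrderLE k N c) (p q : Fin n) : PoleOrderLE k N (fun a => c a p q) :=
  fun a ha => hc a fun h => ha (by simp [h])

/-- The entries of a product of matrix Laurent series. -/
lemma conv_entry {N N' : ℕ} {c d : (Fin m → ℤ) → Matrix (Fin n) (Fin n) ℂ}
    (hc : PoleOrderLE k N c) (hd : PoleOrderLE k N' d) (e : Fin m → ℤ) (p q : Fin n) :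
    conv c d e p q = ∑ r, ∑ᶠ a, c (e - a) p r * d a r q := by
  set S := Finset.Icc (fun _ => -(N' : ℤ)) (e + fun _ => (N : ℤ)) with hS
  rw [conv, finsum_eq_sum_of_support_subset _ (HasLaurentExpansion.finite_support_conv hc hd e),
    Finset.sum_congr rfl fun r _ => finsum_eq_sum_of_support_subset _
      (HasLaurentExpansion.finite_support_conv (hc.entry p r) (hd.entry r q) e),
    Matrix.sum_apply, Finset.sum_comm]
  rfl

/-- The Laurent expansion of a product of matrices. -/
lemma hasLaurentExpansion_matrix_mul {X Y : (Fin m → ℂ) → Matrix (Fin n) (Fin n) ℂ}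
    {c d : (Fin m → ℤ) → Matrix (Fin n) (Fin n) ℂ}
    (hX : ∀ p q, HasLaurentExpansion k (fun t => X t p q) (fun a => c a p q))
    (hY : ∀ p q, HasLaurentExpansion k (fun t => Y t p q) (fun a => d a p q)) (p q : Fin n) :
    HasLaurentExpansion k (fun t => (X t * Y t) p q) (fun e => conv c d e p q) := by
  obtain ⟨N, hN⟩ := PoleOrderLE.exists_of_entries fun p q => (hX p q).poleOrderLE
  obtain ⟨N', hN'⟩ := PoleOrderLE.exists_of_entries fun p q => (hY p q).poleOrderLE
  have h1 := HasLaurentExpansion.sum Finset.univ fun r _ => (hX p r).mul (hY r q)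
  simp only [conv_entry hN hN']
  exact h1

/-- A matrix of functions of moderate growth has a Laurent expansion. -/
lemma exists_hasLaurentExpansion_matrix {ρ : ℝ} (hρ : 0 < ρ)
    {X : (Fin m → ℂ) → Matrix (Fin n) (Fin n) ℂ} (hX : ∀ p q, IsModerate k ρ (fun t => X t p q)) :
    ∃ c : (Fin m → ℤ) → Matrix (Fin n) (Fin n) ℂ,
      ∀ p q, HasLaurentExpansion k (fun t => X t p q) (fun a => c a p q) := by
  choose c hc using fun p q => (hX p q).exists_hasLaurentExpansion hρ
  exact ⟨fun a => Matrix.of fun p q => c p q a, hc⟩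

end MatrixLaurent

section Monomials

variable {m k : ℕ} {ρ : ℝ}

lemma IsModerate.coord (hρ : ρ ≤ 1) (i : Fin m) :
    IsModerate k ρ (fun t : Fin m → ℂ => t i) := by
  refine ⟨fun t _ => (ContinuousLinearMap.proj (R := ℂ) (φ := fun _ : Fin m => ℂ) i).analyticAt t,
    1, 0, fun t ht => ?_⟩
  rw [pow_zero, one_mul]
  exact (norm_le_pi_norm t i).trans ((mem_ball_zero_iff.1 ht.1).le.trans hρ)

lemma IsModerate.inv_coord (hρ : ρ ≤ 1) {i : Fin m} (hi : (i : ℕ) < k) :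
    IsModerate k ρ (fun t : Fin m → ℂ => (t i)⁻¹) := by
  refine ⟨fun t ht => ((IsModerate.coord (k := k) hρ i).1 t ht).inv (notMem_cross_iff.1 ht.2 i hi),
    1, 1, fun t ht => ?_⟩
  have h0 : ‖t i‖ ≠ 0 := norm_ne_zero_iff.2 (notMem_cross_iff.1 ht.2 i hi)
  rw [pow_one, norm_crossEq, ← Finset.mul_prod_erase _ _
    (Finset.mem_filter.2 ⟨Finset.mem_univ i, hi⟩), norm_inv, mul_right_comm, mul_inv_cancel₀ h0,
    one_mul]
  refine Finset.prod_le_one (fun _ _ => norm_nonneg _) fun j _ => ?_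
  exact (norm_le_pi_norm t j).trans ((mem_ball_zero_iff.1 ht.1).le.trans hρ)

/-- A Laurent monomial in the first `k` coordinates has moderate growth. -/
lemma IsModerate.monomial (hρ : ρ ≤ 1) {e : Fin m → ℤ} (he : ∀ i : Fin m, ¬ (i : ℕ) < k → e i = 0) :
    IsModerate k ρ (fun t : Fin m → ℂ => ∏ i, t i ^ e i) := by
  refine IsModerate.prod _ fun i _ => ?_
  have hpow : ∀ {g : (Fin m → ℂ) → ℂ}, IsModerate k ρ g → ∀ N : ℕ,
      IsModerate k ρ (fun t => g t ^ N) := fun {g} hg N => by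
    have := IsModerate.prod (Finset.range N) fun _ _ => hg
    simpa using this
  by_cases hi : (i : ℕ) < k
  · obtain ⟨N, hN | hN⟩ := (e i).eq_nat_or_neg
    · simpa only [hN, zpow_natCast] using hpow (IsModerate.coord hρ i) N
    · simpa only [hN, zpow_neg, zpow_natCast, inv_pow] using hpow (IsModerate.inv_coord hρ hi) N
  · simpa only [he i hi, zpow_zero] using IsModerate.const ρ 1

lemma partialDeriv_monomial {e : Fin m → ℤ} (he : ∀ i : Fin m, ¬ (i : ℕ) < k → e i = 0)
    {t : Fin m → ℂ} (ht : t ∉ cross m k) (i : Fin m) :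
    partialDeriv i (fun t : Fin m → ℂ => ∏ i, t i ^ e i) t =
      (t i)⁻¹ * ((e i : ℂ) * ∏ i, t i ^ e i) := by
  have h0 : ∀ j, t j ≠ 0 ∨ 0 ≤ e j := fun j => by
    by_cases hj : (j : ℕ) < k
    · exact Or.inl (notMem_cross_iff.1 ht j hj)
    · exact Or.inr (he j hj).ge
  have h1 := HasFDerivAt.finsetProd (u := Finset.univ) (x := t) fun j _ =>
    (hasDerivAt_zpow (e j) (t j) (h0 j)).comp_hasFDerivAt t
      (ContinuousLinearMap.proj (R := ℂ) (φ := fun _ : Fin m => ℂ) j).hasFDerivAt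
  rw [partialDeriv]
  have h2 : (fun t : Fin m → ℂ => ∏ i, t i ^ e i) = fun t => ∏ j, ((fun z : ℂ => z ^ e j) ∘
    (ContinuousLinearMap.proj (R := ℂ) (φ := fun _ : Fin m => ℂ) j)) t := rfl
  rw [h2, h1.fderiv]
  simp only [_root_.sum_apply, _root_.smul_apply, ContinuousLinearMap.proj_apply]
  rw [Finset.sum_eq_single i (fun j _ hj => by rw [Pi.single_eq_of_ne hj]; simp) (by simp)]
  by_cases hi : (i : ℕ) < k
  · have hti := notMem_cross_iff.1 ht i hi
    rw [← Finset.mul_prod_erase _ _ (Finset.mem_univ i), zpow_sub_one₀ hti]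
    simp
    ring
  · simp [he i hi]

end Monomials

/-! ### Convergence of formal solutions -/

section Convergence

variable {m n k : ℕ}

/-- The Laurent coefficients of the inverse frame `Ψ`, which satisfies
`t_i ∂Ψ/∂t_i = A_i Ψ - Ψ (t_i Ω_i)`. -/
lemma euler_coeff_eq {ρ : ℝ} (hρ : 0 < ρ) {Ω : MatrixForm m n}
    {b : Fin m → (Fin m → ℤ) → Matrix (Fin n) (Fin n) ℂ}
    (hb : ∀ i p q, HasLaurentExpansion k (fun t => Ω i t p q) (fun a => b i a p q))
    {Ψ : (Fin m → ℂ) → Matrix (Fin n) (Fin n) ℂ} {A : Fin m → Matrix (Fin n) (Fin n) ℂ}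
    (hΨ : ∀ p q, IsModerate k ρ (fun t => Ψ t p q))
    (hΨs : ∀ t ∈ ball 0 ρ \ cross m k, ∀ i p q, t i * partialDeriv i (fun s => Ψ s p q) t =
      (A i * Ψ t) p q - t i * (Ψ t * Ω i t) p q)
    {ψ : (Fin m → ℤ) → Matrix (Fin n) (Fin n) ℂ}
    (hψ : ∀ p q, HasLaurentExpansion k (fun t => Ψ t p q) (fun a => ψ a p q)) (i : Fin m)
    (e : Fin m → ℤ) :
    (e i : ℂ) • ψ e = A i * ψ e - conv ψ (fun a => b i (a - Pi.single i 1)) e := by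
  ext p q
  have h1 := (hψ p q).euler hρ (hΨ p q).1 i
  have h2 : HasLaurentExpansion k (fun t => (A i * Ψ t) p q) (fun a => (A i * ψ a) p q) :=
    HasLaurentExpansion.sum Finset.univ fun r _ => (hψ r q).const_mul (A i p r)
  have h3 := hasLaurentExpansion_matrix_mul hψ (Y := fun t => t i • Ω i t)
    (fun p q => (hb i p q).coord_mul i) p q
  refine congrFun (h1.unique (h2.sub h3) hρ fun t ht => ?_) e
  rw [hΨs t ht, mul_smul_comm]
  rfl

/-- A solution of `t_i ∂y/∂t_i = A_i y` with `A_i = 0` for `i ≥ k` is a Laurent polynomial in the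
first `k` coordinates, as `|e_i| ≤ ‖A_i‖` for all its exponents. -/
lemma finite_support_of_euler_eq {A : Fin m → Matrix (Fin n) (Fin n) ℂ}
    (hA : ∀ i : Fin m, ¬ (i : ℕ) < k → A i = 0) {y : (Fin m → ℤ) → Matrix (Fin n) (Fin n) ℂ}
    (hy : ∀ i e, (e i : ℂ) • y e = A i * y e) :
    (Function.support y).Finite ∧ ∀ e, y e ≠ 0 → ∀ i : Fin m, ¬ (i : ℕ) < k → e i = 0 := by
  let : NormedRing (Matrix (Fin n) (Fin n) ℂ) := Matrix.linftyOpNormedRing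
  let : NormedAlgebra ℂ (Matrix (Fin n) (Fin n) ℂ) := Matrix.linftyOpNormedAlgebra
  refine ⟨?_, fun e he i hi => ?_⟩
  · set K : Fin m → ℤ := fun i => ⌈‖A i‖⌉ with hK
    refine (Set.finite_Icc (-K) K).subset fun e he => ?_
    have h1 : ∀ i, |e i| ≤ K i := fun i => by
      have h2 : ‖((e i : ℤ) : ℂ)‖ * ‖y e‖ ≤ ‖A i‖ * ‖y e‖ := by
        rw [← norm_smul, hy i e]
        exact norm_mul_le _ _
      have h3 := le_of_mul_le_mul_right h2 (norm_pos_iff.2 he)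
      rw [Complex.norm_intCast, ← Int.cast_abs] at h3
      exact_mod_cast h3.trans (Int.le_ceil _)
    exact ⟨fun i => (abs_le.1 (h1 i)).1, fun i => (abs_le.1 (h1 i)).2⟩
  · have h1 := hy i e
    rw [hA i hi, zero_mul, smul_eq_zero] at h1
    exact_mod_cast h1.resolve_right he

lemma partialDeriv_sum_mul {ι : Type*} [Fintype ι] {g h : ι → (Fin m → ℂ) → ℂ} {t : Fin m → ℂ}
    (hg : ∀ r, DifferentiableAt ℂ (g r) t) (hh : ∀ r, DifferentiableAt ℂ (h r) t) (i : Fin m) :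
    partialDeriv i (fun s => ∑ r, g r s * h r s) t =
      ∑ r, (g r t * partialDeriv i (h r) t + partialDeriv i (g r) t * h r t) := by
  simp only [partialDeriv]
  rw [fderiv_fun_sum fun r _ => (hg r).fun_mul (hh r), _root_.sum_apply]
  refine Finset.sum_congr rfl fun r _ => ?_
  rw [fderiv_fun_mul (hg r) (hh r)]
  simp only [_root_.add_apply, _root_.smul_apply, smul_eq_mul]
  ring

/-- A formal matrix solution converges: after the change of frame it becomes a Laurent
polynomial. -/
theorem exists_moderate_solution {U : Set (Fin m → ℂ)} (hU : IsOpen U) (h0 : 0 ∈ U)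
    {Ω : MatrixForm m n} (hmero : MatrixForm.IsMeromorphicOn k U Ω)
    (hint : MatrixForm.IsIntegrableOn Ω (U \ cross m k)) (hreg : HasRegularSingularity k U Ω)
    {b : Fin m → (Fin m → ℤ) → Matrix (Fin n) (Fin n) ℂ}
    (hb : ∀ i p q, HasLaurentExpansion k (fun t => Ω i t p q) (fun a => b i a p q))
    {x : (Fin m → ℤ) → Matrix (Fin n) (Fin n) ℂ} (hx : FiniteBelow x)
    (hxs : ∀ i e, (e i : ℂ) • x e = conv (fun a => b i (a - Pi.single i 1)) x e) :
    ∃ (ρ : ℝ) (F : (Fin m → ℂ) → Matrix (Fin n) (Fin n) ℂ), 0 < ρ ∧ ball 0 ρ ⊆ U ∧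
      (∀ p q, IsModerate k ρ (fun t => F t p q)) ∧
      (∀ p q, HasLaurentExpansion k (fun t => F t p q) (fun a => x a p q)) ∧
      ∀ t ∈ ball 0 ρ \ cross m k, ∀ i p q,
        partialDeriv i (fun s => F s p q) t = (Ω i t * F t) p q := by
  obtain ⟨ρ, Φ, Ψ, A, hρ0, hρ1, hρU, hΦ, hΨ, hΦΨ, hA, hΦs, hΨs⟩ :=
    exists_moderate_frame_pair hU h0 hmero hint hreg hb
  obtain ⟨φ, hφ⟩ := exists_hasLaurentExpansion_matrix hρ0 hΦ
  obtain ⟨ψ, hψ⟩ := exists_hasLaurentExpansion_matrix hρ0 hΨ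
  obtain ⟨N, hφN⟩ := PoleOrderLE.exists_of_entries fun p q => (hφ p q).poleOrderLE
  obtain ⟨N', hψN⟩ := PoleOrderLE.exists_of_entries fun p q => (hψ p q).poleOrderLE
  have hφψ : conv φ ψ = Pi.single 0 1 := by
    have h1 : ∀ p q, (fun e => conv φ ψ e p q) =
        fun a => (1 : Matrix (Fin n) (Fin n) ℂ) p q * (Pi.single 0 1 : (Fin m → ℤ) → ℂ) a :=
      fun p q => (hasLaurentExpansion_matrix_mul hφ hψ p q).unique
        (HasLaurentExpansion.const _) hρ0 fun t ht => by rw [hΦΨ t ht]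
    funext e
    ext p q
    refine (congrFun (h1 p q) e).trans ?_
    by_cases he : e = 0
    · subst he
      simp
    · simp [Pi.single_eq_of_ne he]
  set y := conv ψ x with hy
  have hφy : conv φ y = x := by
    rw [hy, ← conv_assoc hφN hψN hx, hφψ, conv_single_one]
  have hys : ∀ i e, (e i : ℂ) • y e = A i * y e := by
    intro i e
    obtain ⟨N₁, hN₁⟩ := PoleOrderLE.exists_of_entries (k := k)
      (c := fun a => b i (a - Pi.single i 1)) fun p q => ((hb i p q).coord_mul i).poleOrderLE
    exact euler_conv_eq hψN hN₁ hx (euler_coeff_eq hρ0 hb hΨ hΨs hψ i) (hxs i) e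
  obtain ⟨hfin, hsupp⟩ := finite_support_of_euler_eq hA hys
  set S := hfin.toFinset with hS
  have hmemS : ∀ {e}, e ∈ S ↔ y e ≠ 0 := fun {e} => hfin.mem_toFinset
  set Y : (Fin m → ℂ) → Matrix (Fin n) (Fin n) ℂ := fun t =>
    ∑ e ∈ S, (∏ i, t i ^ e i) • y e with hY
  have hYe : ∀ t p q, Y t p q = ∑ e ∈ S, y e p q * ∏ i, t i ^ e i := by
    intro t p q
    simp only [hY, Matrix.sum_apply, Matrix.smul_apply, smul_eq_mul, mul_comm]
  have hYL : ∀ p q, HasLaurentExpansion k (fun t => Y t p q) (fun a => y a p q) := by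
    intro p q
    have h1 := HasLaurentExpansion.sum S fun e he => (HasLaurentExpansion.monomial (k := k)
      (e := e) fun i hi => (hsupp e (hmemS.1 he) i hi).ge).const_mul (y e p q)
    have h2 : (fun a => ∑ e ∈ S, y e p q * (Pi.single e 1 : (Fin m → ℤ) → ℂ) a) =
        fun a => y a p q := by
      funext a
      simp only [Pi.single_apply, mul_ite, mul_one, mul_zero, Finset.sum_ite_eq]
      split_ifs with ha
      · rfl
      · rw [hmemS, not_not] at ha
        simp [ha]
    simp only [hYe]
    rwa [h2] at h1
  have hYm : ∀ p q, IsModerate k ρ (fun t => Y t p q) := by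
    intro p q
    simp only [hYe]
    exact IsModerate.sum hρ1 S fun e he => (IsModerate.const ρ _).mul
      (IsModerate.monomial hρ1 (hsupp e (hmemS.1 he)))
  have hYs : ∀ t ∈ ball 0 ρ \ cross m k, ∀ i p q,
      partialDeriv i (fun s => Y s p q) t = (t i)⁻¹ * (A i * Y t) p q := by
    intro t ht i p q
    have hd : ∀ e ∈ S, DifferentiableAt ℂ (fun t : Fin m → ℂ => ∏ i, t i ^ e i) t := fun e he =>
      ((IsModerate.monomial hρ1 (hsupp e (hmemS.1 he))).1 t ht).differentiableAt
    have h1 : partialDeriv i (fun s => Y s p q) t = ∑ e ∈ S, y e p q *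
        partialDeriv i (fun t : Fin m → ℂ => ∏ i, t i ^ e i) t := by
      simp only [hYe, partialDeriv]
      rw [fderiv_fun_sum fun e he => (hd e he).const_mul _, _root_.sum_apply]
      refine Finset.sum_congr rfl fun e he => ?_
      rw [fderiv_const_mul (hd e he), _root_.smul_apply, smul_eq_mul]
    have h2 : A i * Y t = ∑ e ∈ S, (∏ i, t i ^ e i) • ((e i : ℂ) • y e) := by
      simp only [hY, Finset.mul_sum, mul_smul_comm, hys]
    rw [h1, h2, Matrix.sum_apply, Finset.mul_sum]
    refine Finset.sum_congr rfl fun e he => ?_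
    rw [partialDeriv_monomial (hsupp e (hmemS.1 he)) ht.2, Matrix.smul_apply, Matrix.smul_apply,
      smul_eq_mul, smul_eq_mul]
    ring
  refine ⟨ρ, fun t => Φ t * Y t, hρ0, hρU, fun p q => ?_, fun p q => ?_, fun t ht i p q => ?_⟩
  · exact IsModerate.sum hρ1 Finset.univ fun r _ => (hΦ p r).mul (hYm r q)
  · have h1 := hasLaurentExpansion_matrix_mul hφ hYL p q
    rwa [hφy] at h1
  · have hdΦ : ∀ r, DifferentiableAt ℂ (fun s => Φ s p r) t := fun r =>
      ((hΦ p r).1 t ht).differentiableAt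
    have hdY : ∀ r, DifferentiableAt ℂ (fun s => Y s r q) t := fun r =>
      ((hYm r q).1 t ht).differentiableAt
    have h1 : partialDeriv i (fun s => (Φ s * Y s) p q) t =
        ∑ r, (Φ t p r * ((t i)⁻¹ * (A i * Y t) r q) +
          ((Ω i t * Φ t) p r - (t i)⁻¹ * (Φ t * A i) p r) * Y t r q) := by
      refine (partialDeriv_sum_mul hdΦ hdY i).trans (Finset.sum_congr rfl fun r _ => ?_)
      rw [hYs t ht, hΦs t ht]
    have h2 : Φ t * ((t i)⁻¹ • (A i * Y t)) + (Ω i t * Φ t - (t i)⁻¹ • (Φ t * A i)) * Y t =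
        Ω i t * (Φ t * Y t) := by
      rw [sub_mul, mul_smul_comm, smul_mul_assoc, ← mul_assoc, ← mul_assoc, add_sub_cancel]
    rw [h1, ← h2, Finset.sum_add_distrib]
    rfl

end Convergence

end PfaffianSystem

theorem mainTheorem9 {m n k : ℕ} (hk : k ≤ m)
    (U : Set (Fin m → ℂ)) (hU : IsOpen U) (h0 : (0 : Fin m → ℂ) ∈ U)
    (Ω : PfaffianSystem.MatrixForm m n)
    (hmero : PfaffianSystem.MatrixForm.IsMeromorphicOn k U Ω)
    (hint : PfaffianSystem.MatrixForm.IsIntegrableOn Ω (U \ PfaffianSystem.cross m k))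
    (hreg : PfaffianSystem.HasRegularSingularity k U Ω)
    (x : (Fin m → ℤ) → Fin n → ℂ)
    (hx : PfaffianSystem.IsFormalLaurentSeries k x)
    (hsol : PfaffianSystem.IsFormalSolution k Ω x) :
    ∃ (V : Set (Fin m → ℂ)) (F : (Fin m → ℂ) → Fin n → ℂ),
      IsOpen V ∧ 0 ∈ V ∧ V ⊆ U ∧
      (∀ p, PfaffianSystem.IsMeromorphicOn k V (fun t => F t p)) ∧
      (∀ p, PfaffianSystem.HasLaurentExpansion k (fun t => F t p) (fun a => x a p)) ∧
      PfaffianSystem.IsSolutionOn Ω (V \ PfaffianSystem.cross m k) F := by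
  obtain ⟨b, hb, hs⟩ := hsol
  rcases isEmpty_or_nonempty (Fin n) with hn | ⟨⟨q⟩⟩
  · exact ⟨U, fun _ => isEmptyElim, hU, h0, subset_rfl, isEmptyElim, isEmptyElim, isEmptyElim,
      fun _ _ _ => isEmptyElim⟩
  -- the square matrix series all of whose columns are `x`
  set X : (Fin m → ℤ) → Matrix (Fin n) (Fin n) ℂ := fun a => Matrix.of fun p _ => x a p with hX
  have hX0 : ∀ a, X a ≠ 0 → x a ≠ 0 := fun a ha h => ha (by ext p r; simp [hX, h])
  have hXfin : PfaffianSystem.FiniteBelow X := fun e =>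
    (hx.2 e).subset fun a ha => ⟨hX0 a ha.1, ha.2⟩
  have hXs : ∀ i e, (e i : ℂ) • X e =
      PfaffianSystem.conv (fun a => b i (a - Pi.single i 1)) X e := by
    intro i e
    obtain ⟨N, hN⟩ := PfaffianSystem.PoleOrderLE.exists_of_entries (k := k)
      (c := fun a => b i (a - Pi.single i 1)) fun p r => ((hb i p r).coord_mul i).poleOrderLE
    have hfin := hXfin.finite_support hN e
    have h1 := hs i (e - Pi.single i 1)
    rw [sub_add_cancel, Pi.sub_apply, Pi.single_eq_same, Int.cast_sub, Int.cast_one,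
      sub_add_cancel] at h1
    ext p r
    let col : Matrix (Fin n) (Fin n) ℂ →+ (Fin n → ℂ) :=
      { toFun := fun M p => M p r
        map_zero' := rfl
        map_add' := fun _ _ => rfl }
    have h2 : col (PfaffianSystem.conv (fun a => b i (a - Pi.single i 1)) X e) =
        ∑ᶠ a, col (b i (e - a - Pi.single i 1) * X a) := col.map_finsum hfin
    have h3 : ∀ a, col (b i (e - a - Pi.single i 1) * X a) =
        b i (e - Pi.single i 1 - a) *ᵥ x a := fun a => by
      rw [sub_right_comm]
      rfl
    simp only [h3] at h2
    exact congrFun (h1.trans h2.symm) p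
  obtain ⟨ρ, F, hρ, hρU, hF, hFL, hFs⟩ :=
    PfaffianSystem.exists_moderate_solution hU h0 hmero hint hreg hb hXfin hXs
  exact ⟨Metric.ball 0 ρ, fun t p => F t p q, Metric.isOpen_ball, Metric.mem_ball_self hρ, hρU,
    fun p => (hF p q).isMeromorphicOn, fun p => hFL p q, fun p => (hF p q).1,
    fun t ht i p => hFs t ht i p q⟩
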